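/- **Setting.** A pseudo-Riemannian metric $g$ is a *Ricci soliton* if $\mathcal L_X g+\varrho=\lambda g$ for some smooth vector field $X$ and some $\lambda\in\mathbb R$, where $\varrho$ is the Ricci tensor. It is an *invariant Ricci soliton* on $M=G/H$ if $g$ and $X$ are both $G$-invariant. It is *Einstein* if $\varrho=\lambda g$ for some constant $\lambda$. A *solvsoliton* is a left-invariant metric on a solvable Lie group that is a Ricci soliton. A pair $(\mathfrak g,\mathfrak h)$ of Lie algebras is *reductive* if $\mathfrak h$ has a complement $\mathfrak m$ in $\mathfrak g$ with $[\mathfrak h,\mathfrak m]\subseteq\mathfrak m$. Homogeneous spaces $G/H$ are taken with $G$ simply connected and $H$ connected. Consider the following five-dimensional Lie algebras with basis $e_1,u_1,u_2,u_3,u_4$ and $\mathfrak h=\mathbb R e_1$ (brackets of basis vectors that are not listed vanish). * Type $1.3^1.1$: $[e_1,u_1]=e_1$, $[e_1,u_3]=u_1$, $[e_1,u_4]=u_2$, $[u_1,u_2]=-\frac12u_2$, $[u_1,u_3]=u_3$, $[u_1,u_4]=\frac12u_4$, $[u_2,u_3]=\frac12u_4$. * Type $1.4^1.2$ with parameter $p\in\mathbb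 R$: $[e_1,u_2]=u_1$, $[e_1,u_3]=u_2$, $[e_1,u_4]=e_1$, $[u_1,u_4]=pu_1$, $[u_2,u_4]=(p-1)u_2$, $[u_3,u_4]=(p-2)u_3$. **Statement.** 1. The pair of type $1.3^1.1$ is isomorphic to the Fels–Renner pair B1, that is, $\mathfrak g=\mathfrak{sl}(2,\mathbb R)\ltimes\mathbb R^2$ with $[e_1,e_2]=2e_2$, $[e_1,e_3]=-2e_3$, $[e_2,e_3]=e_1$, $[e_1,e_4]=e_4$, $[e_1,e_5]=-e_5$, $[e_2,e_5]=e_4$, $[e_3,e_4]=e_5$ and $\mathfrak h=\mathbb Re_3$. The pair of type $1.4^1.2$ with parameter $p$ is isomorphic to the Fels–Renner pair A2 with $\alpha=p-1$, that is, $[e_1,e_5]=(\alpha+1)e_1$, $[e_2,e_4]=e_1$, $[e_2,e_5]=\alpha e_2$, $[e_3,e_4]=e_2$, $[e_3,e_5]=(\alpha-1)e_3$, $[e_4,e_5]=e_4$ and $\mathfrak h=\mathbb Re_4$. 2. The pair of type $1.3^1.1$ is non-reductive and is realized by a homogeneous space $M=G/H$ diffeomorphic to $\mathbb R^4$ (hence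 non-compact). For all real $a,b,c$ with $a\ne0$ and $c\ne0$ there is a $G$-invariant pseudo-Riemannian metric $g$ on $M$ whose only nonzero components at the base point with respect to $(u_i)$ are $g(u_1,u_4)=a$, $g(u_2,u_3)=-a$, $g(u_3,u_3)=b$, $g(u_3,u_4)=c$ (and the symmetric ones). It is a non-Einstein invariant Ricci soliton with $\lambda=0$, and $(M,g)$ is not isometric to any Lie group with a left-invariant metric; in particular it is not isometric to a solvsoliton. Hence there are non-compact homogeneous, and even invariant, pseudo-Riemannian Ricci solitons that are not isometric to any Lie group with a left-invariant metric. 3. For every $p\in\mathbb R$ the pair of type $1.4^1.2$ is non-reductive and is realized by a homogeneous space $M=G/H$ diffeomorphic to $\mathbb R^4$. For $p=1$ and all real $a,b,c,d$ with $a\ne0$ and $d\ne0$ there is a $G$-invariant pseudo-Riemannian metric $g$ on $M$ whose only nonzero components at the base point are $g(u_1,u_3)=-a$, $g(u_2,u_2)=a$, $g(u_3,u_3)=b$, $g(u_3,u_4)=c$, $g(u_4,u_4)=d$ (and the symmetric ones). It is an invariant Ricci soliton with $\lambda=0$, and it is not Einstein if $b\neq0$. -/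

import Mathlib

open scoped Manifold ContDiff

noncomputable section

/-! ### Pseudo-Riemannian metrics, Ricci tensor, Ricci solitons

`EuclideanSpace ℝ (Fin n)` with `𝓡 n` is the model of `n`-dimensional real manifolds. -/

/-- A smooth pseudo-Riemannian metric on an `n`-dimensional manifold: a smooth field of symmetric
nondegenerate bilinear forms on the tangent spaces (of any signature). -/
structure PseudoRiemannianMetric (n : ℕ) (M : Type) [TopologicalSpace M]
    [ChartedSpace (EuclideanSpace ℝ (Fin n)) M] [IsManifold (𝓡 n) ∞ M] where
  form : ∀ x : M, TangentSpace (𝓡 n) x →L[ℝ] TangentSpace (𝓡 n) x →L[ℝ] ℝ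
  symm : ∀ (x : M) (v w : TangentSpace (𝓡 n) x), form x v w = form x w v
  nondegenerate : ∀ (x : M) (v : TangentSpace (𝓡 n) x), (∀ w, form x v w = 0) → v = 0
  smooth : ContMDiff (𝓡 n) ((𝓡 n).prod
      𝓘(ℝ, EuclideanSpace ℝ (Fin n) →L[ℝ] EuclideanSpace ℝ (Fin n) →L[ℝ] ℝ)) ∞
    (fun x : M ↦ Bundle.TotalSpace.mk'
      (EuclideanSpace ℝ (Fin n) →L[ℝ] EuclideanSpace ℝ (Fin n) →L[ℝ] ℝ)
      (E := fun x : M ↦ TangentSpace (𝓡 n) x →L[ℝ] TangentSpace (𝓡 n) x →L[ℝ] ℝ) x (form x))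

/-- The partial derivative `∂f/∂yⁱ` of a function on `ℝⁿ`. -/
def partialD {n : ℕ} (i : Fin n) (f : EuclideanSpace ℝ (Fin n) → ℝ)
    (y : EuclideanSpace ℝ (Fin n)) : ℝ :=
  fderiv ℝ f y (EuclideanSpace.single i 1)

/-- Christoffel symbols `Γᵏᵢⱼ` of a field of matrices `(Gᵢⱼ)` on (an open subset of) `ℝⁿ`. -/
def christoffel {n : ℕ} (G : EuclideanSpace ℝ (Fin n) → Matrix (Fin n) (Fin n) ℝ)
    (k i j : Fin n) (y : EuclideanSpace ℝ (Fin n)) : ℝ :=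
  (1 / 2) * ∑ l, (G y)⁻¹ k l *
    (partialD i (fun z ↦ G z j l) y + partialD j (fun z ↦ G z i l) y
      - partialD l (fun z ↦ G z i j) y)

/-- Components `Rᵢⱼ` of the Ricci tensor (the trace of `Z ↦ R(Z, ∂ᵢ)∂ⱼ`) of a field of matrices. -/
def ricciCoord {n : ℕ} (G : EuclideanSpace ℝ (Fin n) → Matrix (Fin n) (Fin n) ℝ)
    (i j : Fin n) (y : EuclideanSpace ℝ (Fin n)) : ℝ :=
  ∑ k, (partialD k (christoffel G k i j) y - partialD j (christoffel G k i k) y)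
    + ∑ k, ∑ l, (christoffel G k k l y * christoffel G l i j y
        - christoffel G k j l y * christoffel G l i k y)

/-- Components of the Lie derivative `ℒ_X g`, for `g = (Gᵢⱼ)` and `X = (Xᵏ)` on `ℝⁿ`. -/
def lieDerivCoord {n : ℕ} (X : EuclideanSpace ℝ (Fin n) → EuclideanSpace ℝ (Fin n))
    (G : EuclideanSpace ℝ (Fin n) → Matrix (Fin n) (Fin n) ℝ)
    (i j : Fin n) (y : EuclideanSpace ℝ (Fin n)) : ℝ :=
  ∑ k, (X y k * partialD k (fun z ↦ G z i j) y
    + G y k j * partialD i (fun z ↦ X z k) y + G y i k * partialD j (fun z ↦ X z k) y)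

section Manifold

variable {n : ℕ} {M : Type} [TopologicalSpace M] [ChartedSpace (EuclideanSpace ℝ (Fin n)) M]

/-- The components, in the preferred chart at `x`, of a tangent vector at `x`. -/
def tangentCoord (x : M) (v : TangentSpace (𝓡 n) x) : EuclideanSpace ℝ (Fin n) :=
  mfderiv (𝓡 n) 𝓘(ℝ, EuclideanSpace ℝ (Fin n)) (extChartAt (𝓡 n) x) x v

/-- A vector field read in the preferred chart at `x`. -/
def fieldInChart (X : ∀ y : M, TangentSpace (𝓡 n) y) (x : M) (y : EuclideanSpace ℝ (Fin n)) :
    EuclideanSpace ℝ (Fin n) :=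
  mfderiv (𝓡 n) 𝓘(ℝ, EuclideanSpace ℝ (Fin n)) (extChartAt (𝓡 n) x)
    ((extChartAt (𝓡 n) x).symm y) (X ((extChartAt (𝓡 n) x).symm y))

/-- Smooth vector fields. -/
def IsSmoothField (X : ∀ y : M, TangentSpace (𝓡 n) y) [IsManifold (𝓡 n) ∞ M] : Prop :=
  ContMDiff (𝓡 n) (𝓡 n).tangent ∞
    (fun y : M ↦ (⟨y, X y⟩ : Bundle.TotalSpace (EuclideanSpace ℝ (Fin n))
      (fun y : M ↦ TangentSpace (𝓡 n) y)))

/-- A vector field invariant under the action of a group `A`. -/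
def IsInvariantField (A : Type) [Group A] [MulAction A M]
    (X : ∀ y : M, TangentSpace (𝓡 n) y) : Prop :=
  ∀ (a : A) (x : M), mfderiv (𝓡 n) (𝓡 n) (fun y : M ↦ a • y) x (X x) = X (a • x)

namespace PseudoRiemannianMetric

variable [IsManifold (𝓡 n) ∞ M] (g : PseudoRiemannianMetric n M)

/-- The matrix `gᵢⱼ = g(∂ᵢ, ∂ⱼ)` of the metric in the preferred chart at `x`. -/
def inChart (x : M) (y : EuclideanSpace ℝ (Fin n)) : Matrix (Fin n) (Fin n) ℝ :=
  Matrix.of fun i j ↦ g.form ((extChartAt (𝓡 n) x).symm y)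
    (mfderiv 𝓘(ℝ, EuclideanSpace ℝ (Fin n)) (𝓡 n) (extChartAt (𝓡 n) x).symm y
      (EuclideanSpace.single i (1 : ℝ) : EuclideanSpace ℝ (Fin n)))
    (mfderiv 𝓘(ℝ, EuclideanSpace ℝ (Fin n)) (𝓡 n) (extChartAt (𝓡 n) x).symm y
      (EuclideanSpace.single j (1 : ℝ) : EuclideanSpace ℝ (Fin n)))

/-- The Ricci tensor of the Levi-Civita connection of `g`. -/
def ricci (x : M) (v w : TangentSpace (𝓡 n) x) : ℝ :=
  ∑ i, ∑ j, tangentCoord x v i * tangentCoord x w j *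
    ricciCoord (g.inChart x) i j (extChartAt (𝓡 n) x x)

/-- The Lie derivative `ℒ_X g`. -/
def lieDeriv (X : ∀ y : M, TangentSpace (𝓡 n) y) (x : M) (v w : TangentSpace (𝓡 n) x) : ℝ :=
  ∑ i, ∑ j, tangentCoord x v i * tangentCoord x w j *
    lieDerivCoord (fieldInChart X x) (g.inChart x) i j (extChartAt (𝓡 n) x x)

/-- `ℒ_X g + ϱ = r g` with `X` a smooth vector field. -/
def IsRicciSoliton (X : ∀ y : M, TangentSpace (𝓡 n) y) (r : ℝ) : Prop :=
  IsSmoothField X ∧ ∀ (x : M) (v w : TangentSpace (𝓡 n) x),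
    g.lieDeriv X x v w + g.ricci x v w = r * g.form x v w

/-- `ϱ = r g` for some real constant `r`. -/
def IsEinstein : Prop :=
  ∃ r : ℝ, ∀ (x : M) (v w : TangentSpace (𝓡 n) x), g.ricci x v w = r * g.form x v w

/-- Invariance of the metric under the action of a group `A`. -/
def IsInvariant (A : Type) [Group A] [MulAction A M] : Prop :=
  ∀ (a : A) (x : M) (v w : TangentSpace (𝓡 n) x),
    g.form (a • x) (mfderiv (𝓡 n) (𝓡 n) (fun y : M ↦ a • y) x v)
      (mfderiv (𝓡 n) (𝓡 n) (fun y : M ↦ a • y) x w) = g.form x v w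

/-- Isometric pseudo-Riemannian manifolds: there is a diffeomorphism pulling back one metric to
the other. -/
def IsIsometric {N : Type} [TopologicalSpace N] [ChartedSpace (EuclideanSpace ℝ (Fin n)) N]
    [IsManifold (𝓡 n) ∞ N] (g' : PseudoRiemannianMetric n N) : Prop :=
  ∃ Φ : Diffeomorph (𝓡 n) (𝓡 n) M N ∞, ∀ (x : M) (v w : TangentSpace (𝓡 n) x),
    g'.form (Φ x) (mfderiv (𝓡 n) (𝓡 n) Φ x v) (mfderiv (𝓡 n) (𝓡 n) Φ x w) = g.form x v w

/-- `g` is isometric to a left-invariant metric on some Lie group (solvable or not). A group acts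
on itself by left multiplication, so left-invariance is invariance under that action. -/
def IsIsometricToLieGroup : Prop :=
  ∃ (L : Type) (_ : TopologicalSpace L) (_ : ChartedSpace (EuclideanSpace ℝ (Fin n)) L)
    (_ : Group L) (_ : LieGroup (𝓡 n) ∞ L) (g' : PseudoRiemannianMetric n L),
    g'.IsInvariant L ∧ g.IsIsometric g'

/-- `g` is isometric to a solvsoliton: a left-invariant Ricci soliton metric on a solvable Lie
group. -/
def IsIsometricToSolvsoliton : Prop :=
  ∃ (L : Type) (_ : TopologicalSpace L) (_ : ChartedSpace (EuclideanSpace ℝ (Fin n)) L)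
    (_ : Group L) (_ : LieGroup (𝓡 n) ∞ L) (g' : PseudoRiemannianMetric n L),
    Group.IsSolvable L ∧ g'.IsInvariant L ∧
    (∃ (X : ∀ y : L, TangentSpace (𝓡 n) y) (r : ℝ), g'.IsRicciSoliton X r) ∧ g.IsIsometric g'

end PseudoRiemannianMetric

end Manifold

/-! ### Homogeneous spaces -/

/-- A presentation of an `n`-dimensional manifold `M` as a homogeneous space `G/H`: a simply
connected `k`-dimensional Lie group `G` acting smoothly and transitively on `M`, with connected
isotropy group `H` at a base point. -/
structure HomogeneousSpace (k n : ℕ) (M : Type) [TopologicalSpace M]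
    [ChartedSpace (EuclideanSpace ℝ (Fin n)) M] where
  G : Type
  [topG : TopologicalSpace G]
  [chartG : ChartedSpace (EuclideanSpace ℝ (Fin k)) G]
  [groupG : Group G]
  [lieG : LieGroup (𝓡 k) ∞ G]
  [actG : MulAction G M]
  simplyConnected : SimplyConnectedSpace G
  smooth_smul : ContMDiff ((𝓡 k).prod (𝓡 n)) (𝓡 n) ∞ (fun p : G × M ↦ p.1 • p.2)
  transitive : MulAction.IsPretransitive G M
  base : M
  connected_isotropy : IsConnected (MulAction.stabilizer G base : Set G)

attribute [instance] HomogeneousSpace.topG HomogeneousSpace.chartG HomogeneousSpace.groupG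
  HomogeneousSpace.lieG HomogeneousSpace.actG

namespace HomogeneousSpace

variable {k n : ℕ} {M : Type} [TopologicalSpace M] [ChartedSpace (EuclideanSpace ℝ (Fin n)) M]

instance (S : HomogeneousSpace k n M) : LieGroup (𝓡 k) (minSmoothness ℝ 3) S.G := by
  rw [minSmoothness_of_isRCLikeNormedField]
  infer_instance

/-- The Lie algebra `𝔤` of `G`. -/
abbrev lieAlg (S : HomogeneousSpace k n M) : Type := GroupLieAlgebra (𝓡 k) S.G

/-- The differential at `1` of the orbit map `a ↦ a • o`. It induces `𝔤/𝔥 ≃ T_o M`. -/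
def proj (S : HomogeneousSpace k n M) : S.lieAlg →ₗ[ℝ] TangentSpace (𝓡 n) ((1 : S.G) • S.base) :=
  (mfderiv (𝓡 k) (𝓡 n) (fun a : S.G ↦ a • S.base) 1).toLinearMap

/-- The isotropy subalgebra `𝔥`, the Lie algebra of the isotropy group `H`. -/
def isotropyAlg (S : HomogeneousSpace k n M) : Submodule ℝ S.lieAlg := LinearMap.ker S.proj

end HomogeneousSpace

/-! ### Lie algebra pairs `(𝔤, 𝔥)` -/

section Pairs

variable {𝔤 : Type} [LieRing 𝔤] [LieAlgebra ℝ 𝔤]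

/-- The pair `(𝔤, 𝔥)` is reductive: `𝔥` has an `ad 𝔥`-invariant complement in `𝔤`. (For connected
`H`, this is the same as having an `Ad H`-invariant one.) -/
def IsReductivePair (𝔥 : Submodule ℝ 𝔤) : Prop :=
  ∃ 𝔪 : Submodule ℝ 𝔤, IsCompl 𝔥 𝔪 ∧ ∀ x ∈ 𝔥, ∀ y ∈ 𝔪, ⁅x, y⁆ ∈ 𝔪

/-- `b = (e₁, u₁, u₂, u₃, u₄)` satisfies the bracket relations of type 1.3¹.1, `𝔥 = ℝ e₁`. -/
def IsKomrakov131_1 (b : Module.Basis (Fin 5) ℝ 𝔤) : Prop :=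
  ⁅b 0, b 1⁆ = b 0 ∧ ⁅b 0, b 2⁆ = 0 ∧ ⁅b 0, b 3⁆ = b 1 ∧ ⁅b 0, b 4⁆ = b 2 ∧
  ⁅b 1, b 2⁆ = (-1 / 2 : ℝ) • b 2 ∧ ⁅b 1, b 3⁆ = b 3 ∧ ⁅b 1, b 4⁆ = (1 / 2 : ℝ) • b 4 ∧
  ⁅b 2, b 3⁆ = (1 / 2 : ℝ) • b 4 ∧ ⁅b 2, b 4⁆ = 0 ∧ ⁅b 3, b 4⁆ = 0

/-- `b = (e₁, u₁, u₂, u₃, u₄)` satisfies the bracket relations of type 1.4¹.2 with parameter `p`,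
`𝔥 = ℝ e₁`. -/
def IsKomrakov141_2 (p : ℝ) (b : Module.Basis (Fin 5) ℝ 𝔤) : Prop :=
  ⁅b 0, b 1⁆ = 0 ∧ ⁅b 0, b 2⁆ = b 1 ∧ ⁅b 0, b 3⁆ = b 2 ∧ ⁅b 0, b 4⁆ = b 0 ∧
  ⁅b 1, b 2⁆ = 0 ∧ ⁅b 1, b 3⁆ = 0 ∧ ⁅b 1, b 4⁆ = p • b 1 ∧
  ⁅b 2, b 3⁆ = 0 ∧ ⁅b 2, b 4⁆ = (p - 1) • b 2 ∧ ⁅b 3, b 4⁆ = (p - 2) • b 3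

/-- `b = (e₁, e₂, e₃, e₄, e₅)` satisfies the bracket relations of the Fels–Renner case B1,
`𝔤 = 𝔰𝔩(2,ℝ) ⋉ ℝ²`, `𝔥 = ℝ e₃`. -/
def IsFelsRennerB1 (b : Module.Basis (Fin 5) ℝ 𝔤) : Prop :=
  ⁅b 0, b 1⁆ = (2 : ℝ) • b 1 ∧ ⁅b 0, b 2⁆ = (-2 : ℝ) • b 2 ∧ ⁅b 0, b 3⁆ = b 3 ∧
  ⁅b 0, b 4⁆ = -b 4 ∧ ⁅b 1, b 2⁆ = b 0 ∧ ⁅b 1, b 3⁆ = 0 ∧ ⁅b 1, b 4⁆ = b 3 ∧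
  ⁅b 2, b 3⁆ = b 4 ∧ ⁅b 2, b 4⁆ = 0 ∧ ⁅b 3, b 4⁆ = 0

/-- `b = (e₁, e₂, e₃, e₄, e₅)` satisfies the bracket relations of the Fels–Renner case A2 with
parameter `α`, `𝔥 = ℝ e₄`. -/
def IsFelsRennerA2 (α : ℝ) (b : Module.Basis (Fin 5) ℝ 𝔤) : Prop :=
  ⁅b 0, b 1⁆ = 0 ∧ ⁅b 0, b 2⁆ = 0 ∧ ⁅b 0, b 3⁆ = 0 ∧ ⁅b 0, b 4⁆ = (α + 1) • b 0 ∧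
  ⁅b 1, b 2⁆ = 0 ∧ ⁅b 1, b 3⁆ = b 0 ∧ ⁅b 1, b 4⁆ = α • b 1 ∧
  ⁅b 2, b 3⁆ = b 1 ∧ ⁅b 2, b 4⁆ = (α - 1) • b 2 ∧ ⁅b 3, b 4⁆ = b 3

end Pairs

/-- Components `g(uᵢ, uⱼ)` of the invariant metrics of type 1.3¹ with parameters `a, b, c, d`. -/
def metric131 (a b c d : ℝ) : Matrix (Fin 4) (Fin 4) ℝ :=
  !![0, 0, 0, a; 0, 0, -a, 0; 0, -a, b, c; a, 0, c, d]

/-- Components `g(uᵢ, uⱼ)` of the invariant metrics of type 1.4¹ with parameters `a, b, c, d`. -/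
def metric141 (a b c d : ℝ) : Matrix (Fin 4) (Fin 4) ℝ :=
  !![0, 0, -a, 0; 0, a, 0, 0; -a, 0, b, c; 0, 0, c, d]

/-- `g` is the `G`-invariant metric on `M = G/H` with components `m` with respect to the basis
`(uᵢ) = (b 1, b 2, b 3, b 4)` of `𝔤/𝔥 = T_o M`. -/
def IsInvariantMetricWith {M : Type} [TopologicalSpace M]
    [ChartedSpace (EuclideanSpace ℝ (Fin 4)) M] [IsManifold (𝓡 4) ∞ M]
    (S : HomogeneousSpace 5 4 M) (b : Module.Basis (Fin 5) ℝ S.lieAlg)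
    (m : Matrix (Fin 4) (Fin 4) ℝ) (g : PseudoRiemannianMetric 4 M) : Prop :=
  g.IsInvariant S.G ∧
    ∀ i j : Fin 4, g.form ((1 : S.G) • S.base) (S.proj (b i.succ)) (S.proj (b j.succ)) = m i j

/-- `g` is an invariant Ricci soliton on `M = G/H` with constant `r`: it is `G`-invariant and
`ℒ_X g + ϱ = r g` for a `G`-invariant vector field `X`. -/
def IsInvariantRicciSoliton {k n : ℕ} {M : Type} [TopologicalSpace M]
    [ChartedSpace (EuclideanSpace ℝ (Fin n)) M] [IsManifold (𝓡 n) ∞ M]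
    (S : HomogeneousSpace k n M) (g : PseudoRiemannianMetric n M) (r : ℝ) : Prop :=
  g.IsInvariant S.G ∧ ∃ X : ∀ y : M, TangentSpace (𝓡 n) y,
    IsInvariantField S.G X ∧ g.IsRicciSoliton X r

end

-- The algebraic claims need little: a permutation and rescaling of the basis matches each pair with
-- its Fels–Renner form, and a vector u with [e₁, u] = e₁ rules out an ad 𝔥-invariant complement
-- (`not_isReductivePair_span`).
--
-- The existence claims rest on explicit models, group laws on ℝ⁵ acting on ℝ⁴. In these global
-- coordinates the metric, its Christoffel symbols, the Ricci tensor and the Lie derivative are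
-- finite computations. In both families the Ricci tensor has a single nonzero component, and an
-- invariant vector field has exactly the opposite Lie derivative. For type 1.3¹.1, G is the
-- universal covering of SL(2,ℝ) ⋉ ℝ² and M that of the space of pairs (v, x), v a nonzero vector
-- and x a point of the plane. Covering theory is replaced by recording logarithms: identities are
-- checked after exponentiation, and estimates of the arguments identify the branches
-- (`eq_of_exp_eq_of_abs_im_sub_lt`). The metric is a combination of products of areas spanned by v,
-- dv, dx (`matrixForm_metricField131`), so its invariance is that of the area form.
--
-- The hard point is that the metrics with c ≠ 0 are not left-invariant metrics on Lie groups. An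
-- isometry to a Lie group pulls the left-invariant fields back to a global frame, closed under
-- brackets, with constant inner products (`InvariantFrame`). By the Koszul formula the connection,
-- and hence the Ricci tensor, have constant coefficients in it (`InvariantFrame.ricci_eq`). Here
-- the Ricci tensor is a nonzero multiple of the square of the one-form ω = area(v, dv). Thus ω is
-- constant on the frame (`InvariantFrame.area_vecV_der`), and so is dω, a multiple of area(dv, dv)
-- (`InvariantFrame.area_der_der`). Let p be the frame field taking v to i at the origin. Its
-- derivative w of v satisfies area(v, w) = 1 everywhere, and the remaining frame fields have
-- controlled effects on v and x.
--
-- The bracket relations of v, x and w then determine dw up to one real constant a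
-- (`InvariantFrame.exists_fderiv_eq`). Along a curve on which v rotates in the unit circle, the
-- component s of w along v satisfies s' = −(1 + (s − a/2)²)/2. Such a Riccati equation has no
-- solution on the whole line (`false_of_fderiv_eq`), although w is globally defined.

local notation "𝔼[" n "]" => EuclideanSpace ℝ (Fin n)

/-! ### Pseudo-Riemannian metrics in global coordinates -/

/-- The bilinear form with a given matrix. -/
noncomputable def matrixForm {n : ℕ} (A : Matrix (Fin n) (Fin n) ℝ) : 𝔼[n] →L[ℝ] 𝔼[n] →L[ℝ] ℝ :=
  ∑ i, ∑ j, A i j • ContinuousLinearMap.smulRight (EuclideanSpace.proj i : 𝔼[n] →L[ℝ] ℝ)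
    (EuclideanSpace.proj j : 𝔼[n] →L[ℝ] ℝ)

theorem matrixForm_apply {n : ℕ} (A : Matrix (Fin n) (Fin n) ℝ) (v w : 𝔼[n]) :
    matrixForm A v w = ∑ i, ∑ j, A i j * (v i * w j) := by
  simp [matrixForm]

theorem matrixForm_single {n : ℕ} (A : Matrix (Fin n) (Fin n) ℝ) (i j : Fin n) :
    matrixForm A (EuclideanSpace.single i 1) (EuclideanSpace.single j 1) = A i j := by
  simp [matrixForm_apply]

theorem matrixForm_apply_single {n : ℕ} (A : Matrix (Fin n) (Fin n) ℝ) (v : 𝔼[n]) (j : Fin n) :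
    matrixForm A v (EuclideanSpace.single j 1) = ∑ i, v i * A i j := by
  simp [matrixForm_apply, mul_comm]

theorem eq_zero_of_matrixForm_eq_zero {n : ℕ} {A : Matrix (Fin n) (Fin n) ℝ} (hA : IsUnit A)
    {v : 𝔼[n]} (h : ∀ w, matrixForm A v w = 0) : v = 0 := by
  have h1 : Matrix.vecMul (fun i ↦ v i) A = 0 := by
    ext j
    simpa [matrixForm_apply_single, Matrix.vecMul, dotProduct] using
      h (EuclideanSpace.single j 1)
  have h2 : (fun i ↦ v i) = 0 := by
    have := Matrix.vecMul_injective_of_isUnit hA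
    exact this (by simpa using h1)
  ext i
  exact congrFun h2 i

theorem contDiff_matrixForm {n : ℕ} {G : 𝔼[n] → Matrix (Fin n) (Fin n) ℝ}
    (hG : ∀ i j, ContDiff ℝ ∞ (fun y ↦ G y i j)) : ContDiff ℝ ∞ (fun y ↦ matrixForm (G y)) := by
  unfold matrixForm
  exact ContDiff.sum fun i _ ↦ ContDiff.sum fun j _ ↦
    (ContinuousLinearMap.smulRight (ContinuousLinearMap.id ℝ ℝ) _).contDiff.comp (hG i j)

theorem matrixForm_symm {n : ℕ} {A : Matrix (Fin n) (Fin n) ℝ} (hs : ∀ i j, A i j = A j i)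
    (v w : 𝔼[n]) : matrixForm A v w = matrixForm A w v := by
  rw [matrixForm_apply, matrixForm_apply, Finset.sum_comm]
  refine Finset.sum_congr rfl fun i _ ↦ Finset.sum_congr rfl fun j _ ↦ ?_
  rw [hs j i, mul_comm (v j)]

theorem contMDiff_form_euclidean {n : ℕ} {B : 𝔼[n] → 𝔼[n] →L[ℝ] 𝔼[n] →L[ℝ] ℝ}
    (hB : ContDiff ℝ ∞ B) : ContMDiff (𝓡 n) ((𝓡 n).prod 𝓘(ℝ, 𝔼[n] →L[ℝ] 𝔼[n] →L[ℝ] ℝ)) ∞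
      (fun x : 𝔼[n] ↦ Bundle.TotalSpace.mk' (𝔼[n] →L[ℝ] 𝔼[n] →L[ℝ] ℝ)
      (E := fun x : 𝔼[n] ↦ TangentSpace (𝓡 n) x →L[ℝ] TangentSpace (𝓡 n) x →L[ℝ] ℝ) x (B x)) := by
  intro x
  refine (Bundle.contMDiffAt_section
    (E := fun x : 𝔼[n] ↦ TangentSpace (𝓡 n) x →L[ℝ] TangentSpace (𝓡 n) x →L[ℝ] ℝ) x).2 ?_
  convert! hB.contMDiff x using 1
  ext y v w
  rw [hom_trivializationAt_apply]
  simp only [ContinuousLinearMap.inCoordinates]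
  simp
  rw [Bundle.Trivialization.linearMapAt_apply, if_pos (by simp [hom_trivializationAt_baseSet]; exact Set.mem_univ y),
    hom_trivializationAt_apply]
  simp only [ContinuousLinearMap.inCoordinates]
  simp
  rfl

/-- The pseudo-Riemannian metric on `ℝⁿ` with given smooth components. -/
noncomputable def PseudoRiemannianMetric.ofMatrix {n : ℕ}
    (G : 𝔼[n] → Matrix (Fin n) (Fin n) ℝ)
    (hG : ∀ i j, ContDiff ℝ ∞ (fun y ↦ G y i j)) (hs : ∀ y i j, G y i j = G y j i)
    (hu : ∀ y, IsUnit (G y)) : PseudoRiemannianMetric n 𝔼[n] where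
  form y := matrixForm (G y)
  symm y := matrixForm_symm (hs y)
  nondegenerate y _ h := eq_zero_of_matrixForm_eq_zero (hu y) h
  smooth := contMDiff_form_euclidean (contDiff_matrixForm hG)

section OfMatrix

variable {n : ℕ} (g : PseudoRiemannianMetric n 𝔼[n])

theorem mfderiv_euclidean {m k : ℕ} (f : 𝔼[m] → 𝔼[k]) (x v : 𝔼[m]) :
    (mfderiv (𝓡 m) (𝓡 k) f x : 𝔼[m] →L[ℝ] 𝔼[k]) v = fderiv ℝ f x v :=
  congrArg (fun L : 𝔼[m] →L[ℝ] 𝔼[k] ↦ L v) (mfderiv_eq_fderiv (f := f) (x := x))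

theorem mfderiv_extChartAt_euclidean (x y v : 𝔼[n]) :
    (mfderiv (𝓡 n) (𝓡 n) (extChartAt (𝓡 n) x) y : 𝔼[n] →L[ℝ] 𝔼[n]) v = v := by
  have h : (extChartAt (𝓡 n) x : 𝔼[n] → 𝔼[n]) = id := rfl
  rw [mfderiv_euclidean, h, fderiv_id]
  rfl

theorem mfderiv_extChartAt_symm_euclidean (x y v : 𝔼[n]) :
    (mfderiv (𝓡 n) (𝓡 n) (extChartAt (𝓡 n) x).symm y : 𝔼[n] →L[ℝ] 𝔼[n]) v = v := by
  have h : ((extChartAt (𝓡 n) x).symm : 𝔼[n] → 𝔼[n]) = id := rfl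
  rw [mfderiv_euclidean, h, fderiv_id]
  rfl

theorem inChart_euclidean (x y : 𝔼[n]) (i j : Fin n) :
    g.inChart x y i j = (g.form y : 𝔼[n] →L[ℝ] 𝔼[n] →L[ℝ] ℝ) (EuclideanSpace.single i (1 : ℝ))
      (EuclideanSpace.single j (1 : ℝ)) :=
  congrArg₂ (fun v w ↦ (g.form y : 𝔼[n] →L[ℝ] 𝔼[n] →L[ℝ] ℝ) v w)
    (mfderiv_extChartAt_symm_euclidean x y (EuclideanSpace.single i (1 : ℝ)))
    (mfderiv_extChartAt_symm_euclidean x y (EuclideanSpace.single j (1 : ℝ)))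

theorem tangentCoord_euclidean (x : 𝔼[n]) (v : 𝔼[n]) :
    tangentCoord (n := n) x v = v :=
  mfderiv_extChartAt_euclidean x x v

theorem fieldInChart_euclidean (X : 𝔼[n] → 𝔼[n]) (x : 𝔼[n]) :
    fieldInChart (n := n) (M := 𝔼[n]) X x = X := by
  ext1 y
  exact mfderiv_extChartAt_euclidean x y (X y)

variable {G : 𝔼[n] → Matrix (Fin n) (Fin n) ℝ} {hG : ∀ i j, ContDiff ℝ ∞ (fun y ↦ G y i j)}
  {hs : ∀ y i j, G y i j = G y j i} {hu : ∀ y, IsUnit (G y)}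

theorem inChart_ofMatrix (x : 𝔼[n]) :
    (PseudoRiemannianMetric.ofMatrix G hG hs hu).inChart x = G := by
  ext y i j
  rw [inChart_euclidean]
  exact matrixForm_single _ i j

theorem ricci_ofMatrix (x v w : 𝔼[n]) :
    (PseudoRiemannianMetric.ofMatrix G hG hs hu).ricci x v w =
      ∑ i, ∑ j, v i * w j * ricciCoord G i j x := by
  change ∑ i, ∑ j, tangentCoord (n := n) x v i * tangentCoord (n := n) x w j * ricciCoord
    ((PseudoRiemannianMetric.ofMatrix G hG hs hu).inChart x) i j x = _
  rw [inChart_ofMatrix, tangentCoord_euclidean, tangentCoord_euclidean]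

theorem lieDeriv_ofMatrix (X : 𝔼[n] → 𝔼[n]) (x v w : 𝔼[n]) :
    (PseudoRiemannianMetric.ofMatrix G hG hs hu).lieDeriv X x v w =
      ∑ i, ∑ j, v i * w j * lieDerivCoord X G i j x := by
  change ∑ i, ∑ j, tangentCoord (n := n) x v i * tangentCoord (n := n) x w j * lieDerivCoord
    (fieldInChart (n := n) (M := 𝔼[n]) X x)
    ((PseudoRiemannianMetric.ofMatrix G hG hs hu).inChart x) i j x = _
  rw [inChart_ofMatrix, tangentCoord_euclidean, tangentCoord_euclidean, fieldInChart_euclidean]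

theorem isSmoothField_euclidean {X : 𝔼[n] → 𝔼[n]} (hX : ContDiff ℝ ∞ X) :
    IsSmoothField (n := n) (M := 𝔼[n]) X :=
  contMDiff_vectorSpace_iff_contDiff.2 hX

/-- The soliton equation in global coordinates. -/
theorem isRicciSoliton_ofMatrix {X : 𝔼[n] → 𝔼[n]} (hX : ContDiff ℝ ∞ X) {r : ℝ}
    (h : ∀ x i j, lieDerivCoord X G i j x + ricciCoord G i j x = r * G x i j) :
    (PseudoRiemannianMetric.ofMatrix G hG hs hu).IsRicciSoliton X r := by
  refine ⟨isSmoothField_euclidean hX, fun x (v : 𝔼[n]) (w : 𝔼[n]) ↦ ?_⟩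
  rw [lieDeriv_ofMatrix, ricci_ofMatrix]
  change _ = r * matrixForm (G x) v w
  simp only [matrixForm_apply, ← Finset.sum_add_distrib, Finset.mul_sum]
  refine Finset.sum_congr rfl fun i _ ↦ Finset.sum_congr rfl fun j _ ↦ ?_
  rw [← mul_add, h]
  ring

theorem IsEinstein.ricciCoord_eq (h : (PseudoRiemannianMetric.ofMatrix G hG hs hu).IsEinstein) :
    ∃ r : ℝ, ∀ x i j, ricciCoord G i j x = r * G x i j := by
  obtain ⟨r, hr⟩ := h
  refine ⟨r, fun x i j ↦ ?_⟩
  have := hr x (EuclideanSpace.single i (1 : ℝ) : 𝔼[n]) (EuclideanSpace.single j (1 : ℝ) : 𝔼[n])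
  rw [ricci_ofMatrix] at this
  have h2 : (PseudoRiemannianMetric.ofMatrix G hG hs hu).form x
      (EuclideanSpace.single i (1 : ℝ) : 𝔼[n]) (EuclideanSpace.single j (1 : ℝ) : 𝔼[n]) = G x i j :=
    matrixForm_single _ i j
  rw [h2] at this
  simpa [Pi.single_apply] using this

end OfMatrix

/-- Christoffel symbols are characterized by their lowered version. -/
theorem christoffel_eq {n : ℕ} {G : 𝔼[n] → Matrix (Fin n) (Fin n) ℝ} {y : 𝔼[n]}
    (hu : IsUnit (G y)) {c : Fin n → ℝ} {i j : Fin n}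
    (h : ∀ l, 2 * ∑ k, G y l k * c k = partialD i (fun z ↦ G z j l) y
      + partialD j (fun z ↦ G z i l) y - partialD l (fun z ↦ G z i j) y) (k : Fin n) :
    christoffel G k i j y = c k := by
  have h1 : (G y)⁻¹.mulVec ((G y).mulVec c) = c := by
    rw [Matrix.mulVec_mulVec, Matrix.nonsing_inv_mul _ ((Matrix.isUnit_iff_isUnit_det _).1 hu),
      Matrix.one_mulVec]
  have h2 := congrFun h1 k
  simp only [christoffel, ← h]
  simp only [Matrix.mulVec, dotProduct] at h2
  rw [← h2, Finset.mul_sum]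
  refine Finset.sum_congr rfl fun l _ ↦ ?_
  ring

theorem mlieBracket_euclidean {n : ℕ} (V W : 𝔼[n] → 𝔼[n]) (x : 𝔼[n]) :
    VectorField.mlieBracket (𝓡 n) (M := 𝔼[n]) V W x =
      (fderiv ℝ W x (V x) - fderiv ℝ V x (W x) : 𝔼[n]) :=
  (congrFun VectorField.mlieBracketWithin_univ x).symm.trans
    ((congrFun (VectorField.mlieBracketWithin_eq_lieBracketWithin (𝕜 := ℝ)
      (V := V) (W := W) (s := Set.univ)) x).trans
      (congrFun VectorField.lieBracketWithin_univ x))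

/-! ### Lie groups and homogeneous spaces in global coordinates -/

/-- A smooth group law on `ℝᵏ` with identity element `0`. -/
structure GroupLaw (k : ℕ) where
  mul : 𝔼[k] → 𝔼[k] → 𝔼[k]
  inv : 𝔼[k] → 𝔼[k]
  mul_assoc : ∀ x y z, mul (mul x y) z = mul x (mul y z)
  zero_mul : ∀ x, mul 0 x = x
  inv_mul : ∀ x, mul (inv x) x = 0
  contDiff_mul : ContDiff ℝ ∞ (fun p : 𝔼[k] × 𝔼[k] ↦ mul p.1 p.2)
  contDiff_inv : ContDiff ℝ ∞ inv

namespace GroupLaw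

variable {k n : ℕ} (L : GroupLaw k)

/-- The Lie group `ℝᵏ` with a given group law. -/
def Carrier (_ : GroupLaw k) : Type := 𝔼[k]

instance : TopologicalSpace L.Carrier := inferInstanceAs (TopologicalSpace 𝔼[k])
instance : ChartedSpace 𝔼[k] L.Carrier := inferInstanceAs (ChartedSpace 𝔼[k] 𝔼[k])

noncomputable instance : Group L.Carrier :=
  letI : Mul L.Carrier := ⟨L.mul⟩
  letI : Inv L.Carrier := ⟨L.inv⟩
  letI : One L.Carrier := ⟨(0 : 𝔼[k])⟩
  Group.ofLeftAxioms L.mul_assoc L.zero_mul L.inv_mul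

instance : IsManifold (𝓡 k) ∞ L.Carrier := inferInstanceAs (IsManifold (𝓡 k) ∞ 𝔼[k])

theorem contMDiff_prod_euclidean {m k n : ℕ} {f : 𝔼[m] × 𝔼[k] → 𝔼[n]} (hf : ContDiff ℝ ∞ f) :
    ContMDiff ((𝓡 m).prod (𝓡 k)) (𝓡 n) ∞ f := by
  have := hf.contMDiff
  rwa [modelWithCornersSelf_prod, ← chartedSpaceSelf_prod] at this

instance instLieGroup : LieGroup (𝓡 k) ∞ L.Carrier where
  contMDiff_mul := contMDiff_prod_euclidean L.contDiff_mul
  contMDiff_inv := L.contDiff_inv.contMDiff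

instance : SimplyConnectedSpace L.Carrier := inferInstanceAs (SimplyConnectedSpace 𝔼[k])

/-- The left-invariant vector field on `ℝᵏ` with value `v` at `0`. -/
noncomputable def leftField (v x : 𝔼[k]) : 𝔼[k] := fderiv ℝ (L.mul x) 0 v

/-- In global coordinates the bracket of vector fields is the commutator of their directional
derivatives. Left-invariant fields take their parameter as value at 0, since `L.mul 0` is the
identity. -/
theorem lie_eq (v w : 𝔼[k]) :
    (⁅(show GroupLieAlgebra (𝓡 k) L.Carrier from v), (show GroupLieAlgebra (𝓡 k) L.Carrier from w)⁆ :
      GroupLieAlgebra (𝓡 k) L.Carrier) =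
    (fderiv ℝ (L.leftField w) 0 v - fderiv ℝ (L.leftField v) 0 w : 𝔼[k]) := by
  have h : ∀ u : 𝔼[k], (mulInvariantVectorField (I := 𝓡 k) (G := L.Carrier) u : 𝔼[k] → 𝔼[k]) =
      L.leftField u := fun u ↦ funext fun x ↦ mfderiv_euclidean (L.mul x) 0 u
  have h2 := mlieBracket_euclidean (L.leftField v) (L.leftField w) 0
  have h0 : ∀ u, L.leftField u 0 = u := by
    intro u
    have : L.mul 0 = id := funext L.zero_mul
    rw [leftField, this, fderiv_id]
    rfl
  rw [h0, h0] at h2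
  rw [← h2, ← h v, ← h w]
  rfl

/-- A smooth action of the Lie group `ℝᵏ` on `ℝⁿ`. -/
structure SmoothAction (L : GroupLaw k) (n : ℕ) where
  act : 𝔼[k] → 𝔼[n] → 𝔼[n]
  zero_act : ∀ y, act 0 y = y
  mul_act : ∀ x x' y, act (L.mul x x') y = act x (act x' y)
  contDiff_act : ContDiff ℝ ∞ (fun p : 𝔼[k] × 𝔼[n] ↦ act p.1 p.2)
  transitive : ∀ y, ∃ x, act x 0 = y
  connected : IsConnected {x | act x 0 = 0}

namespace SmoothAction

variable {L} (α : L.SmoothAction n)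

/-- The homogeneous space of a smooth transitive action of `ℝᵏ` on `ℝⁿ`. -/
noncomputable def space (α : L.SmoothAction n) : HomogeneousSpace k n 𝔼[n] where
  G := L.Carrier
  topG := inferInstance
  chartG := inferInstance
  groupG := inferInstance
  lieG := L.instLieGroup
  actG :=
    { smul := α.act
      one_smul := α.zero_act
      mul_smul := α.mul_act }
  simplyConnected := inferInstance
  smooth_smul := contMDiff_prod_euclidean α.contDiff_act
  transitive := by
    let _ : MulAction L.Carrier 𝔼[n] :=
      { smul := α.act
        one_smul := α.zero_act
        mul_smul := α.mul_act }
    refine ⟨fun y z ↦ ?_⟩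
    obtain ⟨a, rfl⟩ := α.transitive y
    obtain ⟨b, rfl⟩ := α.transitive z
    refine ⟨(show L.Carrier from b) * (show L.Carrier from a)⁻¹, ?_⟩
    change ((show L.Carrier from b) * (show L.Carrier from a)⁻¹) •
      ((show L.Carrier from a) • (0 : 𝔼[n])) = (show L.Carrier from b) • (0 : 𝔼[n])
    rw [smul_smul, inv_mul_cancel_right]
  base := 0
  connected_isotropy := α.connected

theorem proj_apply (v : 𝔼[k]) :
    (α.space.proj (show α.space.lieAlg from v) : 𝔼[n]) = fderiv ℝ (fun x ↦ α.act x 0) 0 v :=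
  mfderiv_euclidean (fun x ↦ α.act x 0) 0 v

theorem isInvariant_iff (g : PseudoRiemannianMetric n 𝔼[n]) :
    g.IsInvariant α.space.G ↔ ∀ (x : 𝔼[k]) (y v w : 𝔼[n]),
      (g.form (α.act x y) : 𝔼[n] →L[ℝ] 𝔼[n] →L[ℝ] ℝ) (fderiv ℝ (α.act x) y v)
        (fderiv ℝ (α.act x) y w) = (g.form y : 𝔼[n] →L[ℝ] 𝔼[n] →L[ℝ] ℝ) v w := by
  have h : ∀ (x : 𝔼[k]) (y v : 𝔼[n]), (mfderiv (𝓡 n) (𝓡 n) (α.act x) y : 𝔼[n] →L[ℝ] 𝔼[n]) v =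
      fderiv ℝ (α.act x) y v := fun x y v ↦ mfderiv_euclidean (α.act x) y v
  simp only [← h]
  rfl

theorem isInvariantField_iff (X : 𝔼[n] → 𝔼[n]) :
    IsInvariantField (n := n) (M := 𝔼[n]) α.space.G X ↔ ∀ (x : 𝔼[k]) (y : 𝔼[n]),
      fderiv ℝ (α.act x) y (X y) = X (α.act x y) := by
  have h : ∀ (x : 𝔼[k]) (y v : 𝔼[n]), (mfderiv (𝓡 n) (𝓡 n) (α.act x) y : 𝔼[n] →L[ℝ] 𝔼[n]) v =
      fderiv ℝ (α.act x) y v := fun x y v ↦ mfderiv_euclidean (α.act x) y v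
  simp only [← h]
  rfl

theorem lie_space (v w : 𝔼[k]) :
    (⁅(show α.space.lieAlg from v), (show α.space.lieAlg from w)⁆ : α.space.lieAlg) =
    (fderiv ℝ (L.leftField w) 0 v - fderiv ℝ (L.leftField v) 0 w : 𝔼[k]) :=
  L.lie_eq v w

/-- The standard basis of the Lie algebra of `ℝᵏ` with a group law. -/
noncomputable def basis : Module.Basis (Fin k) ℝ α.space.lieAlg :=
  (EuclideanSpace.basisFun (Fin k) ℝ).toBasis

theorem basis_apply (i : Fin k) : α.basis i = (EuclideanSpace.single i (1 : ℝ) : 𝔼[k]) := by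
  exact (EuclideanSpace.basisFun (Fin k) ℝ).coe_toBasis ▸ EuclideanSpace.basisFun_apply _ _ i

end SmoothAction

end GroupLaw

/-! ### Metrics isometric to left-invariant metrics on Lie groups -/

/-- A family of vector fields on `ℝⁿ` that is closed under brackets, restricts to an isomorphism
onto each tangent space, and has constant inner products for a field of bilinear forms. -/
structure InvariantFrame {n : ℕ} (B : 𝔼[n] → 𝔼[n] →L[ℝ] 𝔼[n] →L[ℝ] ℝ) where
  X : 𝔼[n] →ₗ[ℝ] (𝔼[n] → 𝔼[n])
  contDiff : ∀ ξ, ContDiff ℝ 2 (X ξ)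
  bijective : ∀ y, Function.Bijective (fun ξ ↦ X ξ y)
  bracket : 𝔼[n] → 𝔼[n] → 𝔼[n]
  bracket_eq : ∀ ξ ζ y, fderiv ℝ (X ζ) y (X ξ y) - fderiv ℝ (X ξ) y (X ζ y) = X (bracket ξ ζ) y
  form_eq : ∀ ξ ζ y, B y (X ξ y) (X ζ y) = B 0 (X ξ 0) (X ζ 0)

/-- The frame consists of the pullbacks of the left-invariant fields under the isometry. Naturality
of the Lie bracket makes the Lie algebra bracket the bracket of the frame, and left invariance makes
the inner products constant. -/
theorem InvariantFrame.nonempty_of_isIsometricToLieGroup {n : ℕ}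
    {g : PseudoRiemannianMetric n 𝔼[n]} (h : g.IsIsometricToLieGroup) :
    Nonempty (InvariantFrame (fun y ↦ (g.form y : 𝔼[n] →L[ℝ] 𝔼[n] →L[ℝ] ℝ))) := by
  obtain ⟨L, _, _, _, _, g', hinv, Φ, hΦ⟩ := h
  have : LieGroup (𝓡 n) (minSmoothness ℝ 3) L := by
    rw [minSmoothness_of_isRCLikeNormedField]
    infer_instance
  have : IsManifold (𝓡 n) (minSmoothness ℝ 3) L := by
    rw [minSmoothness_of_isRCLikeNormedField]
    infer_instance
  have : IsManifold (𝓡 n) (minSmoothness ℝ 3) 𝔼[n] := by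
    rw [minSmoothness_of_isRCLikeNormedField]
    infer_instance
  have hΦi : ∀ y : 𝔼[n], (mfderiv (𝓡 n) (𝓡 n) Φ y).IsInvertible := fun y ↦
    ⟨Φ.mfderivToContinuousLinearEquiv (by simp) y, Φ.mfderivToContinuousLinearEquiv_coe (by simp)⟩
  let V : 𝔼[n] → ∀ a : L, TangentSpace (𝓡 n) a := fun ξ ↦
    mulInvariantVectorField (I := 𝓡 n) (G := L) ξ
  let A : 𝔼[n] → 𝔼[n] →L[ℝ] 𝔼[n] := fun y ↦ (mfderiv (𝓡 n) (𝓡 n) Φ y).inverse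
  let D : L → 𝔼[n] →L[ℝ] 𝔼[n] := fun a ↦ mfderiv (𝓡 n) (𝓡 n) (fun b : L ↦ a * b) 1
  let X : 𝔼[n] →ₗ[ℝ] (𝔼[n] → 𝔼[n]) :=
    { toFun := fun ξ y ↦ A y (D (Φ y) ξ)
      map_add' := fun ξ ζ ↦ funext fun y ↦ ((A y).comp (D (Φ y))).map_add ξ ζ
      map_smul' := fun c ξ ↦ funext fun y ↦ ((A y).comp (D (Φ y))).map_smul c ξ }
  have hcongr : ∀ (a b : L) (v w : 𝔼[n]), a = b → (g'.form a : 𝔼[n] →L[ℝ] 𝔼[n] →L[ℝ] ℝ) v w =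
      (g'.form b : 𝔼[n] →L[ℝ] 𝔼[n] →L[ℝ] ℝ) v w := by
    rintro a b v w rfl
    rfl
  have hD : ∀ (a : L) (v w : 𝔼[n]), (g'.form a : 𝔼[n] →L[ℝ] 𝔼[n] →L[ℝ] ℝ) (D a v) (D a w) =
      (g'.form 1 : 𝔼[n] →L[ℝ] 𝔼[n] →L[ℝ] ℝ) v w := fun a v w ↦
    (hcongr _ _ _ _ (mul_one a)).symm.trans (hinv a 1 v w)
  have hA : ∀ y v, (mfderiv (𝓡 n) (𝓡 n) Φ y : 𝔼[n] →L[ℝ] 𝔼[n]) (A y v) = v := fun y v ↦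
    congrArg (fun T : 𝔼[n] →L[ℝ] 𝔼[n] ↦ T v) (hΦi y).self_comp_inverse
  have hform : ∀ ξ ζ y, (g.form y : 𝔼[n] →L[ℝ] 𝔼[n] →L[ℝ] ℝ) (X ξ y) (X ζ y) =
      (g'.form 1 : 𝔼[n] →L[ℝ] 𝔼[n] →L[ℝ] ℝ) ξ ζ := fun ξ ζ y ↦ by
    have h1 := hΦ y (X ξ y) (X ζ y)
    have h2 : ∀ ξ, (mfderiv (𝓡 n) (𝓡 n) Φ y : 𝔼[n] →L[ℝ] 𝔼[n]) (X ξ y) = D (Φ y) ξ := fun ξ ↦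
      hA y (D (Φ y) ξ)
    refine h1.symm.trans (Eq.trans ?_ (hD (Φ y) ξ ζ))
    exact congrArg₂ (fun v w ↦ (g'.form (Φ y) : 𝔼[n] →L[ℝ] 𝔼[n] →L[ℝ] ℝ) v w) (h2 ξ) (h2 ζ)
  have hcm : ∀ ξ : 𝔼[n], ContMDiff (𝓡 n) (𝓡 n).tangent 2
      (fun a : L ↦ (⟨a, V ξ a⟩ : TangentBundle (𝓡 n) L)) := fun ξ ↦ by
    have := contMDiff_mulInvariantVectorField (I := 𝓡 n) (G := L) ξ
    exact this.of_le minSmoothness_of_isRCLikeNormedField.ge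
  refine ⟨⟨X, fun ξ ↦ ?_, fun y ↦ ?_, fun ξ ζ ↦
    (⁅(show GroupLieAlgebra (𝓡 n) L from ξ), (show GroupLieAlgebra (𝓡 n) L from ζ)⁆ :
      GroupLieAlgebra (𝓡 n) L),
    fun ξ ζ y ↦ ?_, fun ξ ζ y ↦ ?_⟩⟩
  · have h3 : ContMDiff (𝓡 n) (𝓡 n).tangent 2 (fun y : 𝔼[n] ↦ (⟨y, X ξ y⟩ : TangentBundle (𝓡 n) 𝔼[n])) :=
      ContMDiff.mpullback_vectorField (n := ∞) (hcm ξ) Φ.contMDiff hΦi (by norm_cast)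
    exact contMDiff_vectorSpace_iff_contDiff.1 h3
  -- A parameter whose field vanishes at y is orthogonal to every parameter at the identity, so
  -- nondegeneracy there kills it. Surjectivity follows by dimension.
  · have hinj : Function.Injective ((LinearMap.proj y).comp X : 𝔼[n] →ₗ[ℝ] 𝔼[n]) := by
      rw [injective_iff_map_eq_zero]
      intro ξ hξ
      refine g'.nondegenerate 1 ξ fun ζ ↦ ?_
      refine (hform ξ ζ y).symm.trans ?_
      have : X ξ y = 0 := hξ
      rw [this]
      exact congrArg (fun T : 𝔼[n] →L[ℝ] ℝ ↦ T (X ζ y))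
        (g.form y : 𝔼[n] →L[ℝ] 𝔼[n] →L[ℝ] ℝ).map_zero
    exact ⟨hinj, LinearMap.injective_iff_surjective.1 hinj⟩
  · rw [← mlieBracket_euclidean]
    refine (VectorField.mpullback_mlieBracket (n := ∞) (x₀ := y) (V := V ξ) (W := V ζ)
      ((hcm ξ).mdifferentiable (by simp) _) ((hcm ζ).mdifferentiable (by simp) _)
      Φ.contMDiff.contMDiffAt (by rw [minSmoothness_of_isRCLikeNormedField]; norm_cast)).symm.trans ?_
    exact congrFun (congrArg (VectorField.mpullback (𝓡 n) (𝓡 n) Φ)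
      (mulInvariantVector_mlieBracket (I := 𝓡 n) (G := L) ξ ζ).symm) y
  · exact (hform ξ ζ y).trans (hform ξ ζ 0).symm

/-! ### The Ricci tensor of a metric with an invariant frame -/

section Ricci

variable {n : ℕ}

/-- Multilinear identities are reduced to index identities by applying this in one slot at a time.
-/
theorem eq_of_isLinearMap_of_single {f g : 𝔼[n] → ℝ} (hf : IsLinearMap ℝ f) (hg : IsLinearMap ℝ g)
    (h : ∀ i, f (EuclideanSpace.single i 1) = g (EuclideanSpace.single i 1)) (v : 𝔼[n]) :
    f v = g v := by
  have : hf.mk' f = hg.mk' g := by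
    refine (EuclideanSpace.basisFun (Fin n) ℝ).toBasis.ext fun i ↦ ?_
    simpa using h i
  exact congrArg (fun T : 𝔼[n] →ₗ[ℝ] ℝ ↦ T v) this

variable (G : 𝔼[n] → Matrix (Fin n) (Fin n) ℝ)

/-- The Christoffel symbols as a field of bilinear maps. -/
noncomputable def christoffelMap (y : 𝔼[n]) : 𝔼[n] →L[ℝ] 𝔼[n] →L[ℝ] 𝔼[n] :=
  ∑ k, ∑ i, ∑ j, christoffel G k i j y •
    ContinuousLinearMap.smulRight (EuclideanSpace.proj i : 𝔼[n] →L[ℝ] ℝ)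
    (ContinuousLinearMap.smulRight (EuclideanSpace.proj j : 𝔼[n] →L[ℝ] ℝ)
      (EuclideanSpace.single k (1 : ℝ)))

theorem christoffelMap_apply (y u v : 𝔼[n]) (k : Fin n) :
    christoffelMap G y u v k = ∑ i, ∑ j, christoffel G k i j y * (u i * v j) := by
  simp [christoffelMap, Finset.sum_apply, Pi.single_apply]

theorem christoffelMap_single (y : 𝔼[n]) (i j k : Fin n) :
    christoffelMap G y (EuclideanSpace.single i 1) (EuclideanSpace.single j 1) k =
      christoffel G k i j y := by
  simp [christoffelMap_apply]

variable {G}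

theorem differentiable_sum_smul {ι E F : Type*} [Fintype ι] [NormedAddCommGroup E]
    [NormedSpace ℝ E] [NormedAddCommGroup F] [NormedSpace ℝ F] {f : ι → E → ℝ}
    (hf : ∀ i, Differentiable ℝ (f i)) (c : ι → E →L[ℝ] E →L[ℝ] F) :
    Differentiable ℝ (fun y ↦ ∑ i, f i y • c i) := by
  have h : ∀ {H : Type _} [NormedAddCommGroup H] [NormedSpace ℝ H] (c : ι → H),
      Differentiable ℝ (fun y ↦ ∑ i, f i y • c i) :=
    fun c ↦ Differentiable.fun_sum fun i _ ↦ (hf i).smul_const (c i)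
  exact h c

theorem differentiable_christoffelMap (hΓ : ∀ k i j, Differentiable ℝ (christoffel G k i j)) :
    Differentiable ℝ (christoffelMap G) := by
  have h : christoffelMap G = fun y ↦ ∑ p : Fin n × Fin n × Fin n,
      christoffel G p.1 p.2.1 p.2.2 y •
      ContinuousLinearMap.smulRight (EuclideanSpace.proj p.2.1 : 𝔼[n] →L[ℝ] ℝ)
      (ContinuousLinearMap.smulRight (EuclideanSpace.proj p.2.2 : 𝔼[n] →L[ℝ] ℝ)
      (EuclideanSpace.single p.1 (1 : ℝ))) := by
    funext y
    simp only [christoffelMap, Fintype.sum_prod_type]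
  rw [h]
  exact differentiable_sum_smul (fun p : Fin n × Fin n × Fin n ↦ hΓ p.1 p.2.1 p.2.2) _

theorem differentiable_matrixForm (hG : ∀ i j, Differentiable ℝ (fun y ↦ G y i j)) :
    Differentiable ℝ (fun y ↦ matrixForm (G y)) := by
  have h : (fun y ↦ matrixForm (G y)) = fun y ↦ ∑ p : Fin n × Fin n, G y p.1 p.2 •
      ContinuousLinearMap.smulRight (EuclideanSpace.proj p.1 : 𝔼[n] →L[ℝ] ℝ)
      (EuclideanSpace.proj p.2 : 𝔼[n] →L[ℝ] ℝ) := by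
    funext y
    simp only [matrixForm, Fintype.sum_prod_type]
  rw [h]
  exact differentiable_sum_smul (fun p : Fin n × Fin n ↦ hG p.1 p.2) _

theorem christoffel_symm (hs : ∀ y i j, G y i j = G y j i) (k i j : Fin n) (y : 𝔼[n]) :
    christoffel G k i j y = christoffel G k j i y := by
  have : ∀ i j, (fun z ↦ G z i j) = fun z ↦ G z j i := fun i j ↦ funext fun z ↦ hs z i j
  simp only [christoffel]
  congr 1
  refine Finset.sum_congr rfl fun l _ ↦ ?_
  rw [this i j]
  ring

theorem christoffelMap_symm (hs : ∀ y i j, G y i j = G y j i) (y u v : 𝔼[n]) :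
    christoffelMap G y u v = christoffelMap G y v u := by
  ext k
  rw [christoffelMap_apply, christoffelMap_apply, Finset.sum_comm]
  refine Finset.sum_congr rfl fun i _ ↦ Finset.sum_congr rfl fun j _ ↦ ?_
  rw [christoffel_symm hs, mul_comm (u j)]

/-- Lowering the index cancels the inverse matrix in the definition. This is the existence half of
the characterization whose uniqueness half is `christoffel_eq`. -/
theorem sum_mul_christoffel {y : 𝔼[n]} (hu : IsUnit (G y)) (m i j : Fin n) :
    2 * ∑ k, G y m k * christoffel G k i j y = partialD i (fun z ↦ G z j m) y
      + partialD j (fun z ↦ G z i m) y - partialD m (fun z ↦ G z i j) y := by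
  set d : Fin n → ℝ := fun l ↦ partialD i (fun z ↦ G z j l) y
      + partialD j (fun z ↦ G z i l) y - partialD l (fun z ↦ G z i j) y with hd
  have h1 : (G y).mulVec ((G y)⁻¹.mulVec d) = d := by
    rw [Matrix.mulVec_mulVec, Matrix.mul_nonsing_inv _ ((Matrix.isUnit_iff_isUnit_det _).1 hu),
      Matrix.one_mulVec]
  have h2 := congrFun h1 m
  simp only [Matrix.mulVec, dotProduct] at h2
  change _ = d m
  rw [← h2, Finset.mul_sum]
  refine Finset.sum_congr rfl fun k _ ↦ ?_
  simp only [christoffel, hd]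
  ring

/-- This is ∇g = 0. Adding the lowered identities for the two index orders cancels all derivatives
of the metric but one. -/
theorem partialD_eq_christoffel (hs : ∀ y i j, G y i j = G y j i) {y : 𝔼[n]} (hu : IsUnit (G y))
    (k i j : Fin n) : partialD k (fun z ↦ G z i j) y =
      ∑ l, christoffel G l k i y * G y l j + ∑ l, christoffel G l k j y * G y i l := by
  have h : ∀ i j, (fun z ↦ G z i j) = fun z ↦ G z j i := fun i j ↦ funext fun z ↦ hs z i j
  have h1 := sum_mul_christoffel hu j k i
  have h2 := sum_mul_christoffel hu i k j
  have h3 : ∑ l, christoffel G l k i y * G y l j = ∑ l, G y j l * christoffel G l k i y :=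
    Finset.sum_congr rfl fun l _ ↦ by rw [hs y l j, mul_comm]
  have h4 : ∑ l, christoffel G l k j y * G y i l = ∑ l, G y i l * christoffel G l k j y :=
    Finset.sum_congr rfl fun l _ ↦ by rw [mul_comm]
  rw [h3, h4]
  rw [h j i] at h2
  rw [h i j] at *
  linarith

theorem fderiv_matrixForm (hG : ∀ i j, Differentiable ℝ (fun y ↦ G y i j))
    (hs : ∀ y i j, G y i j = G y j i) (y : 𝔼[n]) (hu : IsUnit (G y)) (u v w : 𝔼[n]) :
    fderiv ℝ (fun y ↦ matrixForm (G y)) y u v w =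
      matrixForm (G y) (christoffelMap G y u v) w + matrixForm (G y) v (christoffelMap G y u w) := by
  have hd := differentiable_matrixForm hG y
  refine eq_of_isLinearMap_of_single
    (f := fun u ↦ fderiv ℝ (fun y ↦ matrixForm (G y)) y u v w)
    (g := fun u ↦ matrixForm (G y) (christoffelMap G y u v) w +
      matrixForm (G y) v (christoffelMap G y u w))
    (by constructor <;> intros <;> simp) (by constructor <;> intros <;> simp <;> ring)
    (fun k ↦ ?_) u
  refine eq_of_isLinearMap_of_single
    (f := fun v ↦ fderiv ℝ (fun y ↦ matrixForm (G y)) y (EuclideanSpace.single k 1) v w)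
    (g := fun v ↦ matrixForm (G y) (christoffelMap G y (EuclideanSpace.single k 1) v) w +
      matrixForm (G y) v (christoffelMap G y (EuclideanSpace.single k 1) w))
    (by constructor <;> intros <;> simp) (by constructor <;> intros <;> simp <;> ring)
    (fun i ↦ ?_) v
  refine eq_of_isLinearMap_of_single
    (f := fun w ↦ fderiv ℝ (fun y ↦ matrixForm (G y)) y (EuclideanSpace.single k 1)
      (EuclideanSpace.single i 1) w)
    (g := fun w ↦ matrixForm (G y) (christoffelMap G y (EuclideanSpace.single k 1)
      (EuclideanSpace.single i 1)) w + matrixForm (G y) (EuclideanSpace.single i 1)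
        (christoffelMap G y (EuclideanSpace.single k 1) w))
    (by constructor <;> intros <;> simp) (by constructor <;> intros <;> simp <;> ring)
    (fun j ↦ ?_) w
  have h1 : fderiv ℝ (fun y ↦ matrixForm (G y)) y (EuclideanSpace.single k 1)
      (EuclideanSpace.single i 1) (EuclideanSpace.single j 1) = partialD k (fun z ↦ G z i j) y := by
    have := ((hd.hasFDerivAt.clm_apply (hasFDerivAt_const (EuclideanSpace.single i (1 : ℝ)) y)).clm_apply
      (hasFDerivAt_const (EuclideanSpace.single j (1 : ℝ)) y)).fderiv
    simp only [matrixForm_single] at this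
    rw [partialD, this]
    simp
  rw [h1, partialD_eq_christoffel hs hu, matrixForm_apply_single]
  rw [matrixForm_symm (hs y) (EuclideanSpace.single i 1), matrixForm_apply_single]
  simp only [christoffelMap_single, hs y _ i]

/-- The curvature operator in coordinates. -/
noncomputable def curvatureMap (G : 𝔼[n] → Matrix (Fin n) (Fin n) ℝ) (y u v w : 𝔼[n]) : 𝔼[n] :=
  fderiv ℝ (christoffelMap G) y u v w - fderiv ℝ (christoffelMap G) y v u w +
    christoffelMap G y u (christoffelMap G y v w) - christoffelMap G y v (christoffelMap G y u w)

/-- The Ricci tensor is a trace of the curvature in its first argument. Symmetry of the Christoffel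
symbols reconciles the index order of the two definitions. -/
theorem sum_curvatureMap (hs : ∀ y i j, G y i j = G y j i)
    (hΓ : ∀ k i j, Differentiable ℝ (christoffel G k i j)) (y v w : 𝔼[n]) :
    ∑ k, curvatureMap G y (EuclideanSpace.single k 1) v w k =
      ∑ i, ∑ j, w i * v j * ricciCoord G i j y := by
  refine eq_of_isLinearMap_of_single
    (f := fun v ↦ ∑ k, curvatureMap G y (EuclideanSpace.single k 1) v w k)
    (g := fun v ↦ ∑ i, ∑ j, w i * v j * ricciCoord G i j y)
    (by constructor <;> intros <;>
      simp only [curvatureMap, Finset.mul_sum, ← Finset.sum_add_distrib, map_add, map_smul,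
        _root_.add_apply, _root_.smul_apply, PiLp.add_apply,
        PiLp.sub_apply, PiLp.smul_apply, smul_eq_mul] <;>
      (refine Finset.sum_congr rfl fun _ _ ↦ ?_) <;> ring)
    (by constructor <;> intros <;> simp only [Finset.mul_sum, ← Finset.sum_add_distrib, PiLp.add_apply, PiLp.smul_apply,
        smul_eq_mul] <;>
      (refine Finset.sum_congr rfl fun _ _ ↦ Finset.sum_congr rfl fun _ _ ↦ ?_) <;> ring)
    (fun j ↦ ?_) v
  refine eq_of_isLinearMap_of_single
    (f := fun w ↦ ∑ k, curvatureMap G y (EuclideanSpace.single k 1) (EuclideanSpace.single j 1) w k)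
    (g := fun w ↦ ∑ i, ∑ j', w i * (EuclideanSpace.single j (1 : ℝ) : 𝔼[n]) j' *
      ricciCoord G i j' y)
    (by constructor <;> intros <;>
      simp only [curvatureMap, Finset.mul_sum, ← Finset.sum_add_distrib, map_add, map_smul,
        PiLp.add_apply,
        PiLp.sub_apply, PiLp.smul_apply, smul_eq_mul] <;>
      (refine Finset.sum_congr rfl fun _ _ ↦ ?_) <;> ring)
    (by constructor <;> intros <;> simp only [Finset.mul_sum, ← Finset.sum_add_distrib,
        PiLp.add_apply, PiLp.smul_apply, smul_eq_mul] <;>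
      (refine Finset.sum_congr rfl fun _ _ ↦ Finset.sum_congr rfl fun _ _ ↦ ?_) <;> ring)
    (fun i ↦ ?_) w
  have hD : ∀ k a b c : Fin n, fderiv ℝ (christoffelMap G) y (EuclideanSpace.single a 1)
      (EuclideanSpace.single b 1) (EuclideanSpace.single c 1) k =
        partialD a (christoffel G k b c) y := by
    intro k a b c
    have h1 := ((differentiable_christoffelMap hΓ y).hasFDerivAt.clm_apply
      (hasFDerivAt_const (EuclideanSpace.single b (1 : ℝ)) y)).clm_apply
      (hasFDerivAt_const (EuclideanSpace.single c (1 : ℝ)) y)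
    have h2 := ((EuclideanSpace.proj k : 𝔼[n] →L[ℝ] ℝ).hasFDerivAt.comp y h1).fderiv
    have h3 : (⇑(EuclideanSpace.proj k : 𝔼[n] →L[ℝ] ℝ) ∘ fun y ↦ christoffelMap G y
      (EuclideanSpace.single b 1) (EuclideanSpace.single c 1)) = christoffel G k b c := by
      ext z
      exact christoffelMap_single G z b c k
    rw [h3] at h2
    rw [partialD, h2]
    simp
  have hE : ∀ k a b c : Fin n, christoffelMap G y (EuclideanSpace.single a 1)
      (christoffelMap G y (EuclideanSpace.single b 1) (EuclideanSpace.single c 1)) k =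
        ∑ l, christoffel G k a l y * christoffel G l b c y := by
    intro k a b c
    rw [christoffelMap_apply]
    simp [christoffelMap_single]
  have hR : ∑ i', ∑ j', (EuclideanSpace.single i (1 : ℝ) : 𝔼[n]) i' *
      (EuclideanSpace.single j (1 : ℝ) : 𝔼[n]) j' * ricciCoord G i' j' y = ricciCoord G i j y := by
    simp
  rw [hR]
  have hf : ∀ a b c, christoffel G a b c = christoffel G a c b :=
    fun a b c ↦ funext fun z ↦ christoffel_symm hs a b c z
  simp only [curvatureMap, PiLp.add_apply, PiLp.sub_apply, hD, hE, ricciCoord,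
    ← Finset.sum_add_distrib]
  refine Finset.sum_congr rfl fun k _ ↦ ?_
  rw [hf k j i, hf k k i, add_sub_assoc, ← Finset.sum_sub_distrib]
  congr 1
  refine Finset.sum_congr rfl fun l _ ↦ ?_
  rw [hf l j i, hf l k i]
end Ricci

namespace InvariantFrame

variable {n : ℕ} {G : 𝔼[n] → Matrix (Fin n) (Fin n) ℝ}

theorem differentiable {B : 𝔼[n] → 𝔼[n] →L[ℝ] 𝔼[n] →L[ℝ] ℝ} (F : InvariantFrame B) (ξ : 𝔼[n]) :
    Differentiable ℝ (F.X ξ) :=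
  (F.contDiff ξ).differentiable (by simp)

/-- The covariant derivatives of the fields of an invariant frame have constant coefficients. -/
theorem exists_connection (F : InvariantFrame (fun y ↦ matrixForm (G y)))
    (hG : ∀ i j, Differentiable ℝ (fun y ↦ G y i j)) (hs : ∀ y i j, G y i j = G y j i)
    (hu : ∀ y, IsUnit (G y)) : ∃ c : 𝔼[n] → 𝔼[n] → 𝔼[n], ∀ ξ ζ y,
      fderiv ℝ (F.X ζ) y (F.X ξ y) + christoffelMap G y (F.X ξ y) (F.X ζ y) = F.X (c ξ ζ) y := by
  set cov : 𝔼[n] → 𝔼[n] → 𝔼[n] → 𝔼[n] := fun ξ ζ y ↦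
    fderiv ℝ (F.X ζ) y (F.X ξ y) + christoffelMap G y (F.X ξ y) (F.X ζ y) with hcov
  -- Metric compatibility, with no derivative term because the inner products of the frame are
  -- constant.
  have h1 : ∀ ξ ζ η y, matrixForm (G y) (cov ξ ζ y) (F.X η y) +
      matrixForm (G y) (cov ξ η y) (F.X ζ y) = 0 := by
    intro ξ ζ η y
    have hb : HasFDerivAt (fun y ↦ matrixForm (G y)) (fderiv ℝ (fun y ↦ matrixForm (G y)) y) y :=
      (differentiable_matrixForm hG y).hasFDerivAt
    have hd := ((hb.clm_apply (F.differentiable ζ y).hasFDerivAt).clm_apply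
      (F.differentiable η y).hasFDerivAt).fderiv
    have hc : (fun y ↦ matrixForm (G y) (F.X ζ y) (F.X η y)) =
        fun _ ↦ matrixForm (G 0) (F.X ζ 0) (F.X η 0) := funext fun y ↦ F.form_eq ζ η y
    rw [hc] at hd
    have := congrArg (fun T : 𝔼[n] →L[ℝ] ℝ ↦ T (F.X ξ y)) hd
    simp only [fderiv_fun_const, Pi.zero_apply, _root_.zero_apply, _root_.add_apply,
      ContinuousLinearMap.comp_apply, ContinuousLinearMap.flip_apply] at this
    rw [fderiv_matrixForm hG hs y (hu y)] at this
    simp only [hcov, map_add, _root_.add_apply]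
    rw [matrixForm_symm (hs y) (fderiv ℝ (F.X η) y _), matrixForm_symm (hs y) (christoffelMap G y _ (F.X η y))]
    linarith
  -- Vanishing torsion.
  have h2 : ∀ ξ ζ y, cov ξ ζ y = cov ζ ξ y + F.X (F.bracket ξ ζ) y := by
    intro ξ ζ y
    simp only [hcov]
    rw [← F.bracket_eq, christoffelMap_symm hs y (F.X ζ y)]
    abel
  -- The Koszul formula. Its right-hand side does not involve y, so coefficients chosen at the
  -- origin are correct everywhere.
  have hK : ∀ ξ ζ η y, 2 * matrixForm (G y) (cov ξ ζ y) (F.X η y) =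
      matrixForm (G 0) (F.X (F.bracket ξ ζ) 0) (F.X η 0)
      - matrixForm (G 0) (F.X (F.bracket ξ η) 0) (F.X ζ 0)
      - matrixForm (G 0) (F.X (F.bracket ζ η) 0) (F.X ξ 0) := by
    intro ξ ζ η y
    have e : ∀ ξ ζ, matrixForm (G y) (F.X ξ y) (F.X ζ y) =
      matrixForm (G 0) (F.X ξ 0) (F.X ζ 0) := fun ξ ζ ↦ F.form_eq ξ ζ y
    have d : ∀ a b c, matrixForm (G y) (cov a b y) (F.X c y) = matrixForm (G y) (cov b a y) (F.X c y)
        + matrixForm (G 0) (F.X (F.bracket a b) 0) (F.X c 0) := fun a b c ↦ by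
      rw [h2 a b, map_add, _root_.add_apply, e]
    linarith [h1 ξ ζ η y, h1 ζ ξ η y, h1 η ξ ζ y, d ξ ζ η, d ξ η ζ, d ζ η ξ]
  choose c hc using fun ξ ζ ↦ (F.bijective 0).2 (cov ξ ζ 0)
  refine ⟨c, fun ξ ζ y ↦ ?_⟩
  change cov ξ ζ y = _
  rw [← sub_eq_zero]
  refine eq_zero_of_matrixForm_eq_zero (hu y) fun w ↦ ?_
  obtain ⟨η, rfl⟩ := (F.bijective y).2 w
  have e := F.form_eq (c ξ ζ) η y
  simp only at e hc
  rw [map_sub, _root_.sub_apply, e, hc]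
  linarith [hK ξ ζ η y, hK ξ ζ η 0]

/-- The Ricci tensor has constant components in an invariant frame. -/
theorem ricci_eq (F : InvariantFrame (fun y ↦ matrixForm (G y)))
    (hG : ∀ i j, Differentiable ℝ (fun y ↦ G y i j)) (hs : ∀ y i j, G y i j = G y j i)
    (hu : ∀ y, IsUnit (G y)) (hΓ : ∀ k i j, Differentiable ℝ (christoffel G k i j))
    (ξ ζ y : 𝔼[n]) :
    ∑ i, ∑ j, F.X ξ y i * F.X ζ y j * ricciCoord G i j y =
      ∑ i, ∑ j, F.X ξ 0 i * F.X ζ 0 j * ricciCoord G i j 0 := by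
  obtain ⟨c, hc⟩ := F.exists_connection hG hs hu
  -- With constant connection coefficients the curvature is algebraic in them. In the commutator of
  -- second covariant derivatives the second derivatives of the frame field cancel by symmetry.
  have hR : ∀ ξ ζ η y, curvatureMap G y (F.X ξ y) (F.X ζ y) (F.X η y) =
      F.X (c ξ (c ζ η) - c ζ (c ξ η) - c (F.bracket ξ ζ) η) y := by
    intro ξ ζ η y
    have hD2 : DifferentiableAt ℝ (fderiv ℝ (F.X η)) y :=
      ((F.contDiff η).fderiv_right (m := 1) (by norm_num)).differentiable (by simp) y
    have hsymm : IsSymmSndFDerivAt ℝ (F.X η) y :=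
      (F.contDiff η).contDiffAt.isSymmSndFDerivAt (by simp)
    have key : ∀ ξ ζ, F.X (c ξ (c ζ η)) y =
        fderiv ℝ (fderiv ℝ (F.X η)) y (F.X ξ y) (F.X ζ y) +
        fderiv ℝ (F.X η) y (fderiv ℝ (F.X ζ) y (F.X ξ y)) +
        (fderiv ℝ (christoffelMap G) y (F.X ξ y) (F.X ζ y) (F.X η y) +
          christoffelMap G y (fderiv ℝ (F.X ζ) y (F.X ξ y)) (F.X η y) +
          christoffelMap G y (F.X ζ y) (fderiv ℝ (F.X η) y (F.X ξ y))) +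
        christoffelMap G y (F.X ξ y) (fderiv ℝ (F.X η) y (F.X ζ y)) +
        christoffelMap G y (F.X ξ y) (christoffelMap G y (F.X ζ y) (F.X η y)) := by
      intro ξ ζ
      have hf : F.X (c ζ η) = fun y ↦
          fderiv ℝ (F.X η) y (F.X ζ y) + christoffelMap G y (F.X ζ y) (F.X η y) :=
        funext fun y ↦ (hc ζ η y).symm
      have hd := ((hD2.hasFDerivAt.clm_apply (F.differentiable ζ y).hasFDerivAt).add
        (((differentiable_christoffelMap hΓ y).hasFDerivAt.clm_apply
          (F.differentiable ζ y).hasFDerivAt).clm_apply (F.differentiable η y).hasFDerivAt)).fderiv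
      rw [← hc ξ (c ζ η) y, ← hc ζ η y]
      rw [(congrArg (fun f ↦ fderiv ℝ f y) hf).trans hd]
      simp only [_root_.add_apply, ContinuousLinearMap.comp_apply,
        ContinuousLinearMap.flip_apply, map_add]
      abel
    have hbr : F.X (c (F.bracket ξ ζ) η) y =
        fderiv ℝ (F.X η) y (fderiv ℝ (F.X ζ) y (F.X ξ y)) -
        fderiv ℝ (F.X η) y (fderiv ℝ (F.X ξ) y (F.X ζ y)) +
        (christoffelMap G y (fderiv ℝ (F.X ζ) y (F.X ξ y)) (F.X η y) -
        christoffelMap G y (fderiv ℝ (F.X ξ) y (F.X ζ y)) (F.X η y)) := by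
      rw [← hc, ← F.bracket_eq]
      simp only [map_sub, _root_.sub_apply]
    rw [map_sub, map_sub, Pi.sub_apply, Pi.sub_apply, key ξ ζ, key ζ ξ, hbr, curvatureMap,
      hsymm.eq (F.X ζ y) (F.X ξ y)]
    abel
  let Φ : 𝔼[n] → 𝔼[n] ≃ₗ[ℝ] 𝔼[n] := fun y ↦
    LinearEquiv.ofBijective ((LinearMap.proj y).comp F.X : 𝔼[n] →ₗ[ℝ] 𝔼[n]) (F.bijective y)
  let R : 𝔼[n] → 𝔼[n] →ₗ[ℝ] 𝔼[n] := fun y ↦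
    { toFun := fun u ↦ curvatureMap G y u (F.X ζ y) (F.X ξ y)
      map_add' := fun u v ↦ by
        simp only [curvatureMap, map_add, _root_.add_apply]
        abel
      map_smul' := fun a u ↦ by
        simp only [curvatureMap, map_smul, _root_.smul_apply, smul_sub, smul_add, RingHom.id_apply] }
  -- Transported to the parameter space by the frame, the curvature endomorphism is the same at all
  -- points. The Ricci value is its trace, which conjugation preserves.
  have hΦ : ∀ y, (Φ y).symm.conj (R y) = (Φ 0).symm.conj (R 0) := by
    intro y
    have h0 : ∀ y η, (Φ y).symm.conj (R y) η =
        c η (c ζ ξ) - c ζ (c η ξ) - c (F.bracket η ζ) ξ := by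
      intro y η
      rw [LinearEquiv.conj_apply_apply, LinearEquiv.symm_symm, LinearEquiv.symm_apply_eq]
      exact hR η ζ ξ y
    ext1 η
    rw [h0, h0]
  have htr : ∀ y, LinearMap.trace ℝ 𝔼[n] (R y) =
      ∑ i, ∑ j, F.X ξ y i * F.X ζ y j * ricciCoord G i j y := by
    intro y
    rw [LinearMap.trace_eq_sum_inner _ (EuclideanSpace.basisFun (Fin n) ℝ), ← sum_curvatureMap hs hΓ]
    simp [R, EuclideanSpace.inner_single_left]
  rw [← htr, ← htr, ← LinearMap.trace_conj' (R y) (Φ y).symm, hΦ, LinearMap.trace_conj']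

end InvariantFrame

/-! ### The pairs of Lie algebras -/

section Pairs

variable {𝔤 : Type} [LieRing 𝔤] [LieAlgebra ℝ 𝔤]

/-- A basis obtained by permuting and rescaling a given one. -/
theorem exists_basis_smul_perm (b : Module.Basis (Fin 5) ℝ 𝔤) (σ : Equiv.Perm (Fin 5))
    (c : Fin 5 → ℝ) (hc : ∀ i, c i ≠ 0) :
    ∃ b' : Module.Basis (Fin 5) ℝ 𝔤, ∀ i, b' i = c i • b (σ i) :=
  ⟨(b.reindex σ.symm).unitsSMul fun i ↦ Units.mk0 (c i) (hc i), fun i ↦ by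
    simp [Module.Basis.unitsSMul_apply, Units.smul_def]⟩

/-- The vectors 2u₁, −2u₃, e₁ form an 𝔰𝔩₂-triple acting on the plane spanned by u₄ and u₂, so the
new basis is (2u₁, −2u₃, e₁, u₄, u₂). -/
theorem IsKomrakov131_1.exists_isFelsRennerB1 {b : Module.Basis (Fin 5) ℝ 𝔤}
    (h : IsKomrakov131_1 b) : ∃ b' : Module.Basis (Fin 5) ℝ 𝔤,
      IsFelsRennerB1 b' ∧ Submodule.span ℝ {b 0} = Submodule.span ℝ {b' 2} := by
  obtain ⟨h01, h02, h03, h04, h12, h13, h14, h23, h24, h34⟩ := h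
  obtain ⟨b', hb'⟩ := exists_basis_smul_perm b (Equiv.mk ![1, 3, 0, 4, 2] ![2, 0, 4, 1, 3]
    (by decide) (by decide)) ![2, -2, 1, 1, 1] (by intro i; fin_cases i <;> simp)
  have h0 : b' 0 = (2 : ℝ) • b 1 := hb' 0
  have h1 : b' 1 = (-2 : ℝ) • b 3 := hb' 1
  have h2 : b' 2 = b 0 := (hb' 2).trans (one_smul ℝ _)
  have h3 : b' 3 = b 4 := (hb' 3).trans (one_smul ℝ _)
  have h4 : b' 4 = b 2 := (hb' 4).trans (one_smul ℝ _)
  have s10 : ⁅b 1, b 0⁆ = -b 0 := by rw [← lie_skew, h01]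
  have s30 : ⁅b 3, b 0⁆ = -b 1 := by rw [← lie_skew, h03]
  have s32 : ⁅b 3, b 2⁆ = -((1 / 2 : ℝ) • b 4) := by rw [← lie_skew, h23]
  have s42 : ⁅b 4, b 2⁆ = 0 := by rw [← lie_skew, h24, neg_zero]
  refine ⟨b', ⟨?_, ?_, ?_, ?_, ?_, ?_, ?_, ?_, ?_, ?_⟩, by rw [h2]⟩ <;>
    simp only [h0, h1, h2, h3, h4, smul_lie, lie_smul, h02, h04, h12, h13, h14, h34, s10, s30,
      s32, s42, smul_zero] <;> module

/-- The new basis is (u₁, u₂, u₃, −e₁, u₄). The sign turns [u₂, e₁] = −u₁ into the required relation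
and does not change the line 𝔥. -/
theorem IsKomrakov141_2.exists_isFelsRennerA2 {p : ℝ} {b : Module.Basis (Fin 5) ℝ 𝔤}
    (h : IsKomrakov141_2 p b) : ∃ b' : Module.Basis (Fin 5) ℝ 𝔤,
      IsFelsRennerA2 (p - 1) b' ∧ Submodule.span ℝ {b 0} = Submodule.span ℝ {b' 3} := by
  obtain ⟨h01, h02, h03, h04, h12, h13, h14, h23, h24, h34⟩ := h
  obtain ⟨b', hb'⟩ := exists_basis_smul_perm b (Equiv.mk ![1, 2, 3, 0, 4] ![3, 0, 1, 2, 4]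
    (by decide) (by decide)) ![1, 1, 1, -1, 1] (by intro i; fin_cases i <;> simp)
  have h0 : b' 0 = b 1 := (hb' 0).trans (one_smul ℝ _)
  have h1 : b' 1 = b 2 := (hb' 1).trans (one_smul ℝ _)
  have h2 : b' 2 = b 3 := (hb' 2).trans (one_smul ℝ _)
  have h3 : b' 3 = -b 0 := (hb' 3).trans (neg_one_smul ℝ _)
  have h4 : b' 4 = b 4 := (hb' 4).trans (one_smul ℝ _)
  have s10 : ⁅b 1, b 0⁆ = 0 := by rw [← lie_skew, h01, neg_zero]
  have s20 : ⁅b 2, b 0⁆ = -b 1 := by rw [← lie_skew, h02]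
  have s30 : ⁅b 3, b 0⁆ = -b 2 := by rw [← lie_skew, h03]
  refine ⟨b', ⟨?_, ?_, ?_, ?_, ?_, ?_, ?_, ?_, ?_, ?_⟩, ?_⟩
  case refine_11 => rw [h3, ← neg_one_smul ℝ, Submodule.span_singleton_smul_eq (by simp)]
  all_goals
    simp only [h0, h1, h2, h3, h4, lie_neg, neg_lie, h04, h12, h13, h14, h23, h24, h34, s10, s20,
      s30, neg_neg, neg_zero] <;> module

/-- Subtracting from u its component along e does not change [e, u]. The remaining vector lies in
the invariant complement, which would therefore contain e. -/
theorem not_isReductivePair_span {e u : 𝔤} (he : e ≠ 0) (h : ⁅e, u⁆ = e) :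
    ¬ IsReductivePair (Submodule.span ℝ {e}) := by
  rintro ⟨𝔪, hc, hm⟩
  obtain ⟨x, hx, y, hy, hxy⟩ := Submodule.mem_sup.1 (hc.sup_eq_top ▸ Submodule.mem_top (x := u))
  obtain ⟨a, rfl⟩ := Submodule.mem_span_singleton.1 hx
  have he' := Submodule.mem_span_singleton_self (R := ℝ) e
  have h1 : ⁅e, u⁆ = ⁅e, y⁆ := by
    rw [← hxy, lie_add, lie_smul, lie_self, smul_zero, zero_add]
  rw [h] at h1
  exact he (Submodule.disjoint_def.1 hc.disjoint e he' (h1.symm ▸ hm e he' y hy))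

end Pairs

/-! ### Derivatives in coordinates -/

section Derivatives

variable {n : ℕ}

theorem hasDerivAt_euclidean_iff {f : ℝ → 𝔼[n]} {f' : 𝔼[n]} {t : ℝ} :
    HasDerivAt f f' t ↔ ∀ i, HasDerivAt (fun s ↦ f s i) (f' i) t := by
  rw [hasDerivAt_iff_hasFDerivAt, ← hasFDerivWithinAt_univ, hasFDerivWithinAt_euclidean]
  refine forall_congr' fun i ↦ ?_
  rw [hasFDerivWithinAt_univ, hasDerivAt_iff_hasFDerivAt]
  refine iff_of_eq (congrArg (fun T ↦ HasFDerivAt _ T t) ?_)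
  ext
  simp

theorem hasDerivAt_add_smul {E : Type*} [NormedAddCommGroup E] [NormedSpace ℝ E] (x v : E) :
    HasDerivAt (fun t : ℝ ↦ x + t • v) v 0 := by
  simpa using ((hasDerivAt_id (0 : ℝ)).smul_const v).const_add x

/-- Reduces the differentials of group laws, actions and coordinate functions to derivatives in one
real variable. -/
theorem fderiv_apply_of_hasDerivAt {E F : Type*} [NormedAddCommGroup E] [NormedSpace ℝ E]
    [NormedAddCommGroup F] [NormedSpace ℝ F] {f : E → F} {x v : E} {u : F}
    (hf : DifferentiableAt ℝ f x) (h : HasDerivAt (fun t : ℝ ↦ f (x + t • v)) u 0) :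
    fderiv ℝ f x v = u := by
  have h2 : HasFDerivAt f (fderiv ℝ f x) (x + (0 : ℝ) • v) := by
    simpa using hf.hasFDerivAt
  exact (h2.comp_hasDerivAt 0 (hasDerivAt_add_smul x v)).unique h

theorem partialD_const (i : Fin n) (c : ℝ) (y : 𝔼[n]) : partialD i (fun _ ↦ c) y = 0 := by
  simp [partialD]

theorem partialD_coord (i j : Fin n) (y : 𝔼[n]) :
    partialD i (fun z ↦ z j) y = if j = i then 1 else 0 := by
  have h : HasFDerivAt (fun z : 𝔼[n] ↦ z j) (EuclideanSpace.proj j : 𝔼[n] →L[ℝ] ℝ) y :=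
    (EuclideanSpace.proj j : 𝔼[n] →L[ℝ] ℝ).hasFDerivAt
  rw [partialD, h.fderiv]
  simp

theorem partialD_add (i : Fin n) {f g : 𝔼[n] → ℝ} {y : 𝔼[n]} (hf : DifferentiableAt ℝ f y)
    (hg : DifferentiableAt ℝ g y) :
    partialD i (fun z ↦ f z + g z) y = partialD i f y + partialD i g y := by
  simp [partialD, fderiv_fun_add hf hg]

theorem partialD_sub (i : Fin n) {f g : 𝔼[n] → ℝ} {y : 𝔼[n]} (hf : DifferentiableAt ℝ f y)
    (hg : DifferentiableAt ℝ g y) :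
    partialD i (fun z ↦ f z - g z) y = partialD i f y - partialD i g y := by
  simp [partialD, fderiv_fun_sub hf hg]

theorem partialD_neg (i : Fin n) (f : 𝔼[n] → ℝ) (y : 𝔼[n]) :
    partialD i (fun z ↦ -f z) y = -partialD i f y := by
  simp [partialD]

theorem partialD_mul (i : Fin n) {f g : 𝔼[n] → ℝ} {y : 𝔼[n]} (hf : DifferentiableAt ℝ f y)
    (hg : DifferentiableAt ℝ g y) :
    partialD i (fun z ↦ f z * g z) y = partialD i f y * g y + f y * partialD i g y := by
  simp [partialD, fderiv_fun_mul hf hg]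
  ring

theorem partialD_exp (i : Fin n) {f : 𝔼[n] → ℝ} {y : 𝔼[n]} (hf : DifferentiableAt ℝ f y) :
    partialD i (fun z ↦ Real.exp (f z)) y = Real.exp (f y) * partialD i f y := by
  simp [partialD, hf.hasFDerivAt.exp.fderiv]

end Derivatives

/-! ### Differentials of group laws and actions along lines -/

namespace GroupLaw

variable {k n : ℕ} (L : GroupLaw k)

theorem contDiff_leftField (v : 𝔼[k]) : ContDiff ℝ ∞ (L.leftField v) := by
  have h : ContDiff ℝ ∞ (fun x ↦ fderiv ℝ (L.mul x) 0) :=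
    ContDiff.fderiv (m := ∞) (n := ∞) (f := L.mul) L.contDiff_mul contDiff_const (by simp)
  exact h.clm_apply contDiff_const

theorem leftField_eq {v x u : 𝔼[k]} (h : HasDerivAt (fun t : ℝ ↦ L.mul x (t • v)) u 0) :
    L.leftField v x = u := by
  have h1 : ContDiff ℝ ∞ (L.mul x) := L.contDiff_mul.comp (contDiff_const.prodMk contDiff_id)
  exact fderiv_apply_of_hasDerivAt (h1.differentiable (by simp) 0) (by simpa using h)

theorem fderiv_leftField_eq {v w u : 𝔼[k]}
    (h : HasDerivAt (fun t : ℝ ↦ L.leftField w (t • v)) u 0) :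
    fderiv ℝ (L.leftField w) 0 v = u :=
  fderiv_apply_of_hasDerivAt ((L.contDiff_leftField w).differentiable (by simp) 0)
    (by simpa using h)

namespace SmoothAction

variable {L} (α : L.SmoothAction n)

theorem contDiff_act_right (x : 𝔼[k]) : ContDiff ℝ ∞ (α.act x) :=
  α.contDiff_act.comp (contDiff_const.prodMk contDiff_id)

theorem contDiff_act_left (y : 𝔼[n]) : ContDiff ℝ ∞ (fun x ↦ α.act x y) :=
  α.contDiff_act.comp (contDiff_id.prodMk contDiff_const)

theorem fderiv_act_eq {x : 𝔼[k]} {y v u : 𝔼[n]}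
    (h : HasDerivAt (fun t : ℝ ↦ α.act x (y + t • v)) u 0) : fderiv ℝ (α.act x) y v = u :=
  fderiv_apply_of_hasDerivAt ((α.contDiff_act_right x).differentiable (by simp) y) h

theorem lie_basis_eq {i j : Fin k} {u : 𝔼[k]}
    (h : fderiv ℝ (L.leftField (EuclideanSpace.single j 1)) 0 (EuclideanSpace.single i 1) -
      fderiv ℝ (L.leftField (EuclideanSpace.single i 1)) 0 (EuclideanSpace.single j 1) = u) :
    (⁅α.basis i, α.basis j⁆ : α.space.lieAlg) = u := by
  rw [basis_apply, basis_apply]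
  exact (α.lie_space _ _).trans h

theorem smul_basis (c : ℝ) (i : Fin k) : c • α.basis i = (EuclideanSpace.single i c : 𝔼[k]) := by
  have h : c • (EuclideanSpace.single i 1 : 𝔼[k]) = EuclideanSpace.single i c := by
    ext j
    simp
  rw [basis_apply]
  exact h

theorem proj_eq {v : 𝔼[k]} {u : 𝔼[n]}
    (h : HasDerivAt (fun t : ℝ ↦ α.act (t • v) 0) u 0) :
    (α.space.proj (show α.space.lieAlg from v) : 𝔼[n]) = u := by
  rw [proj_apply]
  exact fderiv_apply_of_hasDerivAt ((α.contDiff_act_left 0).differentiable (by simp) 0)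
    (by simpa using h)

theorem isotropyAlg_eq (i : Fin k) {P : 𝔼[k] → 𝔼[n]}
    (hP : ∀ v : 𝔼[k], (α.space.proj (show α.space.lieAlg from v) : 𝔼[n]) = P v)
    (h : ∀ v, P v = 0 ↔ ∀ j, j ≠ i → v j = 0) :
    α.space.isotropyAlg = Submodule.span ℝ {α.basis i} := by
  refine Submodule.ext fun (v : 𝔼[k]) ↦ ?_
  rw [basis_apply, HomogeneousSpace.isotropyAlg]
  refine Iff.trans (iff_of_eq (congrArg (fun u : 𝔼[n] ↦ u = 0) (hP v))) ?_
  refine (h v).trans (Iff.trans ?_ Submodule.mem_span_singleton.symm)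
  constructor
  · intro hv
    refine ⟨v i, ?_⟩
    change v i • (EuclideanSpace.single i (1 : ℝ) : 𝔼[k]) = v
    ext j
    by_cases hj : j = i
    · subst hj
      simp
    · simp [hj, hv j hj]
  · rintro ⟨a, rfl⟩ j hj
    change (a • (EuclideanSpace.single i (1 : ℝ) : 𝔼[k])) j = 0
    simp [hj]

end SmoothAction

end GroupLaw

/-! ### Type 1.4¹.2 -/

/-- The group law of the simply connected group with Lie algebra of type 1.4¹.2, in the coordinates
`exp (x₁u₁ + x₂u₂ + x₃u₃) exp (x₀e₁) exp (x₄u₄)`. -/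
noncomputable def groupLaw141 (p : ℝ) : GroupLaw 5 where
  mul x y := !₂[x 0 + Real.exp (-x 4) * y 0,
    x 1 + Real.exp (-(p * x 4)) * (y 1 + Real.exp (x 4) * x 0 * y 2
      + Real.exp (x 4) ^ 2 * x 0 ^ 2 / 2 * y 3),
    x 2 + Real.exp (-(p * x 4)) * Real.exp (x 4) * (y 2 + Real.exp (x 4) * x 0 * y 3),
    x 3 + Real.exp (-(p * x 4)) * Real.exp (x 4) ^ 2 * y 3, x 4 + y 4]
  inv x := !₂[-(Real.exp (x 4) * x 0),
    -(Real.exp (p * x 4) * (x 1 - x 0 * x 2 + x 0 ^ 2 / 2 * x 3)),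
    -(Real.exp (p * x 4) * Real.exp (-x 4) * (x 2 - x 0 * x 3)),
    -(Real.exp (p * x 4) * Real.exp (-x 4) ^ 2 * x 3), -x 4]
  mul_assoc x y z := by
    ext i
    fin_cases i <;> simp [mul_add, Real.exp_add, Real.exp_neg] <;> field_simp <;> ring
  zero_mul x := by
    ext i
    fin_cases i <;> simp
  inv_mul x := by
    ext i
    fin_cases i <;> simp [Real.exp_neg] <;> field_simp <;> ring
  contDiff_mul := by
    rw [contDiff_euclidean]
    intro i
    fin_cases i <;> simp <;> fun_prop
  contDiff_inv := by
    rw [contDiff_euclidean]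
    intro i
    fin_cases i <;> simp <;> fun_prop

/-- The action of the group of type 1.4¹.2 on `M = G/H`. -/
noncomputable def action141 (p : ℝ) : (groupLaw141 p).SmoothAction 4 where
  act x y := !₂[x 1 + Real.exp (-(p * x 4)) * (y 0 + Real.exp (x 4) * x 0 * y 1
      + Real.exp (x 4) ^ 2 * x 0 ^ 2 / 2 * y 2),
    x 2 + Real.exp (-(p * x 4)) * Real.exp (x 4) * (y 1 + Real.exp (x 4) * x 0 * y 2),
    x 3 + Real.exp (-(p * x 4)) * Real.exp (x 4) ^ 2 * y 2, x 4 + y 3]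
  zero_act y := by
    ext i
    fin_cases i <;> simp
  mul_act x x' y := by
    ext i
    fin_cases i <;> simp [groupLaw141, mul_add, Real.exp_add, Real.exp_neg] <;> field_simp <;> ring
  contDiff_act := by
    rw [contDiff_euclidean]
    intro i
    fin_cases i <;> simp <;> fun_prop
  -- Elements with x₀ = 0 move the origin to the point with their remaining coordinates.
  transitive y := ⟨!₂[0, y 0, y 1, y 2, y 3], by
    ext i
    fin_cases i <;> simp⟩
  connected := by
    -- The isotropy group of the origin is the x₀-axis.
    have h : {x : 𝔼[5] | (!₂[x 1 + Real.exp (-(p * x 4)) * ((0 : 𝔼[4]) 0 +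
        Real.exp (x 4) * x 0 * (0 : 𝔼[4]) 1 + Real.exp (x 4) ^ 2 * x 0 ^ 2 / 2 * (0 : 𝔼[4]) 2),
        x 2 + Real.exp (-(p * x 4)) * Real.exp (x 4) * ((0 : 𝔼[4]) 1 +
          Real.exp (x 4) * x 0 * (0 : 𝔼[4]) 2),
        x 3 + Real.exp (-(p * x 4)) * Real.exp (x 4) ^ 2 * (0 : 𝔼[4]) 2, x 4 + (0 : 𝔼[4]) 3] : 𝔼[4])
        = 0} = Set.range fun s : ℝ ↦ (EuclideanSpace.single 0 s : 𝔼[5]) := by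
      ext x
      simp only [Set.mem_ofPred_eq, Set.mem_range]
      constructor
      · intro h
        have h0 := congrArg (fun v : 𝔼[4] ↦ v 0) h
        have h1 := congrArg (fun v : 𝔼[4] ↦ v 1) h
        have h2 := congrArg (fun v : 𝔼[4] ↦ v 2) h
        have h3 := congrArg (fun v : 𝔼[4] ↦ v 3) h
        simp at h0 h1 h2 h3
        refine ⟨x 0, ?_⟩
        ext i
        fin_cases i <;> simp [h0, h1, h2, h3]
      · rintro ⟨s, rfl⟩
        ext i
        fin_cases i <;> simp
    rw [h]
    refine isConnected_range ?_
    have : Continuous fun s : ℝ ↦ s • (EuclideanSpace.single 0 1 : 𝔼[5]) := by fun_prop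
    refine this.congr fun s ↦ ?_
    ext i
    simp

theorem leftField_groupLaw141 (p : ℝ) (w x : 𝔼[5]) : (groupLaw141 p).leftField w x =
    !₂[Real.exp (-x 4) * w 0, Real.exp (-(p * x 4)) * (w 1 + Real.exp (x 4) * x 0 * w 2
      + Real.exp (x 4) ^ 2 * x 0 ^ 2 / 2 * w 3),
    Real.exp (-(p * x 4)) * Real.exp (x 4) * (w 2 + Real.exp (x 4) * x 0 * w 3),
    Real.exp (-(p * x 4)) * Real.exp (x 4) ^ 2 * w 3, w 4] := by
  refine (groupLaw141 p).leftField_eq ?_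
  refine HasDerivAt.congr_of_eventuallyEq
    (hasDerivAt_add_smul x _)
    (Filter.Eventually.of_forall fun t ↦ ?_)
  ext i
  fin_cases i <;> simp [groupLaw141] <;> ring

theorem lie_groupLaw141 (p : ℝ) (v w : 𝔼[5]) :
    fderiv ℝ ((groupLaw141 p).leftField w) 0 v = !₂[-v 4 * w 0, -p * v 4 * w 1 + v 0 * w 2,
      (1 - p) * v 4 * w 2 + v 0 * w 3, (2 - p) * v 4 * w 3, 0] := by
  refine (groupLaw141 p).fderiv_leftField_eq ?_
  rw [hasDerivAt_euclidean_iff]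
  intro i
  have e : ∀ c : ℝ, HasDerivAt (fun t : ℝ ↦ Real.exp (t * c)) c 0 := fun c ↦ by
    simpa using ((hasDerivAt_id (0 : ℝ)).mul_const c).exp
  have l : ∀ c : ℝ, HasDerivAt (fun t : ℝ ↦ t * c) c 0 := fun c ↦ by
    simpa using (hasDerivAt_id (0 : ℝ)).mul_const c
  simp only [leftField_groupLaw141]
  fin_cases i
  · convert! (e (-v 4)).mul_const (w 0) using 1
    ext t
    simp
  · convert! (e (-p * v 4)).mul ((((e (v 4)).mul (l (v 0))).mul_const (w 2)).const_add (w 1) |>.add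
      ((((e (v 4)).pow 2).mul ((l (v 0)).pow 2)).mul_const (w 3 / 2))) using 1
    · ext t
      simp
      ring_nf
    · simp
  · convert! ((e (-p * v 4)).mul (e (v 4))).mul
      ((((e (v 4)).mul (l (v 0))).mul_const (w 3)).const_add (w 2)) using 1
    · ext t
      simp [-mul_eq_mul_right_iff, -mul_eq_mul_left_iff]
      ring_nf
    · simp [-mul_eq_mul_right_iff, -mul_eq_mul_left_iff]
      ring
  · convert! ((e (-p * v 4)).mul ((e (v 4)).pow 2)).mul_const (w 3) using 1
    · ext t
      simp [-mul_eq_mul_right_iff, -mul_eq_mul_left_iff]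
      ring_nf
    · simp [-mul_eq_mul_right_iff, -mul_eq_mul_left_iff]
      ring
  · simpa using hasDerivAt_const (0 : ℝ) (w 4)

theorem isKomrakov141_2_action141 (p : ℝ) : IsKomrakov141_2 p (action141 p).basis := by
  refine ⟨?_, ?_, ?_, ?_, ?_, ?_, ?_, ?_, ?_, ?_⟩
  all_goals
    try rw [GroupLaw.SmoothAction.smul_basis]
    refine (action141 p).lie_basis_eq ?_
    rw [lie_groupLaw141, lie_groupLaw141]
    ext i
    fin_cases i <;> simp [(action141 p).basis_apply] <;> rfl

theorem proj_action141 (p : ℝ) (v : 𝔼[5]) :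
    ((action141 p).space.proj (show (action141 p).space.lieAlg from v) : 𝔼[4]) =
      !₂[v 1, v 2, v 3, v 4] := by
  refine (action141 p).proj_eq ?_
  refine HasDerivAt.congr_of_eventuallyEq
    (by simpa using ((hasDerivAt_id (0 : ℝ)).smul_const _))
    (Filter.Eventually.of_forall fun t ↦ ?_)
  ext i
  fin_cases i <;> simp [action141]

theorem isotropyAlg_action141 (p : ℝ) :
    (action141 p).space.isotropyAlg = Submodule.span ℝ {(action141 p).basis 0} := by
  refine (action141 p).isotropyAlg_eq 0 (proj_action141 p) fun v ↦ ?_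
  constructor
  · intro h j hj
    have h0 := congrArg (fun v : 𝔼[4] ↦ v 0) h
    have h1 := congrArg (fun v : 𝔼[4] ↦ v 1) h
    have h2 := congrArg (fun v : 𝔼[4] ↦ v 2) h
    have h3 := congrArg (fun v : 𝔼[4] ↦ v 3) h
    simp at h0 h1 h2 h3
    fin_cases j <;> simp_all
  · intro h
    ext i
    fin_cases i <;> simp [h]

/-! ### Metrics, curvature and solitons of type 1.4¹.2 -/

/-- The invariant metrics of type 1.4¹.2 with `p = 1`. -/
noncomputable def metricField141 (A B C D : ℝ) (y : 𝔼[4]) : Matrix (Fin 4) (Fin 4) ℝ :=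
  !![0, 0, -A, 0; 0, A, 0, 0; -A, 0, B * Real.exp (-y 3) ^ 2, C * Real.exp (-y 3);
    0, 0, C * Real.exp (-y 3), D]

section Metric141

variable (A B C D : ℝ)

theorem contDiff_metricField141 (i j : Fin 4) :
    ContDiff ℝ ∞ (fun y ↦ metricField141 A B C D y i j) := by
  fin_cases i <;> fin_cases j <;> simp [metricField141] <;> fun_prop

theorem metricField141_symm (y : 𝔼[4]) (i j : Fin 4) :
    metricField141 A B C D y i j = metricField141 A B C D y j i := by
  fin_cases i <;> fin_cases j <;> simp [metricField141]

theorem isUnit_metricField141 {A D : ℝ} (hA : A ≠ 0) (hD : D ≠ 0) (y : 𝔼[4]) :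
    IsUnit (metricField141 A B C D y) := by
  rw [Matrix.isUnit_iff_isUnit_det, isUnit_iff_ne_zero]
  have : (metricField141 A B C D y).det = -A ^ 3 * D := by
    simp [metricField141, Matrix.det_succ_row_zero, Fin.sum_univ_succ, Fin.succAbove]
    ring
  rw [this]
  simp [hA, hD]

theorem partialD_metricField141 (k i j : Fin 4) (y : 𝔼[4]) :
    partialD k (fun z ↦ metricField141 A B C D z i j) y = if k = 3 then
      (!![0, 0, 0, 0; 0, 0, 0, 0; 0, 0, -2 * B * Real.exp (-y 3) ^ 2, -C * Real.exp (-y 3);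
        0, 0, -C * Real.exp (-y 3), 0] : Matrix (Fin 4) (Fin 4) ℝ) i j else 0 := by
  fin_cases i <;> fin_cases j <;> simp (disch := fun_prop) [metricField141, partialD_const, pow_two,
    partialD_mul, partialD_exp, partialD_neg, partialD_coord] <;> fin_cases k <;> simp <;> ring

/-- The proposed values are verified through the lowered equations of `christoffel_eq`, so the
matrix is never inverted. -/
theorem christoffel_metricField141 {A D : ℝ} (hA : A ≠ 0) (hD : D ≠ 0) (k i j : Fin 4) :
    christoffel (metricField141 A B C D) k i j = fun y ↦
      if k = 0 then
        (!![0, 0, 0, 0; 0, 0, 0, 0;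
          0, 0, B * C / (A * D) * Real.exp (-y 3) ^ 3, B / A * Real.exp (-y 3) ^ 2;
          0, 0, B / A * Real.exp (-y 3) ^ 2, C / A * Real.exp (-y 3)] : Matrix (Fin 4) (Fin 4) ℝ) i j
      else if k = 3 ∧ i = 2 ∧ j = 2 then B / D * Real.exp (-y 3) ^ 2 else 0 := by
  funext y
  refine christoffel_eq (isUnit_metricField141 B C hA hD y) (c := fun k ↦ if k = 0 then
        (!![0, 0, 0, 0; 0, 0, 0, 0;
          0, 0, B * C / (A * D) * Real.exp (-y 3) ^ 3, B / A * Real.exp (-y 3) ^ 2;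
          0, 0, B / A * Real.exp (-y 3) ^ 2, C / A * Real.exp (-y 3)] : Matrix (Fin 4) (Fin 4) ℝ) i j
      else if k = 3 ∧ i = 2 ∧ j = 2 then B / D * Real.exp (-y 3) ^ 2 else 0) (fun l ↦ ?_) k
  simp only [partialD_metricField141, Fin.sum_univ_four]
  fin_cases i <;> fin_cases j <;> fin_cases l <;> simp [metricField141] <;> field_simp <;> ring

end Metric141

theorem GroupLaw.SmoothAction.isInvariantMetricWith_ofMatrix {L : GroupLaw 5}
    (α : L.SmoothAction 4)
    (hP : ∀ v : 𝔼[5], (α.space.proj (show α.space.lieAlg from v) : 𝔼[4]) = !₂[v 1, v 2, v 3, v 4])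
    {G : 𝔼[4] → Matrix (Fin 4) (Fin 4) ℝ} {m : Matrix (Fin 4) (Fin 4) ℝ}
    (hG : ∀ i j, ContDiff ℝ ∞ (fun y ↦ G y i j)) (hs : ∀ y i j, G y i j = G y j i)
    (hu : ∀ y, IsUnit (G y))
    (hinv : (PseudoRiemannianMetric.ofMatrix G hG hs hu).IsInvariant α.space.G)
    (h0 : ∀ i j, G 0 i j = m i j) :
    IsInvariantMetricWith α.space α.basis m (PseudoRiemannianMetric.ofMatrix G hG hs hu) := by
  refine ⟨hinv, fun i j ↦ ?_⟩
  have hp : ∀ i : Fin 4, (α.space.proj (α.basis i.succ) : 𝔼[4]) = EuclideanSpace.single i 1 := by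
    intro i
    have h : (!₂[(EuclideanSpace.single i.succ 1 : 𝔼[5]) 1,
        (EuclideanSpace.single i.succ 1 : 𝔼[5]) 2, (EuclideanSpace.single i.succ 1 : 𝔼[5]) 3,
        (EuclideanSpace.single i.succ 1 : 𝔼[5]) 4] : 𝔼[4]) = EuclideanSpace.single i 1 := by
      ext j
      fin_cases i <;> fin_cases j <;> simp
    rw [GroupLaw.SmoothAction.basis_apply]
    exact (hP _).trans h
  -- The orbit map is differentiated at the identity, so its tangent vectors sit at `1 • base`,
  -- which has to be identified with the origin.
  have hb : (1 : α.space.G) • α.space.base = (0 : 𝔼[4]) := α.zero_act 0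
  have h1 : matrixForm (G 0) (EuclideanSpace.single i 1) (EuclideanSpace.single j 1) = m i j := by
    rw [matrixForm_single, h0]
  rw [← h1, ← hp i, ← hp j, ← hb]
  rfl

section Metric141

variable (A B C D : ℝ)

theorem ricciCoord_metricField141 {A D : ℝ} (hA : A ≠ 0) (hD : D ≠ 0) (i j : Fin 4) (y : 𝔼[4]) :
    ricciCoord (metricField141 A B C D) i j y =
      if i = 2 ∧ j = 2 then -2 * B / D * Real.exp (-y 3) ^ 2 else 0 := by
  simp only [ricciCoord, christoffel_metricField141 B C hA hD, Fin.sum_univ_four]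
  fin_cases i <;> fin_cases j <;> simp (disch := fun_prop) [partialD_const, pow_succ,
    partialD_mul, partialD_exp, partialD_neg, partialD_coord]
  all_goals ring

/-- The invariant vector field whose Lie derivative compensates the Ricci tensor. -/
noncomputable def solitonField141 (A C D : ℝ) (y : 𝔼[4]) : 𝔼[4] :=
  !₂[-(C / (A * D)) * Real.exp (-y 3), 0, 0, -(1 / D)]

theorem contDiff_solitonField141 : ContDiff ℝ ∞ (solitonField141 A C D) := by
  rw [contDiff_euclidean]
  intro i
  fin_cases i <;> simp [solitonField141] <;> fun_prop

/-- The component −1/D along ∂₃ rescales the (2,2) entry as required but also changes the (2,3)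
entry. The component along ∂₀ is chosen to cancel that change. -/
theorem lieDerivCoord_metricField141 {A D : ℝ} (hA : A ≠ 0) (hD : D ≠ 0) (i j : Fin 4) (y : 𝔼[4]) :
    lieDerivCoord (solitonField141 A C D) (metricField141 A B C D) i j y =
      if i = 2 ∧ j = 2 then 2 * B / D * Real.exp (-y 3) ^ 2 else 0 := by
  have h : ∀ k l : Fin 4, partialD k (fun z ↦ solitonField141 A C D z l) y =
      if k = 3 ∧ l = 0 then C / (A * D) * Real.exp (-y 3) else 0 := by
    intro k l
    fin_cases l <;> simp (disch := fun_prop) [solitonField141, partialD_const,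
      partialD_mul, partialD_exp, partialD_neg, partialD_coord] <;> fin_cases k <;> simp
  simp only [lieDerivCoord, partialD_metricField141, Fin.sum_univ_four, h]
  fin_cases i <;> fin_cases j <;> simp [solitonField141, metricField141] <;> field_simp
  all_goals ring

/-- The invariant pseudo-Riemannian metrics of type 1.4¹.2 with `p = 1`. -/
noncomputable def pseudoMetric141 {A D : ℝ} (hA : A ≠ 0) (hD : D ≠ 0) :
    PseudoRiemannianMetric 4 𝔼[4] :=
  PseudoRiemannianMetric.ofMatrix (metricField141 A B C D) (contDiff_metricField141 A B C D)
    (metricField141_symm A B C D) (isUnit_metricField141 B C hA hD)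

theorem fderiv_action141 (p : ℝ) (x : 𝔼[5]) (y v : 𝔼[4]) : fderiv ℝ ((action141 p).act x) y v =
    !₂[Real.exp (-(p * x 4)) * (v 0 + Real.exp (x 4) * x 0 * v 1
      + Real.exp (x 4) ^ 2 * x 0 ^ 2 / 2 * v 2),
    Real.exp (-(p * x 4)) * Real.exp (x 4) * (v 1 + Real.exp (x 4) * x 0 * v 2),
    Real.exp (-(p * x 4)) * Real.exp (x 4) ^ 2 * v 2, v 3] := by
  refine (action141 p).fderiv_act_eq ?_
  refine HasDerivAt.congr_of_eventuallyEq
    (hasDerivAt_add_smul ((action141 p).act x y) _)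
    (Filter.Eventually.of_forall fun t ↦ ?_)
  ext i
  fin_cases i <;> simp [action141] <;> ring

/-- For p = 1 the weights on dy₀, dy₁, dy₂ are e^{−x₄}, 1, e^{x₄}. They preserve dy₁² − 2dy₀dy₂, as
does the unipotent part coming from x₀, and e^{−y₃}dy₂ and dy₃ are invariant. -/
theorem isInvariant_pseudoMetric141 {A D : ℝ} (hA : A ≠ 0) (hD : D ≠ 0) :
    (pseudoMetric141 B C hA hD).IsInvariant (action141 1).space.G := by
  rw [GroupLaw.SmoothAction.isInvariant_iff]
  intro x y v w
  rw [fderiv_action141, fderiv_action141]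
  change matrixForm (metricField141 A B C D _) _ _ = matrixForm (metricField141 A B C D y) v w
  rw [matrixForm_apply, matrixForm_apply]
  simp only [Fin.sum_univ_four, metricField141, action141]
  simp [Real.exp_neg, Real.exp_add]
  field_simp
  ring

theorem isInvariantMetricWith_pseudoMetric141 {A D : ℝ} (hA : A ≠ 0) (hD : D ≠ 0) :
    IsInvariantMetricWith (action141 1).space (action141 1).basis (metric141 A B C D)
      (pseudoMetric141 B C hA hD) :=
  (action141 1).isInvariantMetricWith_ofMatrix (proj_action141 1) _ _ _
    (isInvariant_pseudoMetric141 B C hA hD) fun i j ↦ by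
      fin_cases i <;> fin_cases j <;> simp [metricField141, metric141]

theorem isInvariantRicciSoliton_pseudoMetric141 {A D : ℝ} (hA : A ≠ 0) (hD : D ≠ 0) :
    IsInvariantRicciSoliton (action141 1).space (pseudoMetric141 B C hA hD) 0 := by
  refine ⟨isInvariant_pseudoMetric141 B C hA hD, solitonField141 A C D, ?_, ?_⟩
  · rw [GroupLaw.SmoothAction.isInvariantField_iff]
    intro x y
    rw [fderiv_action141]
    ext i
    fin_cases i <;> simp [solitonField141, action141, Real.exp_add]
    ring
  · refine isRicciSoliton_ofMatrix (contDiff_solitonField141 A C D) fun y i j ↦ ?_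
    rw [lieDerivCoord_metricField141 B C hA hD, ricciCoord_metricField141 B C hA hD]
    split_ifs <;> ring

theorem not_isEinstein_pseudoMetric141 {A B D : ℝ} (hA : A ≠ 0) (hD : D ≠ 0) (hB : B ≠ 0) :
    ¬ (pseudoMetric141 B C hA hD).IsEinstein := by
  intro h
  obtain ⟨r, hr⟩ := IsEinstein.ricciCoord_eq h
  -- The metric entry (1,1) is A ≠ 0 while its Ricci entry vanishes. This forces the Einstein
  -- constant to be 0, against the entry (2,2).
  have h1 := hr 0 1 1
  have h2 := hr 0 2 2
  rw [ricciCoord_metricField141 B C hA hD] at h1 h2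
  simp [metricField141, hA] at h1 h2
  simp [h1, hB, hD] at h2

end Metric141

/-! ### A lift of addition along the complex exponential -/

/-- A logarithm of `exp p + b`, close to `p`. -/
noncomputable def logAdd (p b : ℂ) : ℂ := p + Complex.log (1 + b * Complex.exp (-p))

theorem re_one_add_mul_exp_pos {p b : ℂ} (h : ‖b‖ < ‖Complex.exp p‖) :
    0 < (1 + b * Complex.exp (-p)).re := by
  have h1 : ‖b * Complex.exp (-p)‖ < 1 := by
    rw [Complex.exp_neg, norm_mul, norm_inv, ← div_eq_mul_inv]
    exact (div_lt_one (norm_pos_iff.2 (Complex.exp_ne_zero _))).2 h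
  have h2 := neg_le_of_abs_le (Complex.abs_re_le_norm (b * Complex.exp (-p)))
  rw [Complex.add_re, Complex.one_re]
  linarith

theorem one_add_mul_exp_mem_slitPlane {p b : ℂ} (h : ‖b‖ < ‖Complex.exp p‖) :
    1 + b * Complex.exp (-p) ∈ Complex.slitPlane :=
  Or.inl (re_one_add_mul_exp_pos h)

theorem exp_logAdd {p b : ℂ} (h : ‖b‖ < ‖Complex.exp p‖) :
    Complex.exp (logAdd p b) = Complex.exp p + b := by
  rw [logAdd, Complex.exp_add, Complex.exp_log
    (Complex.slitPlane_ne_zero (one_add_mul_exp_mem_slitPlane h)), Complex.exp_neg]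
  field_simp

/-- The correcting factor 1 + b e^{−p} has positive real part. This bound is the only information
about branches used later. -/
theorem abs_im_logAdd_sub_lt {p b : ℂ} (h : ‖b‖ < ‖Complex.exp p‖) :
    |(logAdd p b).im - p.im| < Real.pi / 2 := by
  rw [logAdd, Complex.add_im, Complex.log_im, add_sub_cancel_left, Complex.abs_arg_lt_pi_div_two_iff]
  exact Or.inl (re_one_add_mul_exp_pos h)

theorem logAdd_zero (p : ℂ) : logAdd p 0 = p := by
  simp [logAdd]

/-- Two logarithms of one number differ by an integer multiple of 2πi. Up to four branch errors,
each below π/2, thus remain admissible. -/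
theorem eq_of_exp_eq_of_abs_im_sub_lt {p q : ℂ} (h : Complex.exp p = Complex.exp q)
    (him : |p.im - q.im| < 2 * Real.pi) : p = q := by
  obtain ⟨n, hn⟩ := Complex.exp_eq_exp_iff_exists_int.1 h
  have h1 : p.im - q.im = n * (2 * Real.pi) := by
    rw [hn]
    simp
  rw [h1, abs_mul, abs_of_pos Real.two_pi_pos] at him
  have h2 : |(n : ℝ)| < 1 := by
    by_contra! hc
    nlinarith [Real.two_pi_pos]
  have h3 : n = 0 := Int.abs_lt_one_iff.1 (by exact_mod_cast h2)
  simpa [h3] using hn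

theorem contDiff_logAdd {E : Type*} [NormedAddCommGroup E] [NormedSpace ℝ E] {f g : E → ℂ}
    (hf : ContDiff ℝ ∞ f) (hg : ContDiff ℝ ∞ g) (h : ∀ x, ‖g x‖ < ‖Complex.exp (f x)‖) :
    ContDiff ℝ ∞ (fun x ↦ logAdd (f x) (g x)) := by
  refine hf.add (contDiff_iff_contDiffAt.2 fun x ↦ ?_)
  have h1 : ContDiffAt ℝ ∞ Complex.log (1 + g x * Complex.exp (-f x)) :=
    (Complex.contDiffAt_log (one_add_mul_exp_mem_slitPlane (h x))).restrict_scalars ℝ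
  exact h1.comp x (contDiff_const.add (hg.mul hf.neg.cexp)).contDiffAt

theorem HasDerivAt.logAdd {f g : ℝ → ℂ} {f' g' : ℂ} {t : ℝ} (hf : HasDerivAt f f' t)
    (hg : HasDerivAt g g' t) (h0 : g t = 0) :
    HasDerivAt (fun s ↦ logAdd (f s) (g s)) (f' + g' * Complex.exp (-f t)) t := by
  have h1 : HasDerivAt (fun s ↦ 1 + g s * Complex.exp (-f s)) (g' * Complex.exp (-f t)) t := by
    simpa [h0] using (hg.mul hf.neg.cexp).const_add 1
  have h2 := h1.clog_real (by simp [h0])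
  simp only [h0, zero_mul, add_zero, div_one] at h2
  exact hf.add h2

theorem ContDiff.complex_conj {E : Type*} [NormedAddCommGroup E] [NormedSpace ℝ E] {f : E → ℂ}
    (hf : ContDiff ℝ ∞ f) : ContDiff ℝ ∞ (fun x ↦ (starRingEnd ℂ) (f x)) :=
  Complex.conjCLE.contDiff.comp hf

theorem HasDerivAt.complex_conj {f : ℝ → ℂ} {f' : ℂ} {t : ℝ} (hf : HasDerivAt f f' t) :
    HasDerivAt (fun x ↦ (starRingEnd ℂ) (f x)) ((starRingEnd ℂ) f') t :=
  Complex.conjCLE.hasFDerivAt.comp_hasDerivAt t hf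

theorem HasDerivAt.complex_re {f : ℝ → ℂ} {f' : ℂ} {t : ℝ} (hf : HasDerivAt f f' t) :
    HasDerivAt (fun x ↦ (f x).re) f'.re t :=
  Complex.reCLM.hasFDerivAt.comp_hasDerivAt t hf

theorem HasDerivAt.complex_im {f : ℝ → ℂ} {f' : ℂ} {t : ℝ} (hf : HasDerivAt f f' t) :
    HasDerivAt (fun x ↦ (f x).im) f'.im t :=
  Complex.imCLM.hasFDerivAt.comp_hasDerivAt t hf

theorem ContDiff.complex_re {E : Type*} [NormedAddCommGroup E] [NormedSpace ℝ E] {f : E → ℂ}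
    (hf : ContDiff ℝ ∞ f) : ContDiff ℝ ∞ (fun x ↦ (f x).re) :=
  Complex.reCLM.contDiff.comp hf

theorem ContDiff.complex_im {E : Type*} [NormedAddCommGroup E] [NormedSpace ℝ E] {f : E → ℂ}
    (hf : ContDiff ℝ ∞ f) : ContDiff ℝ ∞ (fun x ↦ (f x).im) :=
  Complex.imCLM.contDiff.comp hf

/-! ### Type 1.3¹.1: the universal covering of the affine group of the plane preserving area

An element of `SL(2,ℝ)` is the map `u ↦ α u + β ū` of `ℂ = ℝ²` with `|α|² = 1 + |β|²`, and an
element of the universal covering is a pair of `β` and of a logarithm of `α`. -/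

/-- The argument of `α`. -/
noncomputable def phi (x : 𝔼[5]) : ℝ := -x 0 / 2 - x 3 / 4

/-- The coefficient `β`. -/
noncomputable def beta (x : 𝔼[5]) : ℂ := ⟨-x 1 / 2, x 0 / 2 - x 3 / 4⟩

/-- The translation part. -/
noncomputable def shift (x : 𝔼[5]) : ℂ := ⟨x 2, x 4⟩

/-- The coordinates of the element with given `arg α`, `β` and translation part. -/
noncomputable def ofShear (φ : ℝ) (β b : ℂ) : 𝔼[5] :=
  !₂[β.im - φ, -2 * β.re, b.re, -2 * (β.im + φ), b.im]

/-- The logarithm of `α`. -/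
noncomputable def logAlpha (x : 𝔼[5]) : ℂ :=
  ⟨Real.log (1 + Complex.normSq (beta x)) / 2, phi x⟩

@[simp] theorem phi_ofShear (φ : ℝ) (β b : ℂ) : phi (ofShear φ β b) = φ := by
  simp [phi, ofShear]
  ring

@[simp] theorem beta_ofShear (φ : ℝ) (β b : ℂ) : beta (ofShear φ β b) = β := by
  apply Complex.ext <;> simp [beta, ofShear]
  ring

@[simp] theorem shift_ofShear (φ : ℝ) (β b : ℂ) : shift (ofShear φ β b) = b := by
  apply Complex.ext <;> simp [shift, ofShear]

theorem ofShear_phi (x : 𝔼[5]) : ofShear (phi x) (beta x) (shift x) = x := by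
  ext i
  fin_cases i <;> simp [ofShear, phi, beta, shift] <;> ring

theorem ext_shear {x y : 𝔼[5]} (h1 : phi x = phi y) (h2 : beta x = beta y)
    (h3 : shift x = shift y) : x = y := by
  rw [← ofShear_phi x, ← ofShear_phi y, h1, h2, h3]

theorem phi_smul (t : ℝ) (x : 𝔼[5]) : phi (t • x) = t * phi x := by
  simp [phi]
  ring

theorem beta_smul (t : ℝ) (x : 𝔼[5]) : beta (t • x) = t * beta x := by
  apply Complex.ext <;> simp [beta] <;> ring

theorem shift_smul (t : ℝ) (x : 𝔼[5]) : shift (t • x) = t * shift x := by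
  apply Complex.ext <;> simp [shift]

@[simp] theorem phi_zero : phi 0 = 0 := by simp [phi]

@[simp] theorem beta_zero : beta 0 = 0 := by simp [beta, Complex.ext_iff]

@[simp] theorem shift_zero : shift 0 = 0 := by simp [shift, Complex.ext_iff]

@[simp] theorem logAlpha_zero : logAlpha 0 = 0 := by simp [logAlpha, Complex.ext_iff]

theorem norm_exp_logAlpha_sq (x : 𝔼[5]) :
    ‖Complex.exp (logAlpha x)‖ ^ 2 = 1 + ‖beta x‖ ^ 2 := by
  have h : 0 < 1 + Complex.normSq (beta x) := by
    have := Complex.normSq_nonneg (beta x)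
    linarith
  rw [Complex.norm_exp, ← Real.exp_nat_mul, logAlpha, ← Complex.normSq_eq_norm_sq]
  push_cast
  rw [mul_div_cancel₀ _ two_ne_zero, Real.exp_log h]

theorem norm_beta_lt (x : 𝔼[5]) : ‖beta x‖ < ‖Complex.exp (logAlpha x)‖ := by
  have := norm_exp_logAlpha_sq x
  refine lt_of_pow_lt_pow_left₀ 2 (norm_nonneg _) ?_
  linarith

theorem exp_mul_conj (x : 𝔼[5]) : Complex.exp (logAlpha x) * (starRingEnd ℂ)
    (Complex.exp (logAlpha x)) = 1 + beta x * (starRingEnd ℂ) (beta x) := by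
  rw [Complex.mul_conj, Complex.mul_conj, Complex.normSq_eq_norm_sq, norm_exp_logAlpha_sq,
    Complex.normSq_eq_norm_sq]
  push_cast
  rfl

theorem norm_beta_mul_conj_lt (x y : 𝔼[5]) : ‖beta x * (starRingEnd ℂ) (beta y)‖ <
    ‖Complex.exp (logAlpha x + logAlpha y)‖ := by
  rw [Complex.exp_add, norm_mul, norm_mul, RCLike.norm_conj]
  exact mul_lt_mul'' (norm_beta_lt x) (norm_beta_lt y) (norm_nonneg _) (norm_nonneg _)

/-- The modulus of α is determined by |α|² = 1 + |β|², so a logarithm of α is recognized by this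
relation and its imaginary part. -/
theorem logAlpha_eq_of_exp {x : 𝔼[5]} {p : ℂ} (him : phi x = p.im)
    (h : Complex.exp p * (starRingEnd ℂ) (Complex.exp p) = 1 + beta x * (starRingEnd ℂ) (beta x)) :
    logAlpha x = p := by
  refine Complex.ext ?_ him
  rw [Complex.mul_conj, Complex.mul_conj, Complex.normSq_eq_norm_sq, Complex.norm_exp,
    ← Real.exp_nat_mul] at h
  have h1 : Real.exp ((2 : ℕ) * p.re) = 1 + Complex.normSq (beta x) := by exact_mod_cast h
  rw [logAlpha, ← h1, Real.log_exp]
  push_cast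
  ring

/-- The product in the universal covering group. -/
noncomputable def mul131 (x y : 𝔼[5]) : 𝔼[5] :=
  ofShear (logAdd (logAlpha x + logAlpha y) (beta x * (starRingEnd ℂ) (beta y))).im
    (Complex.exp (logAlpha x) * beta y + beta x * (starRingEnd ℂ) (Complex.exp (logAlpha y)))
    (shift x + Complex.exp (logAlpha x) * shift y + beta x * (starRingEnd ℂ) (shift y))

theorem beta_mul131 (x y : 𝔼[5]) : beta (mul131 x y) = Complex.exp (logAlpha x) * beta y +
    beta x * (starRingEnd ℂ) (Complex.exp (logAlpha y)) := by
  simp [mul131]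

theorem shift_mul131 (x y : 𝔼[5]) : shift (mul131 x y) =
    shift x + Complex.exp (logAlpha x) * shift y + beta x * (starRingEnd ℂ) (shift y) := by
  simp [mul131]

theorem logAlpha_mul131 (x y : 𝔼[5]) : logAlpha (mul131 x y) =
    logAdd (logAlpha x + logAlpha y) (beta x * (starRingEnd ℂ) (beta y)) := by
  refine logAlpha_eq_of_exp (by simp [mul131]) ?_
  have hx := exp_mul_conj x
  have hy := exp_mul_conj y
  rw [exp_logAdd (norm_beta_mul_conj_lt x y), Complex.exp_add]
  simp only [mul131, beta_ofShear, map_add, map_mul, Complex.conj_conj]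
  -- Multiplicativity of the determinant |α|² − |β|².
  linear_combination (Complex.exp (logAlpha y) * (starRingEnd ℂ) (Complex.exp (logAlpha y)) -
    beta y * (starRingEnd ℂ) (beta y)) * hx + hy

theorem exp_logAlpha_mul131 (x y : 𝔼[5]) : Complex.exp (logAlpha (mul131 x y)) =
    Complex.exp (logAlpha x) * Complex.exp (logAlpha y) + beta x * (starRingEnd ℂ) (beta y) := by
  rw [logAlpha_mul131, exp_logAdd (norm_beta_mul_conj_lt x y), Complex.exp_add]

theorem abs_phi_mul131_lt (x y : 𝔼[5]) : |phi (mul131 x y) - (phi x + phi y)| < Real.pi / 2 := by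
  simpa [mul131, logAlpha] using abs_im_logAdd_sub_lt (norm_beta_mul_conj_lt x y)

theorem contDiff_phi : ContDiff ℝ ∞ phi := by
  unfold phi
  fun_prop

theorem contDiff_complex_mk {E : Type*} [NormedAddCommGroup E] [NormedSpace ℝ E] {f g : E → ℝ}
    (hf : ContDiff ℝ ∞ f) (hg : ContDiff ℝ ∞ g) : ContDiff ℝ ∞ (fun x ↦ (⟨f x, g x⟩ : ℂ)) :=
  Complex.equivRealProdCLM.symm.contDiff.comp (hf.prodMk hg)

theorem contDiff_beta : ContDiff ℝ ∞ beta :=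
  contDiff_complex_mk (by fun_prop) (by fun_prop)

theorem contDiff_shift : ContDiff ℝ ∞ shift :=
  contDiff_complex_mk (by fun_prop) (by fun_prop)

theorem contDiff_logAlpha : ContDiff ℝ ∞ logAlpha := by
  refine contDiff_complex_mk (ContDiff.div_const (ContDiff.log ?_ fun x ↦ ?_) 2) contDiff_phi
  · have h : ∀ x, Complex.normSq (beta x) = (beta x).re * (beta x).re + (beta x).im * (beta x).im :=
      fun x ↦ Complex.normSq_apply _
    simp only [h]
    exact contDiff_const.add ((contDiff_beta.complex_re.mul contDiff_beta.complex_re).add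
      (contDiff_beta.complex_im.mul contDiff_beta.complex_im))
  · have := Complex.normSq_nonneg (beta x)
    positivity

theorem contDiff_ofShear {E : Type*} [NormedAddCommGroup E] [NormedSpace ℝ E] {f : E → ℝ}
    {g h : E → ℂ} (hf : ContDiff ℝ ∞ f) (hg : ContDiff ℝ ∞ g) (hh : ContDiff ℝ ∞ h) :
    ContDiff ℝ ∞ (fun x ↦ ofShear (f x) (g x) (h x)) := by
  rw [contDiff_euclidean]
  intro i
  fin_cases i
  · exact hg.complex_im.sub hf
  · exact contDiff_const.mul hg.complex_re
  · exact hh.complex_re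
  · exact contDiff_const.mul (hg.complex_im.add hf)
  · exact hh.complex_im

theorem HasDerivAt.ofShear {f : ℝ → ℝ} {g h : ℝ → ℂ} {f' : ℝ} {g' h' : ℂ} {t : ℝ}
    (hf : HasDerivAt f f' t) (hg : HasDerivAt g g' t) (hh : HasDerivAt h h' t) :
    HasDerivAt (fun x ↦ ofShear (f x) (g x) (h x)) (ofShear f' g' h') t := by
  rw [hasDerivAt_euclidean_iff]
  intro i
  fin_cases i
  · exact hg.complex_im.sub hf
  · exact hg.complex_re.const_mul (-2)
  · exact hh.complex_re
  · exact (hg.complex_im.add hf).const_mul (-2)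
  · exact hh.complex_im

/-- The universal covering group of `SL(2,ℝ) ⋉ ℝ²`. -/
noncomputable def groupLaw131 : GroupLaw 5 where
  mul := mul131
  inv x := ofShear (-phi x) (-beta x)
    (beta x * (starRingEnd ℂ) (shift x) - (starRingEnd ℂ) (Complex.exp (logAlpha x)) * shift x)
  mul_assoc x y z := by
    refine ext_shear ?_ ?_ ?_
    · have h : logAlpha (mul131 (mul131 x y) z) = logAlpha (mul131 x (mul131 y z)) := by
        -- After exponentiation this is associativity of matrix multiplication. The two bracketings
        -- involve two products each, so the arguments differ by less than 4 · π/2.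
        refine eq_of_exp_eq_of_abs_im_sub_lt ?_ ?_
        · simp only [exp_logAlpha_mul131]
          simp only [beta_mul131, map_add, map_mul, Complex.conj_conj]
          ring
        · have h1 := abs_lt.1 (abs_phi_mul131_lt (mul131 x y) z)
          have h2 := abs_lt.1 (abs_phi_mul131_lt x y)
          have h3 := abs_lt.1 (abs_phi_mul131_lt x (mul131 y z))
          have h4 := abs_lt.1 (abs_phi_mul131_lt y z)
          change |phi _ - phi _| < _
          rw [abs_lt]
          constructor <;> linarith
      exact congrArg Complex.im h
    · simp only [beta_mul131, exp_logAlpha_mul131, map_add, map_mul, Complex.conj_conj]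
      ring
    · simp only [shift_mul131, beta_mul131, exp_logAlpha_mul131, map_add, map_mul,
        Complex.conj_conj]
      ring
  zero_mul x := by
    refine ext_shear ?_ ?_ ?_ <;> simp [mul131, logAdd_zero]
    rfl
  inv_mul x := by
    set y : 𝔼[5] := ofShear (-phi x) (-beta x) (beta x * (starRingEnd ℂ) (shift x) -
      (starRingEnd ℂ) (Complex.exp (logAlpha x)) * shift x) with hy
    -- The inverse of u ↦ αu + βū is u ↦ ᾱu − βū, as the determinant is 1.
    have h : logAlpha y = (starRingEnd ℂ) (logAlpha x) := by
      refine logAlpha_eq_of_exp (by simp [hy, logAlpha]) ?_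
      rw [← Complex.exp_conj, Complex.conj_conj, Complex.exp_conj, mul_comm, exp_mul_conj]
      simp [hy]
    have he : Complex.exp (logAlpha y) = (starRingEnd ℂ) (Complex.exp (logAlpha x)) := by
      rw [h, Complex.exp_conj]
    have h0 : logAlpha (mul131 y x) = 0 := by
      refine eq_of_exp_eq_of_abs_im_sub_lt ?_ ?_
      · rw [exp_logAlpha_mul131, he, mul_comm, exp_mul_conj]
        simp [hy]
      · have := abs_phi_mul131_lt y x
        change |phi _ - 0| < _
        rw [hy, phi_ofShear, neg_add_cancel, ← hy] at this
        linarith [Real.pi_pos]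
    refine ext_shear ?_ ?_ ?_
    · rw [phi_zero]
      exact congrArg Complex.im h0
    · rw [mul131, beta_ofShear, he, hy, beta_ofShear, beta_zero]
      ring
    · rw [mul131, shift_ofShear, he, hy, beta_ofShear, shift_ofShear, shift_zero]
      ring
  contDiff_mul := by
    have h1 := contDiff_logAlpha.comp (contDiff_fst (E := 𝔼[5]) (F := 𝔼[5]))
    have h2 := contDiff_logAlpha.comp (contDiff_snd (E := 𝔼[5]) (F := 𝔼[5]))
    have h3 := contDiff_beta.comp (contDiff_fst (E := 𝔼[5]) (F := 𝔼[5]))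
    have h4 := contDiff_beta.comp (contDiff_snd (E := 𝔼[5]) (F := 𝔼[5]))
    have h5 := contDiff_shift.comp (contDiff_fst (E := 𝔼[5]) (F := 𝔼[5]))
    have h6 := contDiff_shift.comp (contDiff_snd (E := 𝔼[5]) (F := 𝔼[5]))
    exact contDiff_ofShear
      (contDiff_logAdd (h1.add h2) (h3.mul h4.complex_conj)
        fun p ↦ norm_beta_mul_conj_lt p.1 p.2).complex_im
      ((h1.cexp.mul h4).add (h3.mul h2.cexp.complex_conj))
      ((h5.add (h1.cexp.mul h6)).add (h3.mul h6.complex_conj))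
  contDiff_inv := contDiff_ofShear contDiff_phi.neg contDiff_beta.neg
    ((contDiff_beta.mul contDiff_shift.complex_conj).sub
      (contDiff_logAlpha.cexp.complex_conj.mul contDiff_shift))

theorem hasDerivAt_beta_smul (v : 𝔼[5]) : HasDerivAt (fun t : ℝ ↦ beta (t • v)) (beta v) 0 := by
  simpa [beta_smul] using (Complex.ofRealCLM.hasDerivAt (x := 0)).mul_const (beta v)

theorem hasDerivAt_shift_smul (v : 𝔼[5]) : HasDerivAt (fun t : ℝ ↦ shift (t • v)) (shift v) 0 := by
  simpa [shift_smul] using (Complex.ofRealCLM.hasDerivAt (x := 0)).mul_const (shift v)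

theorem hasDerivAt_phi_smul (v : 𝔼[5]) : HasDerivAt (fun t : ℝ ↦ phi (t • v)) (phi v) 0 := by
  simpa [phi_smul] using (hasDerivAt_id (0 : ℝ)).mul_const (phi v)

theorem hasDerivAt_logAlpha_smul (v : 𝔼[5]) :
    HasDerivAt (fun t : ℝ ↦ logAlpha (t • v)) (Complex.I * phi v) 0 := by
  have h1 : HasDerivAt (fun t : ℝ ↦ Real.log (1 + t ^ 2 * Complex.normSq (beta v)) / 2) 0 0 := by
    have := ((((hasDerivAt_id (0 : ℝ)).pow 2).mul_const (Complex.normSq (beta v))).const_add 1).log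
      (by simp)
    simpa using this.div_const 2
  have h2 := Complex.ofRealCLM.hasFDerivAt.comp_hasDerivAt 0 h1
  have h3 := Complex.ofRealCLM.hasFDerivAt.comp_hasDerivAt 0 (hasDerivAt_phi_smul v)
  convert! h2.add (h3.mul_const Complex.I) using 1
  · ext t
    apply Complex.ext <;> simp [logAlpha, beta_smul, pow_two]
  · simp [mul_comm]

theorem leftField_groupLaw131 (w x : 𝔼[5]) : groupLaw131.leftField w x =
    ofShear (phi w + (beta x * (starRingEnd ℂ) (beta w) * Complex.exp (-logAlpha x)).im)
      (Complex.exp (logAlpha x) * beta w - beta x * (Complex.I * phi w))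
      (Complex.exp (logAlpha x) * shift w + beta x * (starRingEnd ℂ) (shift w)) := by
  refine groupLaw131.leftField_eq ?_
  have h1 := hasDerivAt_logAlpha_smul w
  have h2 := hasDerivAt_beta_smul w
  have h3 := hasDerivAt_shift_smul w
  have h4 := ((h1.const_add (logAlpha x)).logAdd (h2.complex_conj.const_mul (beta x))
    (by simp)).complex_im
  have h5 := (h2.const_mul (Complex.exp (logAlpha x))).add
    (h1.cexp.complex_conj.const_mul (beta x))
  have h6 := ((h3.const_mul (Complex.exp (logAlpha x))).const_add (shift x)).add
    (h3.complex_conj.const_mul (beta x))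
  convert! HasDerivAt.ofShear h4 h5 h6 using 1
  simp [sub_eq_add_neg]

/-! ### The homogeneous space of type 1.3¹.1 and the action on it -/

/-- The logarithm of the point of the universal covering of `ℂ \ {0}` lying below a point of `M`. -/
noncomputable def logV (y : 𝔼[4]) : ℂ := ⟨-y 0 / 2, -y 2 / 2⟩

/-- The affine coordinate of a point of `M`, twisted by `v̄`. -/
noncomputable def twist (y : 𝔼[4]) : ℂ := ⟨y 1, y 3⟩

/-- The coordinates of a point of `M`. -/
noncomputable def ofLogV (z w : ℂ) : 𝔼[4] := !₂[-2 * z.re, w.re, -2 * z.im, w.im]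

/-- The vector `v = exp z`. -/
noncomputable def vecV (y : 𝔼[4]) : ℂ := Complex.exp (logV y)

/-- The point `x` of the plane. -/
noncomputable def ptX (y : 𝔼[4]) : ℂ := twist y * (starRingEnd ℂ) (Complex.exp (-logV y))

@[simp] theorem logV_ofLogV (z w : ℂ) : logV (ofLogV z w) = z := by
  apply Complex.ext <;> simp [logV, ofLogV]

@[simp] theorem twist_ofLogV (z w : ℂ) : twist (ofLogV z w) = w := by
  apply Complex.ext <;> simp [twist, ofLogV]

theorem ofLogV_logV (y : 𝔼[4]) : ofLogV (logV y) (twist y) = y := by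
  ext i
  fin_cases i <;> simp [ofLogV, logV, twist] <;> ring

theorem ext_logV {y y' : 𝔼[4]} (h1 : logV y = logV y') (h2 : twist y = twist y') : y = y' := by
  rw [← ofLogV_logV y, ← ofLogV_logV y', h1, h2]

theorem vecV_ne_zero (y : 𝔼[4]) : vecV y ≠ 0 := Complex.exp_ne_zero _

theorem twist_eq (y : 𝔼[4]) : twist y = ptX y * (starRingEnd ℂ) (vecV y) := by
  rw [ptX, vecV, mul_assoc, ← map_mul, ← Complex.exp_add]
  simp

theorem ext_vecV {y y' : 𝔼[4]} (h1 : logV y = logV y') (h2 : ptX y = ptX y') : y = y' :=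
  ext_logV h1 (by rw [twist_eq, twist_eq, h2, vecV, vecV, h1])

@[simp] theorem logV_zero : logV 0 = 0 := by simp [logV, Complex.ext_iff]

@[simp] theorem twist_zero : twist 0 = 0 := by simp [twist, Complex.ext_iff]

@[simp] theorem ptX_zero : ptX 0 = 0 := by simp [ptX]

@[simp] theorem vecV_zero : vecV 0 = 1 := by simp [vecV]

theorem contDiff_logV : ContDiff ℝ ∞ logV := contDiff_complex_mk (by fun_prop) (by fun_prop)

theorem contDiff_twist : ContDiff ℝ ∞ twist := contDiff_complex_mk (by fun_prop) (by fun_prop)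

theorem contDiff_ofLogV {E : Type*} [NormedAddCommGroup E] [NormedSpace ℝ E] {f g : E → ℂ}
    (hf : ContDiff ℝ ∞ f) (hg : ContDiff ℝ ∞ g) : ContDiff ℝ ∞ (fun x ↦ ofLogV (f x) (g x)) := by
  rw [contDiff_euclidean]
  intro i
  fin_cases i
  · exact contDiff_const.mul hf.complex_re
  · exact hg.complex_re
  · exact contDiff_const.mul hf.complex_im
  · exact hg.complex_im

theorem HasDerivAt.ofLogV {f g : ℝ → ℂ} {f' g' : ℂ} {t : ℝ} (hf : HasDerivAt f f' t)
    (hg : HasDerivAt g g' t) :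
    HasDerivAt (fun x ↦ ofLogV (f x) (g x)) (ofLogV f' g') t := by
  rw [hasDerivAt_euclidean_iff]
  intro i
  fin_cases i
  · exact hf.complex_re.const_mul (-2)
  · exact hg.complex_re
  · exact hf.complex_im.const_mul (-2)
  · exact hg.complex_im

theorem contDiff_vecV : ContDiff ℝ ∞ vecV := contDiff_logV.cexp

theorem contDiff_ptX : ContDiff ℝ ∞ ptX := contDiff_twist.mul contDiff_logV.neg.cexp.complex_conj

/-- The logarithm of the image of `v` under an element of the group. -/
noncomputable def logVAct (x : 𝔼[5]) (y : 𝔼[4]) : ℂ :=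
  logAdd (logAlpha x + logV y) (beta x * (starRingEnd ℂ) (vecV y))

theorem norm_beta_mul_lt (x : 𝔼[5]) (y : 𝔼[4]) : ‖beta x * (starRingEnd ℂ) (vecV y)‖ <
    ‖Complex.exp (logAlpha x + logV y)‖ := by
  rw [Complex.exp_add, norm_mul, norm_mul, RCLike.norm_conj]
  exact mul_lt_mul_of_pos_right (norm_beta_lt x) (norm_pos_iff.2 (vecV_ne_zero y))

/-- The action of the group of type 1.3¹.1 on `M = G/H`. -/
noncomputable def act131 (x : 𝔼[5]) (y : 𝔼[4]) : 𝔼[4] :=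
  ofLogV (logVAct x y) ((Complex.exp (logAlpha x) * ptX y + beta x * (starRingEnd ℂ) (ptX y)
    + shift x) * (starRingEnd ℂ) (Complex.exp (logVAct x y)))

theorem logV_act131 (x : 𝔼[5]) (y : 𝔼[4]) : logV (act131 x y) =
    logAdd (logAlpha x + logV y) (beta x * (starRingEnd ℂ) (vecV y)) :=
  logV_ofLogV _ _

theorem vecV_act131 (x : 𝔼[5]) (y : 𝔼[4]) : vecV (act131 x y) =
    Complex.exp (logAlpha x) * vecV y + beta x * (starRingEnd ℂ) (vecV y) := by
  rw [vecV, logV_act131, exp_logAdd (norm_beta_mul_lt x y), Complex.exp_add]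
  rfl

theorem ptX_act131 (x : 𝔼[5]) (y : 𝔼[4]) : ptX (act131 x y) =
    Complex.exp (logAlpha x) * ptX y + beta x * (starRingEnd ℂ) (ptX y) + shift x := by
  rw [ptX, act131, logV_ofLogV, twist_ofLogV, mul_assoc, ← map_mul, ← Complex.exp_add]
  simp

theorem abs_im_logV_act131_lt (x : 𝔼[5]) (y : 𝔼[4]) :
    |(logV (act131 x y)).im - (phi x + (logV y).im)| < Real.pi / 2 := by
  rw [logV_act131]
  exact abs_im_logAdd_sub_lt (norm_beta_mul_lt x y)

theorem logV_eq_of_vecV_eq {y : 𝔼[4]} {z : ℂ} (h : vecV y = Complex.exp z)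
    (him : |(logV y).im - z.im| < 2 * Real.pi) : logV y = z :=
  eq_of_exp_eq_of_abs_im_sub_lt h him

/-- Fixing v = 1 means α + β = 1. With |α|² = 1 + |β|² this makes β = is purely imaginary and α = 1
− is, and the branch bound selects the principal argument. The isotropy group is therefore a curve,
hence connected. -/
theorem act131_zero_eq_zero_iff (x : 𝔼[5]) : act131 x 0 = 0 ↔
    ∃ s : ℝ, ofShear (Complex.log (1 - s * Complex.I)).im (s * Complex.I) 0 = x := by
  have hre : ∀ s : ℝ, 1 - s * Complex.I ∈ Complex.slitPlane := fun s ↦ Or.inl (by simp)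
  constructor
  · intro h
    have h1 := vecV_act131 x 0
    have h2 := ptX_act131 x 0
    have h3 := abs_im_logV_act131_lt x 0
    simp only [h, vecV_zero, ptX_zero, map_one, mul_one, map_zero, mul_zero, zero_add, logV_zero,
      Complex.zero_im, add_zero, zero_sub, abs_neg] at h1 h2 h3
    have h4 := exp_mul_conj x
    have h5 : Complex.exp (logAlpha x) = 1 - beta x := by rw [h1]; ring
    have h6 : (beta x).re = 0 := by
      rw [h5] at h4
      have := congrArg Complex.re h4
      simp at this
      linarith
    have h7 : beta x = (beta x).im * Complex.I := by apply Complex.ext <;> simp [h6]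
    refine ⟨(beta x).im, ext_shear ?_ ?_ ?_⟩
    · rw [phi_ofShear, ← h7, ← h5, Complex.log_exp]
      · rfl
      · change _ < phi x
        linarith [abs_lt.1 h3, Real.pi_pos]
      · change phi x ≤ _
        linarith [abs_lt.1 h3, Real.pi_pos]
    · rw [beta_ofShear, ← h7]
    · rw [shift_ofShear, ← h2]
  · rintro ⟨s, rfl⟩
    set x : 𝔼[5] := ofShear (Complex.log (1 - s * Complex.I)).im (s * Complex.I) 0 with hx
    have h1 : logAlpha x = Complex.log (1 - s * Complex.I) := by
      refine logAlpha_eq_of_exp (by simp [hx]) ?_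
      rw [Complex.exp_log (Complex.slitPlane_ne_zero (hre s))]
      simp [hx]
      ring
    have h2 : Complex.exp (logAlpha x) = 1 - s * Complex.I := by
      rw [h1, Complex.exp_log (Complex.slitPlane_ne_zero (hre s))]
    refine ext_vecV ?_ ?_
    · rw [logV_zero]
      refine logV_eq_of_vecV_eq ?_ ?_
      · rw [vecV_act131, h2]
        simp [hx]
      · have h3 := abs_lt.1 (abs_im_logV_act131_lt x 0)
        have h4 : |phi x| ≤ Real.pi := by
          rw [hx, phi_ofShear, Complex.log_im]
          exact Complex.abs_arg_le_pi _
        have h5 := abs_le.1 h4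
        simp only [logV_zero, Complex.zero_im] at h3 ⊢
        rw [abs_lt]
        constructor <;> linarith [Real.pi_pos]
    · rw [ptX_act131, ptX_zero, hx]
      simp

/-- The homogeneous space of type 1.3¹.1, which is the universal covering of the space of pairs of
a nonzero vector and a point of the plane. -/
noncomputable def action131 : groupLaw131.SmoothAction 4 where
  act := act131
  zero_act y := by
    refine ext_vecV ?_ ?_
    · rw [logV_act131]
      simp [logAdd_zero]
    · rw [ptX_act131]
      simp
  mul_act x x' y := by
    change act131 (mul131 x x') y = _
    refine ext_vecV (logV_eq_of_vecV_eq ?_ ?_) ?_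
    · change _ = vecV _
      simp only [vecV_act131, exp_logAlpha_mul131, beta_mul131, map_add, map_mul, Complex.conj_conj]
      ring
    · have h1 := abs_lt.1 (abs_im_logV_act131_lt (mul131 x x') y)
      have h2 := abs_lt.1 (abs_phi_mul131_lt x x')
      have h3 := abs_lt.1 (abs_im_logV_act131_lt x (act131 x' y))
      have h4 := abs_lt.1 (abs_im_logV_act131_lt x' y)
      rw [abs_lt]
      constructor <;> linarith
    · simp only [ptX_act131, exp_logAlpha_mul131, beta_mul131, shift_mul131, map_add, map_mul,
        Complex.conj_conj]
      ring
  contDiff_act := by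
    have h1 := contDiff_logAlpha.comp (contDiff_fst (E := 𝔼[5]) (F := 𝔼[4]))
    have h2 := contDiff_beta.comp (contDiff_fst (E := 𝔼[5]) (F := 𝔼[4]))
    have h3 := contDiff_shift.comp (contDiff_fst (E := 𝔼[5]) (F := 𝔼[4]))
    have h4 := contDiff_logV.comp (contDiff_snd (E := 𝔼[5]) (F := 𝔼[4]))
    have h5 := contDiff_vecV.comp (contDiff_snd (E := 𝔼[5]) (F := 𝔼[4]))
    have h6 := contDiff_ptX.comp (contDiff_snd (E := 𝔼[5]) (F := 𝔼[4]))
    have h7 := contDiff_logAdd (h1.add h4) (h2.mul h5.complex_conj)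
      fun p ↦ norm_beta_mul_lt p.1 p.2
    exact contDiff_ofLogV h7
      ((((h1.cexp.mul h6).add (h2.mul h6.complex_conj)).add h3).mul h7.cexp.complex_conj)
  transitive y := by
    set z := logV y with hz
    -- With z = log v, take α = cosh(Re z) e^{i Im z} and β = sinh(Re z) e^{i Im z}. Then α + β =
    -- e^z, and the translation part carries 0 to the point x of the plane.
    let x : 𝔼[5] := ofShear z.im (Real.sinh z.re * Complex.exp (z.im * Complex.I)) (ptX y)
    have hc : (Complex.exp (z.im * Complex.I)) * (starRingEnd ℂ) (Complex.exp (z.im * Complex.I))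
        = 1 := by
      rw [← Complex.exp_conj, ← Complex.exp_add]
      simp
    have h1 : logAlpha x = Real.log (Real.cosh z.re) + z.im * Complex.I := by
      refine logAlpha_eq_of_exp (by simp [x]) ?_
      rw [Complex.exp_add, ← Complex.ofReal_exp, Real.exp_log (Real.cosh_pos _)]
      simp only [x, beta_ofShear, map_mul, Complex.conj_ofReal]
      have h : (Real.cosh z.re : ℂ) ^ 2 = 1 + (Real.sinh z.re : ℂ) ^ 2 := by
        exact_mod_cast (Real.cosh_sq' z.re)
      linear_combination ((Real.cosh z.re : ℂ) ^ 2 - (Real.sinh z.re : ℂ) ^ 2) * hc + h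
    refine ⟨x, ext_vecV (logV_eq_of_vecV_eq ?_ ?_) ?_⟩
    · rw [vecV_act131, h1, Complex.exp_add, ← Complex.ofReal_exp, Real.exp_log (Real.cosh_pos _),
        vecV_zero, ← hz]
      simp only [x, beta_ofShear, map_one, mul_one]
      rw [← add_mul, ← Complex.ofReal_add, Real.cosh_add_sinh, Complex.ofReal_exp, ← Complex.exp_add,
        Complex.re_add_im]
    · have h3 := abs_im_logV_act131_lt x 0
      simp only [x, phi_ofShear, logV_zero, Complex.zero_im, add_zero] at h3
      exact h3.trans (by linarith [Real.pi_pos])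
    · rw [ptX_act131]
      simp [x]
  connected := by
    have h : {x : 𝔼[5] | act131 x 0 = 0} = Set.range fun s : ℝ ↦
        ofShear (Complex.log (1 - s * Complex.I)).im (s * Complex.I) 0 :=
      Set.ext act131_zero_eq_zero_iff
    rw [h]
    refine isConnected_range (ContDiff.continuous (𝕜 := ℝ) (n := ∞) ?_)
    have h1 : ContDiff ℝ ∞ fun s : ℝ ↦ (s : ℂ) := Complex.ofRealCLM.contDiff
    refine contDiff_ofShear (ContDiff.complex_im ?_) (h1.mul contDiff_const) contDiff_const
    refine contDiff_iff_contDiffAt.2 fun s ↦ ?_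
    have h2 : ContDiffAt ℝ ∞ Complex.log (1 - s * Complex.I) :=
      (Complex.contDiffAt_log (Or.inl (by simp))).restrict_scalars ℝ
    exact h2.comp s (contDiff_const.sub (h1.mul contDiff_const)).contDiffAt

/-- Antisymmetrizing in v and w yields the Lie bracket in the coordinates (arg α, β, translation).
-/
theorem lie_groupLaw131 (v w : 𝔼[5]) : fderiv ℝ (groupLaw131.leftField w) 0 v =
    ofShear (beta v * (starRingEnd ℂ) (beta w)).im
      (Complex.I * (phi v * beta w - phi w * beta v))
      (Complex.I * phi v * shift w + beta v * (starRingEnd ℂ) (shift w)) := by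
  refine groupLaw131.fderiv_leftField_eq ?_
  simp only [leftField_groupLaw131]
  have h1 := hasDerivAt_logAlpha_smul v
  have h2 := hasDerivAt_beta_smul v
  have h4 := (((h2.mul_const ((starRingEnd ℂ) (beta w))).mul h1.neg.cexp).complex_im).const_add
    (phi w)
  have h5 := (h1.cexp.mul_const (beta w)).sub (h2.mul_const (Complex.I * phi w))
  have h6 := (h1.cexp.mul_const (shift w)).add (h2.mul_const ((starRingEnd ℂ) (shift w)))
  convert! HasDerivAt.ofShear h4 h5 h6 using 1
  simp
  ring_nf

theorem isKomrakov131_1_action131 : IsKomrakov131_1 action131.basis := by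
  refine ⟨?_, ?_, ?_, ?_, ?_, ?_, ?_, ?_, ?_, ?_⟩
  all_goals
    try rw [GroupLaw.SmoothAction.smul_basis]
    refine action131.lie_basis_eq ?_
    rw [lie_groupLaw131, lie_groupLaw131]
    ext i
    fin_cases i <;> simp [action131.basis_apply, ofShear, phi, beta, shift]
  all_goals first | rfl | exact Eq.trans (b := (0 : ℝ)) (by norm_num) rfl | norm_num

theorem proj_action131 (v : 𝔼[5]) :
    (action131.space.proj (show action131.space.lieAlg from v) : 𝔼[4]) =
      !₂[v 1, v 2, v 3, v 4] := by
  refine action131.proj_eq ?_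
  have h1 := hasDerivAt_logAlpha_smul v
  have h2 := hasDerivAt_beta_smul v
  have h3 := hasDerivAt_shift_smul v
  have h4 := h1.logAdd h2 (by simp)
  convert! HasDerivAt.ofLogV h4 (h3.mul h4.cexp.complex_conj) using 1
  · ext t : 1
    simp [action131, act131, logVAct]
  · rw [zero_smul, logAlpha_zero, beta_zero, logAdd_zero, shift_zero]
    ext i
    fin_cases i <;> simp [ofLogV, phi, beta, shift]
    all_goals ring

theorem isotropyAlg_action131 :
    action131.space.isotropyAlg = Submodule.span ℝ {action131.basis 0} := by
  refine action131.isotropyAlg_eq 0 proj_action131 fun v ↦ ?_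
  constructor
  · intro h j hj
    have h0 := congrArg (fun v : 𝔼[4] ↦ v 0) h
    have h1 := congrArg (fun v : 𝔼[4] ↦ v 1) h
    have h2 := congrArg (fun v : 𝔼[4] ↦ v 2) h
    have h3 := congrArg (fun v : 𝔼[4] ↦ v 3) h
    simp at h0 h1 h2 h3
    fin_cases j <;> simp_all
  · intro h
    ext i
    fin_cases i <;> simp [h]

/-! ### Metrics, curvature and soliton fields of type 1.3¹.1 -/

/-- The invariant metrics of type 1.3¹.1. -/
noncomputable def metricField131 (A B C : ℝ) (y : 𝔼[4]) : Matrix (Fin 4) (Fin 4) ℝ :=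
  !![A * y 3, 0, -A * y 1 + C / 2 * (Real.exp (-y 0) * y 3), A;
    0, 0, -A, 0;
    -A * y 1 + C / 2 * (Real.exp (-y 0) * y 3), -A,
      -A * y 3 + B * Real.exp (-y 0) ^ 2 - C * (Real.exp (-y 0) * y 1), C * Real.exp (-y 0);
    A, 0, C * Real.exp (-y 0), 0]

/-- The derivatives of the coefficients of the invariant metrics of type 1.3¹.1. -/
noncomputable def metricDeriv131 (A B C : ℝ) (y : 𝔼[4]) :
    Fin 4 → Matrix (Fin 4) (Fin 4) ℝ
  | 0 => !![0, 0, -(C / 2) * (Real.exp (-y 0) * y 3), 0; 0, 0, 0, 0;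
      -(C / 2) * (Real.exp (-y 0) * y 3), 0,
        -2 * B * Real.exp (-y 0) ^ 2 + C * (Real.exp (-y 0) * y 1), -C * Real.exp (-y 0);
      0, 0, -C * Real.exp (-y 0), 0]
  | 1 => !![0, 0, -A, 0; 0, 0, 0, 0; -A, 0, -C * Real.exp (-y 0), 0; 0, 0, 0, 0]
  | 2 => 0
  | 3 => !![A, 0, C / 2 * Real.exp (-y 0), 0; 0, 0, 0, 0; C / 2 * Real.exp (-y 0), 0, -A, 0; 0, 0, 0, 0]

/-- The Christoffel symbols of the invariant metrics of type 1.3¹.1, with `r = C / A` and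
`s = B / A`. -/
noncomputable def christoffel131 (r s : ℝ) (y : 𝔼[4]) : Fin 4 → Matrix (Fin 4) (Fin 4) ℝ
  | 0 => !![-1 / 2, 0, -(r / 4) * Real.exp (-y 0), 0; 0, 0, 0, 0;
      -(r / 4) * Real.exp (-y 0), 0, 1 / 2 + r ^ 2 / 2 * Real.exp (-y 0) ^ 2, 0; 0, 0, 0, 0]
  | 1 => !![1 / 2 * y 1 + 3 / 4 * r * (Real.exp (-y 0) * y 3), 1 / 2,
        1 / 2 * y 3 - r / 4 * (Real.exp (-y 0) * y 1) + s / 2 * Real.exp (-y 0) ^ 2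
          + 3 / 8 * r ^ 2 * (Real.exp (-y 0) ^ 2 * y 3), 3 / 4 * r * Real.exp (-y 0);
      1 / 2, 0, 0, 0;
      1 / 2 * y 3 - r / 4 * (Real.exp (-y 0) * y 1) + s / 2 * Real.exp (-y 0) ^ 2
          + 3 / 8 * r ^ 2 * (Real.exp (-y 0) ^ 2 * y 3), 0,
        -(1 / 2) * y 1 + r / 4 * (Real.exp (-y 0) * y 3) - r ^ 2 * (Real.exp (-y 0) ^ 2 * y 1)
          + r * s / 2 * Real.exp (-y 0) ^ 3, 1 / 2 + 3 / 4 * r ^ 2 * Real.exp (-y 0) ^ 2;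
      3 / 4 * r * Real.exp (-y 0), 0, 1 / 2 + 3 / 4 * r ^ 2 * Real.exp (-y 0) ^ 2, 0]
  | 2 => !![0, 0, -1 / 2, 0; 0, 0, 0, 0; -1 / 2, 0, -(r / 2) * Real.exp (-y 0), 0; 0, 0, 0, 0]
  | 3 => !![1 / 2 * y 3, 0, -(1 / 2) * y 1 + r / 2 * (Real.exp (-y 0) * y 3), 1 / 2; 0, 0, -1 / 2, 0;
      -(1 / 2) * y 1 + r / 2 * (Real.exp (-y 0) * y 3), -1 / 2,
        -(1 / 2) * y 3 - r * (Real.exp (-y 0) * y 1) + s * Real.exp (-y 0) ^ 2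
          - r ^ 2 / 4 * (Real.exp (-y 0) ^ 2 * y 3), 3 / 4 * r * Real.exp (-y 0);
      1 / 2, 0, 3 / 4 * r * Real.exp (-y 0), 0]

section Metric131

variable (A B C : ℝ)

theorem contDiff_metricField131 (i j : Fin 4) :
    ContDiff ℝ ∞ (fun y ↦ metricField131 A B C y i j) := by
  fin_cases i <;> fin_cases j <;> simp [metricField131] <;> fun_prop

theorem metricField131_symm (y : 𝔼[4]) (i j : Fin 4) :
    metricField131 A B C y i j = metricField131 A B C y j i := by
  fin_cases i <;> fin_cases j <;> simp [metricField131]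

theorem isUnit_metricField131 {A : ℝ} (hA : A ≠ 0) (y : 𝔼[4]) :
    IsUnit (metricField131 A B C y) := by
  rw [Matrix.isUnit_iff_isUnit_det, isUnit_iff_ne_zero]
  have : (metricField131 A B C y).det = A ^ 4 := by
    simp [metricField131, Matrix.det_succ_row_zero, Fin.sum_univ_succ, Fin.succAbove]
    ring
  rw [this]
  simp [hA]

theorem partialD_metricField131 (k i j : Fin 4) (y : 𝔼[4]) :
    partialD k (fun z ↦ metricField131 A B C z i j) y = metricDeriv131 A B C y k i j := by
  fin_cases i <;> fin_cases j <;> simp (disch := fun_prop) [metricField131, partialD_const, pow_two,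
    partialD_mul, partialD_exp, partialD_neg, partialD_coord, partialD_add, partialD_sub] <;>
    fin_cases k <;> simp [metricDeriv131] <;> ring

set_option maxHeartbeats 1000000 in
-- There are 64 equations to check.
theorem christoffel_metricField131 {A : ℝ} (hA : A ≠ 0) (k i j : Fin 4) :
    christoffel (metricField131 A B C) k i j = fun y ↦ christoffel131 (C / A) (B / A) y k i j := by
  funext y
  refine christoffel_eq (isUnit_metricField131 B C hA y)
    (c := fun k ↦ christoffel131 (C / A) (B / A) y k i j) (fun l ↦ ?_) k
  -- Expressing B and C as multiples of A removes the denominators from all the equations.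
  obtain ⟨r, rfl⟩ : ∃ r, C = r * A := ⟨C / A, (div_mul_cancel₀ C hA).symm⟩
  obtain ⟨s, rfl⟩ : ∃ s, B = s * A := ⟨B / A, (div_mul_cancel₀ B hA).symm⟩
  simp only [partialD_metricField131, Fin.sum_univ_four, mul_div_cancel_right₀ _ hA]
  fin_cases i <;> fin_cases j <;> fin_cases l <;>
    simp [metricField131, metricDeriv131, christoffel131] <;> ring

end Metric131

section Metric131

variable (A B C : ℝ)

theorem partialD_const_mul (i : Fin 4) (c : ℝ) {f : 𝔼[4] → ℝ} {y : 𝔼[4]}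
    (hf : DifferentiableAt ℝ f y) : partialD i (fun z ↦ c * f z) y = c * partialD i f y := by
  rw [partialD_mul i (by fun_prop) hf, partialD_const]
  ring

theorem partialD_exp_neg (i j : Fin 4) (y : 𝔼[4]) : partialD i (fun z ↦ Real.exp (-z j)) y =
    if j = i then -Real.exp (-y j) else 0 := by
  rw [partialD_exp i (by fun_prop), partialD_neg, partialD_coord]
  split_ifs <;> ring

theorem partialD_exp_neg_pow (i j : Fin 4) (n : ℕ) (y : 𝔼[4]) :
    partialD i (fun z ↦ Real.exp (-z j) ^ n) y =
      if j = i then -n * Real.exp (-y j) ^ n else 0 := by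
  simp only [← Real.exp_nat_mul]
  rw [partialD_exp i (by fun_prop), partialD_const_mul i _ (by fun_prop), partialD_neg,
    partialD_coord]
  split_ifs <;> ring

set_option maxHeartbeats 1000000 in
-- There are 16 components, each with 32 products and 8 derivatives.
theorem ricciCoord_metricField131 {A : ℝ} (hA : A ≠ 0) (i j : Fin 4) (y : 𝔼[4]) :
    ricciCoord (metricField131 A B C) i j y =
      if i = 2 ∧ j = 2 then -(15 / 8) * (C / A) ^ 2 * Real.exp (-y 0) ^ 2 else 0 := by
  simp only [ricciCoord, christoffel_metricField131 B C hA, Fin.sum_univ_four]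
  generalize C / A = r
  generalize B / A = s
  fin_cases i <;> fin_cases j <;> simp (disch := fun_prop) [christoffel131, partialD_const,
    partialD_const_mul, partialD_mul, partialD_exp_neg, partialD_exp_neg_pow, partialD_coord,
    partialD_neg, partialD_add, partialD_sub]
  all_goals ring

/-- The invariant vector field whose Lie derivative compensates the Ricci tensor. -/
noncomputable def solitonField131 (A C : ℝ) (y : 𝔼[4]) : 𝔼[4] :=
  !₂[0, -(15 * C / (8 * A ^ 2)) * Real.exp (-y 0), 0, 0]

theorem contDiff_solitonField131 : ContDiff ℝ ∞ (solitonField131 A C) := by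
  rw [contDiff_euclidean]
  intro i
  fin_cases i <;> simp [solitonField131] <;> fun_prop

/-- In the (0,2) entries the variation of the coefficient −A y₁ cancels the derivative of the field.
Only the y₁-dependence of the (2,2) entry survives, and it fixes the constant in the field. -/
theorem lieDerivCoord_metricField131 {A : ℝ} (hA : A ≠ 0) (i j : Fin 4) (y : 𝔼[4]) :
    lieDerivCoord (solitonField131 A C) (metricField131 A B C) i j y =
      if i = 2 ∧ j = 2 then 15 / 8 * (C / A) ^ 2 * Real.exp (-y 0) ^ 2 else 0 := by
  have h : ∀ k l : Fin 4, partialD k (fun z ↦ solitonField131 A C z l) y =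
      if k = 0 ∧ l = 1 then 15 * C / (8 * A ^ 2) * Real.exp (-y 0) else 0 := by
    intro k l
    fin_cases l <;> simp (disch := fun_prop) [solitonField131, partialD_const,
      partialD_mul, partialD_exp, partialD_neg, partialD_coord] <;> fin_cases k <;> simp
  simp only [lieDerivCoord, partialD_metricField131, Fin.sum_univ_four, h]
  fin_cases i <;> fin_cases j <;> simp [solitonField131, metricField131, metricDeriv131] <;>
    field_simp
  all_goals ring

/-- The invariant pseudo-Riemannian metrics of type 1.3¹.1. -/
noncomputable def pseudoMetric131 {A : ℝ} (hA : A ≠ 0) : PseudoRiemannianMetric 4 𝔼[4] :=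
  PseudoRiemannianMetric.ofMatrix (metricField131 A B C) (contDiff_metricField131 A B C)
    (metricField131_symm A B C) (isUnit_metricField131 B C hA)

theorem not_isEinstein_pseudoMetric131 {A C : ℝ} (hA : A ≠ 0) (hC : C ≠ 0) :
    ¬ (pseudoMetric131 B C hA).IsEinstein := by
  intro h
  obtain ⟨r, hr⟩ := IsEinstein.ricciCoord_eq h
  -- The entry (0,3) of the metric is A ≠ 0 with vanishing Ricci entry, so the Einstein constant
  -- would be 0.
  have h1 := hr 0 0 3
  have h2 := hr 0 2 2
  rw [ricciCoord_metricField131 B C hA] at h1 h2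
  simp [metricField131, hA] at h1 h2
  simp [h1, hC, hA] at h2

end Metric131

/-! ### Invariance of the metrics of type 1.3¹.1 -/

/-- The area form of the plane. -/
noncomputable def area (a b : ℂ) : ℝ := ((starRingEnd ℂ) a * b).im

theorem area_eq (a b : ℂ) : area a b = a.re * b.im - a.im * b.re := by
  simp [area]
  ring

/-- The map u ↦ αu + βū has determinant |α|² − |β|² = 1. -/
theorem area_shear (x : 𝔼[5]) (a b : ℂ) :
    area (Complex.exp (logAlpha x) * a + beta x * (starRingEnd ℂ) a)
      (Complex.exp (logAlpha x) * b + beta x * (starRingEnd ℂ) b) = area a b := by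
  have h := congrArg Complex.re (exp_mul_conj x)
  simp at h
  simp only [area_eq, Complex.add_re, Complex.add_im, Complex.mul_re, Complex.mul_im,
    Complex.conj_re, Complex.conj_im]
  linear_combination (a.re * b.im - a.im * b.re) * h

theorem logV_add_smul (y v : 𝔼[4]) (t : ℝ) : logV (y + t • v) = logV y + t * logV v := by
  apply Complex.ext <;> simp [logV] <;> ring

theorem twist_add_smul (y v : 𝔼[4]) (t : ℝ) : twist (y + t • v) = twist y + t * twist v := by
  apply Complex.ext <;> simp [twist]

theorem hasDerivAt_add_ofReal_mul (a b : ℂ) : HasDerivAt (fun t : ℝ ↦ a + t * b) b 0 := by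
  simpa using ((Complex.ofRealCLM.hasDerivAt (x := 0)).mul_const b).const_add a

theorem fderiv_vecV (y v : 𝔼[4]) : fderiv ℝ vecV y v = vecV y * logV v := by
  refine fderiv_apply_of_hasDerivAt (contDiff_vecV.differentiable (by simp) y) ?_
  simp only [vecV, logV_add_smul]
  simpa using (hasDerivAt_add_ofReal_mul (logV y) (logV v)).cexp

theorem fderiv_ptX (y v : 𝔼[4]) : fderiv ℝ ptX y v =
    (twist v - twist y * (starRingEnd ℂ) (logV v)) * (starRingEnd ℂ) (Complex.exp (-logV y)) := by
  refine fderiv_apply_of_hasDerivAt (contDiff_ptX.differentiable (by simp) y) ?_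
  simp only [ptX, logV_add_smul, twist_add_smul]
  convert! (hasDerivAt_add_ofReal_mul (twist y) (twist v)).mul
    (hasDerivAt_add_ofReal_mul (logV y) (logV v)).neg.cexp.complex_conj using 1
  simp
  ring

theorem conj_exp_neg_logV (y : 𝔼[4]) :
    (starRingEnd ℂ) (Complex.exp (-logV y)) = ((starRingEnd ℂ) (vecV y))⁻¹ := by
  rw [Complex.exp_neg, map_inv₀]
  rfl

theorem vecV_mul_conj (y : 𝔼[4]) :
    vecV y * (starRingEnd ℂ) (vecV y) = Real.exp (-y 0) := by
  rw [vecV, ← Complex.exp_conj, ← Complex.exp_add, Complex.add_conj, Complex.ofReal_exp]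
  congr 2
  simp [logV]
  ring

/-- The pair (v, x) has injective differential because v never vanishes. Tangent vectors can
therefore be compared through their effect on v and x. -/
theorem eq_zero_of_fderiv_eq_zero {y v : 𝔼[4]} (h1 : fderiv ℝ vecV y v = 0)
    (h2 : fderiv ℝ ptX y v = 0) : v = 0 := by
  have h3 : logV v = 0 := by
    simpa [fderiv_vecV, vecV_ne_zero] using h1
  have h4 : twist v = 0 := by
    simpa [fderiv_ptX, h3, conj_exp_neg_logV, vecV_ne_zero] using h2
  exact ext_logV (by simpa using h3) (by simpa using h4)

theorem area_fderiv_vecV (y v : 𝔼[4]) :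
    area (vecV y) (fderiv ℝ vecV y v) = -(1 / 2) * Real.exp (-y 0) * v 2 := by
  have h : (starRingEnd ℂ) (vecV y) * (vecV y * logV v) = Real.exp (-y 0) * logV v := by
    rw [← vecV_mul_conj]
    ring
  rw [fderiv_vecV, area, h, Complex.im_ofReal_mul]
  simp only [logV]
  ring

theorem area_fderiv_ptX (y v : 𝔼[4]) :
    area (vecV y) (fderiv ℝ ptX y v) = v 3 + (y 3 * v 0 - y 1 * v 2) / 2 := by
  have h : (starRingEnd ℂ) (vecV y) * ((twist v - twist y * (starRingEnd ℂ) (logV v)) *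
      ((starRingEnd ℂ) (vecV y))⁻¹) = twist v - twist y * (starRingEnd ℂ) (logV v) := by
    have : (starRingEnd ℂ) (vecV y) ≠ 0 := by simpa using vecV_ne_zero y
    field_simp
  rw [fderiv_ptX, conj_exp_neg_logV, area, h]
  simp [twist, logV]
  ring

theorem area_fderiv_fderiv (y v w : 𝔼[4]) : area (fderiv ℝ vecV y v) (fderiv ℝ ptX y w) =
    ((starRingEnd ℂ) (logV v) * (twist w - twist y * (starRingEnd ℂ) (logV w))).im := by
  have : (starRingEnd ℂ) (vecV y) ≠ 0 := by simpa using vecV_ne_zero y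
  rw [fderiv_ptX, fderiv_vecV, conj_exp_neg_logV, area, map_mul]
  congr 1
  field_simp

/-- Both v and the differentials dv, dx transform by the same area-preserving linear map, so this
form of the metric makes invariance immediate. It is also the form in which the frame argument reads
off inner products. -/
theorem matrixForm_metricField131 (A B C : ℝ) (y v w : 𝔼[4]) :
    matrixForm (metricField131 A B C y) v w =
      -2 * A * (area (fderiv ℝ vecV y v) (fderiv ℝ ptX y w)
        + area (fderiv ℝ vecV y w) (fderiv ℝ ptX y v))
      + 4 * B * (area (vecV y) (fderiv ℝ vecV y v) * area (vecV y) (fderiv ℝ vecV y w))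
      - 2 * C * (area (vecV y) (fderiv ℝ vecV y v) * area (vecV y) (fderiv ℝ ptX y w)
        + area (vecV y) (fderiv ℝ vecV y w) * area (vecV y) (fderiv ℝ ptX y v)) := by
  rw [matrixForm_apply]
  simp only [area_fderiv_vecV, area_fderiv_ptX, area_fderiv_fderiv, Fin.sum_univ_four]
  simp [metricField131, logV, twist]
  ring

theorem fderiv_vecV_act131 (x : 𝔼[5]) (y v : 𝔼[4]) :
    fderiv ℝ vecV (act131 x y) (fderiv ℝ (act131 x) y v) =
      Complex.exp (logAlpha x) * fderiv ℝ vecV y v +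
        beta x * (starRingEnd ℂ) (fderiv ℝ vecV y v) := by
  have h1 := fderiv_comp y (contDiff_vecV.differentiable (by simp) (act131 x y))
    ((action131.contDiff_act_right x).differentiable (by simp) y)
  have h2 : vecV ∘ action131.act x = fun y ↦
      Complex.exp (logAlpha x) * vecV y + beta x * (starRingEnd ℂ) (vecV y) :=
    funext fun y ↦ vecV_act131 x y
  have h3 : HasFDerivAt vecV (fderiv ℝ vecV y) y :=
    (contDiff_vecV.differentiable (by simp) y).hasFDerivAt
  have h4 := (h3.const_mul (Complex.exp (logAlpha x))).add
    ((Complex.conjCLE.hasFDerivAt.comp y h3).const_mul (beta x))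
  have h5 := congrArg (fun T : 𝔼[4] →L[ℝ] ℂ ↦ T v) (h1.symm.trans
    ((congrArg (fun f ↦ fderiv ℝ f y) h2).trans h4.fderiv))
  simpa using h5

theorem fderiv_ptX_act131 (x : 𝔼[5]) (y v : 𝔼[4]) :
    fderiv ℝ ptX (act131 x y) (fderiv ℝ (act131 x) y v) =
      Complex.exp (logAlpha x) * fderiv ℝ ptX y v +
        beta x * (starRingEnd ℂ) (fderiv ℝ ptX y v) := by
  have h1 := fderiv_comp y (contDiff_ptX.differentiable (by simp) (act131 x y))
    ((action131.contDiff_act_right x).differentiable (by simp) y)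
  have h2 : ptX ∘ action131.act x = fun y ↦
      Complex.exp (logAlpha x) * ptX y + beta x * (starRingEnd ℂ) (ptX y) + shift x :=
    funext fun y ↦ ptX_act131 x y
  have h3 : HasFDerivAt ptX (fderiv ℝ ptX y) y :=
    (contDiff_ptX.differentiable (by simp) y).hasFDerivAt
  have h4 := ((h3.const_mul (Complex.exp (logAlpha x))).add
    ((Complex.conjCLE.hasFDerivAt.comp y h3).const_mul (beta x))).add_const (shift x)
  have h5 := congrArg (fun T : 𝔼[4] →L[ℝ] ℂ ↦ T v) (h1.symm.trans
    ((congrArg (fun f ↦ fderiv ℝ f y) h2).trans h4.fderiv))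
  simpa using h5

section Metric131

variable (B C : ℝ)

theorem isInvariant_pseudoMetric131 {A : ℝ} (hA : A ≠ 0) :
    (pseudoMetric131 B C hA).IsInvariant action131.space.G := by
  rw [GroupLaw.SmoothAction.isInvariant_iff]
  intro x y v w
  change matrixForm (metricField131 A B C (act131 x y)) (fderiv ℝ (act131 x) y v)
    (fderiv ℝ (act131 x) y w) = matrixForm (metricField131 A B C y) v w
  simp only [matrixForm_metricField131, fderiv_vecV_act131, fderiv_ptX_act131, vecV_act131,
    area_shear]

theorem isInvariantMetricWith_pseudoMetric131 {A : ℝ} (hA : A ≠ 0) :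
    IsInvariantMetricWith action131.space action131.basis (metric131 A B C 0)
      (pseudoMetric131 B C hA) :=
  action131.isInvariantMetricWith_ofMatrix proj_action131 _ _ _
    (isInvariant_pseudoMetric131 B C hA) fun i j ↦ by
      fin_cases i <;> fin_cases j <;> simp [metricField131, metric131]

theorem fderiv_vecV_solitonField131 (A : ℝ) (y : 𝔼[4]) :
    fderiv ℝ vecV y (solitonField131 A C y) = 0 := by
  rw [fderiv_vecV]
  simp [logV, solitonField131, Complex.ext_iff]

/-- The soliton field leaves v fixed and moves x by a constant multiple of v, a description that
makes its invariance evident. -/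
theorem fderiv_ptX_solitonField131 (A : ℝ) (y : 𝔼[4]) :
    fderiv ℝ ptX y (solitonField131 A C y) = (-(15 * C / (8 * A ^ 2)) : ℝ) * vecV y := by
  have h1 : logV (solitonField131 A C y) = 0 := by simp [logV, solitonField131, Complex.ext_iff]
  have h2 : twist (solitonField131 A C y) = (-(15 * C / (8 * A ^ 2)) : ℝ) * Real.exp (-y 0) := by
    rw [← Complex.ofReal_mul]
    apply Complex.ext
    · rw [Complex.ofReal_re]
      simp [twist, solitonField131]
    · rw [Complex.ofReal_im]
      simp [twist, solitonField131]
  have : (starRingEnd ℂ) (vecV y) ≠ 0 := by simpa using vecV_ne_zero y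
  rw [fderiv_ptX, h1, h2, conj_exp_neg_logV, ← vecV_mul_conj]
  field_simp
  simp

theorem isInvariantRicciSoliton_pseudoMetric131 {A : ℝ} (hA : A ≠ 0) :
    IsInvariantRicciSoliton action131.space (pseudoMetric131 B C hA) 0 := by
  refine ⟨isInvariant_pseudoMetric131 B C hA, solitonField131 A C, ?_, ?_⟩
  · rw [GroupLaw.SmoothAction.isInvariantField_iff]
    intro x y
    change fderiv ℝ (act131 x) y (solitonField131 A C y) = solitonField131 A C (act131 x y)
    refine sub_eq_zero.1 (eq_zero_of_fderiv_eq_zero (y := act131 x y) ?_ ?_)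
    · rw [map_sub, fderiv_vecV_act131, fderiv_vecV_solitonField131, fderiv_vecV_solitonField131]
      simp
    · rw [map_sub, fderiv_ptX_act131, fderiv_ptX_solitonField131, fderiv_ptX_solitonField131,
        vecV_act131, map_mul, Complex.conj_ofReal]
      ring
  · refine isRicciSoliton_ofMatrix (contDiff_solitonField131 A C) fun y i j ↦ ?_
    rw [lieDerivCoord_metricField131 B C hA, ricciCoord_metricField131 B C hA]
    split_ifs <;> ring

end Metric131

/-! ### Differentiation of complex functions along an invariant frame -/

namespace InvariantFrame

variable {n : ℕ} {B : 𝔼[n] → 𝔼[n] →L[ℝ] 𝔼[n] →L[ℝ] ℝ} (F : InvariantFrame B)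

/-- The derivative of a complex function along a field of an invariant frame. -/
noncomputable def der (ξ : 𝔼[n]) (g : 𝔼[n] → ℂ) (y : 𝔼[n]) : ℂ := fderiv ℝ g y (F.X ξ y)

theorem contDiff_der {g : 𝔼[n] → ℂ} (hg : ContDiff ℝ ∞ g) (ξ : 𝔼[n]) :
    ContDiff ℝ 2 (F.der ξ g) := by
  have h : ContDiff ℝ 2 (fderiv ℝ g) := hg.fderiv_right (by norm_cast)
  exact h.clm_apply (F.contDiff ξ)

/-- Second derivatives of the function cancel by symmetry, leaving only the bracket of the fields.
-/
theorem der_bracket {g : 𝔼[n] → ℂ} (hg : ContDiff ℝ 2 g) (ξ ζ y : 𝔼[n]) :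
    F.der (F.bracket ξ ζ) g y = F.der ξ (F.der ζ g) y - F.der ζ (F.der ξ g) y := by
  have hsymm : IsSymmSndFDerivAt ℝ g y :=
    hg.contDiffAt.isSymmSndFDerivAt (by rw [minSmoothness_of_isRCLikeNormedField])
  have h1 : HasFDerivAt (fderiv ℝ g) (fderiv ℝ (fderiv ℝ g) y) y :=
    ((hg.fderiv_right (m := 1) (by norm_num)).differentiable (by simp) y).hasFDerivAt
  have h2 : ∀ ξ ζ, F.der ξ (F.der ζ g) y = fderiv ℝ (fderiv ℝ g) y (F.X ξ y) (F.X ζ y) +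
      fderiv ℝ g y (fderiv ℝ (F.X ζ) y (F.X ξ y)) := by
    intro ξ ζ
    have h := (h1.clm_apply (F.differentiable ζ y).hasFDerivAt).fderiv
    refine (congrArg (fun T : 𝔼[n] →L[ℝ] ℂ ↦ T (F.X ξ y)) h).trans ?_
    simp [add_comm]
  rw [h2, h2, hsymm.eq (F.X ζ y), der, ← F.bracket_eq, map_sub]
  ring

theorem der_add (ξ : 𝔼[n]) {g h : 𝔼[n] → ℂ} {y : 𝔼[n]} (hg : DifferentiableAt ℝ g y)
    (hh : DifferentiableAt ℝ h y) :
    F.der ξ (fun z ↦ g z + h z) y = F.der ξ g y + F.der ξ h y := by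
  simp [der, fderiv_fun_add hg hh]

theorem der_mul (ξ : 𝔼[n]) {g h : 𝔼[n] → ℂ} {y : 𝔼[n]} (hg : DifferentiableAt ℝ g y)
    (hh : DifferentiableAt ℝ h y) :
    F.der ξ (fun z ↦ g z * h z) y = F.der ξ g y * h y + g y * F.der ξ h y := by
  simp [der, fderiv_fun_mul hg hh]
  ring

theorem der_const (ξ : 𝔼[n]) (c : ℂ) (y : 𝔼[n]) : F.der ξ (fun _ ↦ c) y = 0 := by
  simp [der]

theorem der_const_mul (ξ : 𝔼[n]) (c : ℂ) {g : 𝔼[n] → ℂ} {y : 𝔼[n]} (hg : DifferentiableAt ℝ g y) :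
    F.der ξ (fun z ↦ c * g z) y = c * F.der ξ g y := by
  rw [F.der_mul ξ (by fun_prop) hg, der_const]
  ring

theorem area_der_add_area_der (ξ : 𝔼[n]) {g h : 𝔼[n] → ℂ} {c : ℝ} (hg : Differentiable ℝ g)
    (hh : Differentiable ℝ h) (hc : ∀ y, area (g y) (h y) = c) (y : 𝔼[n]) :
    area (F.der ξ g y) (h y) + area (g y) (F.der ξ h y) = 0 := by
  have h1 := (Complex.imCLM.hasFDerivAt.comp y
    ((Complex.conjCLE.hasFDerivAt.comp y (hg y).hasFDerivAt).mul (hh y).hasFDerivAt)).fderiv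
  have h2 : (fun y ↦ ((starRingEnd ℂ) (g y) * h y).im) = fun _ ↦ c := funext hc
  have h3 := congrArg (fun T : 𝔼[n] →L[ℝ] ℝ ↦ T (F.X ξ y))
    (((congrArg (fun f ↦ fderiv ℝ f y) h2).symm.trans h1))
  simp at h3
  rw [area_eq, area_eq, der, der]
  linarith

theorem X_injective (y : 𝔼[n]) {ξ ζ : 𝔼[n]} (h : F.X ξ y = F.X ζ y) : ξ = ζ :=
  (F.bijective y).1 h

end InvariantFrame

/-! ### Algebra of the area form -/

theorem area_self (a : ℂ) : area a a = 0 := by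
  rw [area_eq]
  ring

theorem area_swap (a b : ℂ) : area b a = -area a b := by
  rw [area_eq, area_eq]
  ring

theorem area_add_right (a b c : ℂ) : area a (b + c) = area a b + area a c := by
  simp [area_eq]
  ring

theorem area_sub_right (a b c : ℂ) : area a (b - c) = area a b - area a c := by
  simp [area_eq]
  ring

theorem area_ofReal_mul_right (a b : ℂ) (r : ℝ) : area a (r * b) = r * area a b := by
  simp [area_eq]
  ring

theorem area_zero_left (a : ℂ) : area 0 a = 0 := by simp [area]

theorem area_zero_right (a : ℂ) : area a 0 = 0 := by simp [area]

/-- Cramer's rule in a basis of unit area. -/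
theorem eq_of_area_eq_one {v w : ℂ} (h : area v w = 1) (z : ℂ) :
    z = area z w * v + area v z * w := by
  rw [area_eq] at h
  apply Complex.ext
  · simp [area_eq]
    linear_combination -z.re * h
  · simp [area_eq]
    linear_combination -z.im * h

/-! ### The Riccati obstruction -/

section Riccati

/-- There is no complementary field on `M` with this derivative, because it would solve a Riccati
equation on the whole real line. -/
theorem false_of_fderiv_eq {w : 𝔼[4] → ℂ} (hw : Differentiable ℝ w)
    (h0 : ∀ y, area (vecV y) (w y) = 1) (e : ℝ)
    (h : ∀ y u, fderiv ℝ w y u = area (fderiv ℝ vecV y u) (w y) * (e * vecV y - w y) +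
      area (vecV y) (fderiv ℝ vecV y u) * ((e ^ 2 / 4 : ℝ) * vecV y)) : False := by
  -- Along this line v = e^{−it/2}, so |v| = 1 throughout.
  let γ : ℝ → 𝔼[4] := fun t ↦ 0 + t • EuclideanSpace.single 2 1
  have hγ : ∀ t, HasDerivAt γ (EuclideanSpace.single 2 1) t := fun t ↦ by
    simpa [γ] using ((hasDerivAt_id t).smul_const (EuclideanSpace.single (2 : Fin 4) (1 : ℝ)))
  set v : ℝ → ℂ := fun t ↦ vecV (γ t) with hv
  have hdv : ∀ t, fderiv ℝ vecV (γ t) (EuclideanSpace.single 2 1) = ⟨0, -(1 / 2)⟩ * v t := by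
    intro t
    rw [fderiv_vecV, mul_comm]
    congr 1
    apply Complex.ext <;> simp [logV]
    norm_num
  have hn : ∀ t, v t * (starRingEnd ℂ) (v t) = 1 := by
    intro t
    simp only [hv]
    rw [vecV_mul_conj]
    simp [γ]
  have hn' : ∀ t, (v t).re ^ 2 + (v t).im ^ 2 = 1 := by
    intro t
    have := congrArg Complex.re (hn t)
    simp at this
    linarith
  have h1 : ∀ t, HasDerivAt v (⟨0, -(1 / 2)⟩ * v t) t := by
    intro t
    rw [← hdv]
    exact (contDiff_vecV.differentiable (by simp) (γ t)).hasFDerivAt.comp_hasDerivAt t (hγ t)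
  set z : ℝ → ℂ := fun t ↦ w (γ t) with hz
  have h2 : ∀ t, HasDerivAt z (area (⟨0, -(1 / 2)⟩ * v t) (z t) * (e * v t - z t) +
      area (v t) (⟨0, -(1 / 2)⟩ * v t) * ((e ^ 2 / 4 : ℝ) * v t)) t := by
    intro t
    have := h (γ t) (EuclideanSpace.single 2 1)
    rw [hdv] at this
    rw [← this]
    exact (hw (γ t)).hasFDerivAt.comp_hasDerivAt t (hγ t)
  -- Since |v| = 1 and area(v, w) = 1, one has w = (s + i)v along the curve. The unknown w is thus
  -- reduced to the real function s.
  set s : ℝ → ℝ := fun t ↦ ((starRingEnd ℂ) (v t) * z t).re with hs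
  have h3 : ∀ t, HasDerivAt s (-(1 / 2) * (1 + (s t - e / 2) ^ 2)) t := by
    intro t
    have h8 := h2 t
    generalize hk : e ^ 2 / 4 = k at h8
    convert! ((h1 t).complex_conj.mul h8).complex_re using 1
    have h4 := hn' t
    have h7 := h0 (γ t)
    rw [area_eq] at h7
    change (v t).re * (z t).im - (v t).im * (z t).re = 1 at h7
    simp [area_eq, hs]
    linear_combination (1 / 2) * h7 + (-(1 / 2) * e * ((v t).re * (z t).re + (v t).im * (z t).im) +
      e ^ 2 / 8 * ((v t).re ^ 2 + (v t).im ^ 2 + 1)) * h4 -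
      (1 / 2) * ((v t).re ^ 2 + (v t).im ^ 2) ^ 2 * hk
  have h5 : ∀ t, HasDerivAt (fun t ↦ Real.arctan (s t - e / 2) + t / 2) 0 t := by
    intro t
    have h6 : 1 + (s t - e / 2) ^ 2 ≠ 0 := by positivity
    convert! (((h3 t).sub_const (e / 2)).arctan).add ((hasDerivAt_id t).div_const 2) using 1
    field_simp
    ring
  -- Over an interval of length 2π the arctangent would have to drop by π, but it takes values in an
  -- open interval of that length.
  have h6 := is_const_of_deriv_eq_zero (fun t ↦ (h5 t).differentiableAt) (fun t ↦ (h5 t).deriv)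
    0 (2 * Real.pi)
  have h7 := Real.arctan_lt_pi_div_two (s 0 - e / 2)
  have h8 := Real.neg_pi_div_two_lt_arctan (s (2 * Real.pi) - e / 2)
  linarith

end Riccati

/-! ### Bracket relations determining the differential of w -/

namespace InvariantFrame

variable {B : 𝔼[4] → 𝔼[4] →L[ℝ] 𝔼[4] →L[ℝ] ℝ} (F : InvariantFrame B)

theorem der_ofReal_mul (ξ : 𝔼[4]) {m : 𝔼[4] → ℝ} {g : 𝔼[4] → ℂ} {y : 𝔼[4]}
    (hm : DifferentiableAt ℝ m y) (hg : DifferentiableAt ℝ g y) :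
    F.der ξ (fun z ↦ m z * g z) y = (fderiv ℝ m y (F.X ξ y) : ℝ) * g y + m y * F.der ξ g y := by
  have h : HasFDerivAt (fun z ↦ (m z : ℂ)) (Complex.ofRealCLM.comp (fderiv ℝ m y)) y :=
    Complex.ofRealCLM.hasFDerivAt.comp y hm.hasFDerivAt
  rw [F.der_mul ξ h.differentiableAt hg, der, h.fderiv]
  rfl

/-- An invariant frame for a metric of type 1.3¹.1 determines the derivative of the complement of
`v` in it. -/
theorem exists_fderiv_eq {e p f q : 𝔼[4]} {w : 𝔼[4] → ℂ} {m : 𝔼[4] → ℝ} (r : ℝ)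
    (hw : ContDiff ℝ 2 w) (hm : Differentiable ℝ m)
    (hVe : F.der e vecV = vecV) (hVp : F.der p vecV = w) (hVf : F.der f vecV = fun _ ↦ 0)
    (hVq : F.der q vecV = fun _ ↦ 0) (hWe : F.der e ptX = fun y ↦ m y * vecV y)
    (hWp : F.der p ptX = fun y ↦ r * (m y * vecV y) + m y * w y) (hWf : F.der f ptX = vecV)
    (hWq : F.der q ptX = w) (hvw : ∀ y, area (vecV y) (w y) = 1) (hw0 : w 0 = Complex.I)
    (hdec : ∀ g ξ y, F.der ξ g y =
      (F.der ξ vecV 0).re * F.der e g y + (F.der ξ vecV 0).im * F.der p g y +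
      (F.der ξ ptX 0).re * F.der f g y + (F.der ξ ptX 0).im * F.der q g y) :
    ∃ a : ℝ, ∀ y u, fderiv ℝ w y u = area (fderiv ℝ vecV y u) (w y) * (a * vecV y - w y) +
      area (vecV y) (fderiv ℝ vecV y u) * ((a ^ 2 / 4 : ℝ) * vecV y) := by
  have hv : ContDiff ℝ 2 vecV := contDiff_vecV.of_le (by norm_cast)
  have hx : ContDiff ℝ 2 ptX := contDiff_ptX.of_le (by norm_cast)
  have hvd : Differentiable ℝ vecV := hv.differentiable (by simp)
  have hwd : Differentiable ℝ w := hw.differentiable (by simp)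
  -- Differentiates area(v, w) = 1.
  have hda : ∀ ξ y, area (vecV y) (F.der ξ w y) = -area (F.der ξ vecV y) (w y) := fun ξ y ↦ by
    linarith [F.area_der_add_area_der ξ hvd hwd hvw y]
  -- On v the bracket [ξ, p] acts as ξw − p(ξv). By `hdec` its action is also a combination of v and
  -- w with constant coefficients.
  have hbr : ∀ ξ, ∃ a b : ℝ, ∀ y, F.der ξ w y = a * vecV y + b * w y + F.der p (F.der ξ vecV) y := by
    intro ξ
    refine ⟨(F.der (F.bracket ξ p) vecV 0).re, (F.der (F.bracket ξ p) vecV 0).im, fun y ↦ ?_⟩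
    have h1 := F.der_bracket hv ξ p y
    rw [hdec, hVe, hVp, hVf, hVq] at h1
    linear_combination -h1
  -- the derivatives of `w` along `e`, `f`, `q` have constant coefficients
  obtain ⟨φ, hφ⟩ : ∃ a : ℝ, F.der f w = fun y ↦ a * vecV y := by
    obtain ⟨a, b, hab⟩ := hbr f
    refine ⟨a, funext fun y ↦ ?_⟩
    have h1 := hda f y
    rw [hab, hVf, der_const, add_zero, area_zero_left, neg_zero, area_add_right,
      area_ofReal_mul_right, area_ofReal_mul_right, area_self, hvw] at h1
    have h2 : b = 0 := by linarith
    rw [hab, hVf, der_const, h2]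
    simp
  obtain ⟨k, hk⟩ : ∃ a : ℝ, F.der q w = fun y ↦ a * vecV y := by
    obtain ⟨a, b, hab⟩ := hbr q
    refine ⟨a, funext fun y ↦ ?_⟩
    have h1 := hda q y
    rw [hab, hVq, der_const, add_zero, area_zero_left, neg_zero, area_add_right,
      area_ofReal_mul_right, area_ofReal_mul_right, area_self, hvw] at h1
    have h2 : b = 0 := by linarith
    rw [hab, hVq, der_const, h2]
    simp
  obtain ⟨a, ha⟩ : ∃ a : ℝ, F.der e w = fun y ↦ a * vecV y + (-1 : ℂ) * w y := by
    obtain ⟨a, b, hab⟩ := hbr e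
    refine ⟨a, funext fun y ↦ ?_⟩
    have h1 := hda e y
    rw [hab, hVe, hVp, area_add_right, area_add_right, area_ofReal_mul_right,
      area_ofReal_mul_right, area_self, hvw] at h1
    have h2 : b = -2 := by linarith
    rw [hab, hVe, hVp, h2]
    push_cast
    ring
  have hcv : ∀ ξ (c : ℝ) y, F.der ξ (fun z ↦ c * vecV z) y = c * F.der ξ vecV y := fun ξ c y ↦
    F.der_const_mul ξ c (hvd y)
  have hcw : ∀ ξ y, F.der ξ (fun y ↦ a * vecV y + (-1 : ℂ) * w y) y =
      a * F.der ξ vecV y - F.der ξ w y := fun ξ y ↦ by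
    rw [F.der_add ξ ((hvd y).const_mul _) ((hwd y).const_mul _), hcv, F.der_const_mul ξ _ (hwd y)]
    ring
  -- integrability along `f` and `q`
  have hφ0 : φ = 0 := by
    have h1 := F.der_bracket hv f q 0
    have h2 := F.der_bracket hx f q 0
    have h3 := F.der_bracket hw f q 0
    rw [hVq, hVf, der_const, der_const, sub_zero] at h1
    rw [hWq, hWf, hφ, hVq] at h2
    simp only [sub_zero, vecV_zero, mul_one] at h2
    -- Here [f, q] = φf, and applying it to w gives φ² = 0.
    rw [hdec, h1, h2, hk, hφ, hcv, hcv, hVf, hVq] at h3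
    simpa using h3
  -- integrability along `e` and `q`
  have hk0 : k = 0 := by
    have h1 := F.der_bracket hv e q 0
    have h2 := F.der_bracket hx e q 0
    have h3 := F.der_bracket hw e q 0
    rw [hVq, hVe, der_const, hVq, sub_zero] at h1
    rw [hWq, hWe, ha, F.der_ofReal_mul q (hm 0) (hvd 0), hVq] at h2
    simp only [vecV_zero, hw0] at h2
    -- Here [e, q] = (a − c)f − q, with c the derivative of m along q at the origin. Since f
    -- annihilates w, applying the bracket to w gives −k = 2k.
    rw [hdec, h1, hk, ha, hcv, hcw, hφ, hφ0, hVe, hVq, hk, h2] at h3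
    simp at h3
    have h4 : (3 * k : ℂ) = 0 := by linear_combination -h3
    simpa using h4
  -- the derivative of `w` along `p` has a constant coefficient
  obtain ⟨h, hh⟩ : ∃ h : ℝ, F.der p w = fun y ↦ h * vecV y := by
    have hp : ∀ y, F.der p w y = area (F.der p w y) (w y) * vecV y := by
      intro y
      have h1 := eq_of_area_eq_one (hvw y) (F.der p w y)
      rw [hda, hVp, area_self] at h1
      simpa using h1
    -- With d the derivative of m along q, the bracket [p, q] takes x to (h − rd)v − dw, whose two
    -- coefficients are constants. Eliminating d gives h.
    refine ⟨(F.der (F.bracket p q) ptX 0).re - r * (F.der (F.bracket p q) ptX 0).im,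
      funext fun y ↦ ?_⟩
    have h1 := F.der_bracket hv p q 0
    have h2 := F.der_bracket hx p q y
    rw [hVq, hVp, der_const, hk, hk0] at h1
    have h3 : Differentiable ℝ fun y ↦ (m y : ℂ) := Complex.ofRealCLM.differentiable.comp hm
    have h4 : DifferentiableAt ℝ (fun z ↦ (m z : ℂ) * vecV z) y := (h3 y).mul (hvd y)
    have h9 : DifferentiableAt ℝ (fun z ↦ (m z : ℂ) * w z) y := (h3 y).mul (hwd y)
    rw [hdec, h1, hWq, hWf, hWp, F.der_add q (h4.const_mul _) h9, F.der_const_mul q _ h4,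
      F.der_ofReal_mul q (hm y) (hvd y), F.der_ofReal_mul q (hm y) (hwd y), hVq, hk, hk0, hp] at h2
    set x := (F.der (F.bracket p q) ptX 0).re
    set z := (F.der (F.bracket p q) ptX 0).im
    set d := fderiv ℝ m y (F.X q y)
    have h5 : (x : ℂ) * vecV y + z * w y = (area (F.der p w y) (w y) : ℝ) * vecV y -
        ((r * d : ℝ) * vecV y + d * w y) := by
      simp at h2
      rw [h2]
      push_cast
      ring
    have h6 := congrArg (area (vecV y)) h5
    have h7 := congrArg (area (w y)) h5
    simp only [area_add_right, area_sub_right, area_ofReal_mul_right, area_self, hvw,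
      area_swap (vecV y)] at h6 h7
    have h8 : area (F.der p w y) (w y) = x - r * z := by
      have : z = -d := by linarith
      rw [this]
      linarith
    rw [hp, h8]
  -- integrability along `e` and `p`
  have hh4 : h = a ^ 2 / 4 := by
    have h1 := F.der_bracket hv e p 0
    have h3 := F.der_bracket hw e p 0
    rw [hVp, hVe, ha, hVp] at h1
    simp only [vecV_zero, hw0] at h1
    -- Up to fields annihilating w, [e, p] = ae − 2p. Comparing coefficients of v gives a² − 2h =
    -- 2h.
    rw [hdec, h1, hh, hcv, ha, hcw, hh, hφ, hk, hφ0, hk0, hVe, hVp] at h3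
    simp only [vecV_zero, hw0] at h3
    have h4 := congrArg Complex.re h3
    simp at h4
    linarith
  refine ⟨a, fun y u ↦ ?_⟩
  obtain ⟨ξ, rfl⟩ := (F.bijective y).2 u
  have h1 := hdec vecV ξ y
  have h2 := hdec w ξ y
  rw [hVe, hVp, hVf, hVq] at h1
  rw [ha, hh, hφ, hk, hφ0, hk0, hh4] at h2
  change F.der ξ w y = area (F.der ξ vecV y) (w y) * (a * vecV y - w y) +
      area (vecV y) (F.der ξ vecV y) * ((a ^ 2 / 4 : ℝ) * vecV y)
  have h3 : area (vecV y) (F.der ξ vecV y) = (F.der ξ vecV 0).im := by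
    rw [h1]
    simp [area_add_right, area_ofReal_mul_right, area_self, hvw]
  have h4 : area (F.der ξ vecV y) (w y) = (F.der ξ vecV 0).re := by
    rw [area_swap, h1]
    simp [area_add_right, area_ofReal_mul_right, area_self, area_swap (vecV y), hvw]
  rw [h2, h3, h4]
  push_cast
  ring

end InvariantFrame

/-! ### Nonexistence of an invariant frame for type 1.3¹.1 -/

section Metric131

variable {A B C : ℝ}

/-- The Ricci tensor is a multiple of ω², ω = area(v, dv), nonzero because C ≠ 0. Its constancy on
the frame makes all products ω(ξ)ω(ζ) constant, so ω is constant up to sign. -/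
theorem InvariantFrame.area_vecV_der
    (F : InvariantFrame (fun y ↦ matrixForm (metricField131 A B C y))) (hA : A ≠ 0) (hC : C ≠ 0)
    (ξ y : 𝔼[4]) : area (vecV y) (F.der ξ vecV y) = area (vecV 0) (F.der ξ vecV 0) := by
  have hsum : ∀ ξ ζ y : 𝔼[4], ∑ i, ∑ j, F.X ξ y i * F.X ζ y j *
      ricciCoord (metricField131 A B C) i j y = -(15 / 2) * (C / A) ^ 2 *
        (area (vecV y) (F.der ξ vecV y) * area (vecV y) (F.der ζ vecV y)) := by
    intro ξ ζ y
    simp only [ricciCoord_metricField131 B C hA, InvariantFrame.der, area_fderiv_vecV,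
      Fin.sum_univ_four]
    simp
    ring
  have hprod : ∀ ξ ζ y : 𝔼[4], area (vecV y) (F.der ξ vecV y) * area (vecV y) (F.der ζ vecV y) =
      area (vecV 0) (F.der ξ vecV 0) * area (vecV 0) (F.der ζ vecV 0) := by
    intro ξ ζ y
    have h := F.ricci_eq (fun i j ↦ (contDiff_metricField131 A B C i j).differentiable (by simp))
      (metricField131_symm A B C) (isUnit_metricField131 B C hA) (fun k i j ↦ by
        rw [christoffel_metricField131 B C hA]
        fin_cases k <;> fin_cases i <;> fin_cases j <;> simp [christoffel131] <;> fun_prop) ξ ζ y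
    rw [hsum, hsum] at h
    exact mul_left_cancel₀ (by simp [hA, hC]) h
  obtain ⟨ζ, hζ⟩ := (F.bijective 0).2 (EuclideanSpace.single 2 1)
  have hζ0 : area (vecV 0) (F.der ζ vecV 0) = -(1 / 2) := by
    have hζ' : F.X ζ 0 = EuclideanSpace.single 2 1 := hζ
    rw [InvariantFrame.der, area_fderiv_vecV, hζ']
    simp
  have hcont : Continuous fun y ↦ area (vecV y) (F.der ζ vecV y) := by
    have h1 := contDiff_vecV.continuous
    have h2 := (F.contDiff_der contDiff_vecV ζ).continuous
    unfold area
    fun_prop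
  have hζy : area (vecV y) (F.der ζ vecV y) = -(1 / 2) := by
    -- Connectedness of M fixes the sign for one field ζ with ω(ζ) ≠ 0. Division by ω(ζ) then
    -- settles every other field.
    refine isPreconnected_univ.eq_of_sq_eq (f := fun y ↦ area (vecV y) (F.der ζ vecV y))
      (g := fun _ ↦ -(1 / 2)) hcont.continuousOn continuousOn_const (fun z _ ↦ ?_) (by norm_num)
      (Set.mem_univ 0) hζ0 (Set.mem_univ y)
    have := hprod ζ ζ z
    rw [hζ0] at this
    simpa [pow_two] using this
  have := hprod ξ ζ y
  rw [hζy, hζ0] at this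
  linarith

/-- Constancy of ω on the frame gives 2 area(ξv, ζv) = −ω([ξ, ζ]), the structure equation for dω,
and the bracket again belongs to the frame. -/
theorem InvariantFrame.area_der_der
    (F : InvariantFrame (fun y ↦ matrixForm (metricField131 A B C y))) (hA : A ≠ 0) (hC : C ≠ 0)
    (ξ ζ y : 𝔼[4]) : area (F.der ξ vecV y) (F.der ζ vecV y) =
      area (F.der ξ vecV 0) (F.der ζ vecV 0) := by
  have h : ∀ y, 2 * area (F.der ξ vecV y) (F.der ζ vecV y) =
      -area (vecV y) (F.der (F.bracket ξ ζ) vecV y) := by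
    intro y
    have hv : Differentiable ℝ vecV := contDiff_vecV.differentiable (by simp)
    have h1 := fun ξ ζ ↦ F.area_der_add_area_der ξ hv
      ((F.contDiff_der contDiff_vecV ζ).differentiable (by simp)) (F.area_vecV_der hA hC ζ) y
    rw [F.der_bracket (contDiff_vecV.of_le (by norm_cast)), area_sub_right]
    linarith [h1 ξ ζ, h1 ζ ξ, area_swap (F.der ξ vecV y) (F.der ζ vecV y)]
  have h0 := h 0
  have hy := h y
  rw [F.area_vecV_der hA hC] at hy
  linarith

theorem exists_fderiv_vecV_ptX_eq (a b : ℂ) :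
    ∃ u : 𝔼[4], fderiv ℝ vecV 0 u = a ∧ fderiv ℝ ptX 0 u = b :=
  ⟨ofLogV a b, by simp [fderiv_vecV], by simp [fderiv_ptX]⟩

theorem not_nonempty_invariantFrame131 (hA : A ≠ 0) (hC : C ≠ 0) :
    ¬ Nonempty (InvariantFrame (fun y ↦ matrixForm (metricField131 A B C y))) := by
  rintro ⟨F⟩
  have hchoose : ∀ a b : ℂ, ∃ ξ, F.der ξ vecV 0 = a ∧ F.der ξ ptX 0 = b := by
    intro a b
    obtain ⟨u, h1, h2⟩ := exists_fderiv_vecV_ptX_eq a b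
    obtain ⟨ξ, rfl⟩ := (F.bijective 0).2 u
    exact ⟨ξ, h1, h2⟩
  -- The fields e, p, f, q are dual at the origin to the real and imaginary parts of dv and dx.
  obtain ⟨e, hVe0, hWe0⟩ := hchoose 1 0
  obtain ⟨p, hVp0, hWp0⟩ := hchoose Complex.I 0
  obtain ⟨f, hVf0, hWf0⟩ := hchoose 0 1
  obtain ⟨q, hVq0, hWq0⟩ := hchoose 0 Complex.I
  have hdec : ∀ g ξ y, F.der ξ g y =
      (F.der ξ vecV 0).re * F.der e g y + (F.der ξ vecV 0).im * F.der p g y +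
      (F.der ξ ptX 0).re * F.der f g y + (F.der ξ ptX 0).im * F.der q g y := by
    intro g ξ y
    have hlin : ∀ (g : 𝔼[4] → ℂ) (y : 𝔼[4]) (a b c d : ℝ),
        F.der (a • e + b • p + c • f + d • q) g y =
          a * F.der e g y + b * F.der p g y + c * F.der f g y + d * F.der q g y := by
      intro g y a b c d
      simp [InvariantFrame.der]
    have h : ξ = (F.der ξ vecV 0).re • e + (F.der ξ vecV 0).im • p +
        (F.der ξ ptX 0).re • f + (F.der ξ ptX 0).im • q := by
      refine F.X_injective 0 (sub_eq_zero.1 (eq_zero_of_fderiv_eq_zero (y := 0) ?_ ?_))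
      · rw [map_sub, sub_eq_zero]
        refine Eq.trans ?_ (hlin vecV 0 _ _ _ _).symm
        rw [hVe0, hVp0, hVf0, hVq0]
        simp [InvariantFrame.der]
      · rw [map_sub, sub_eq_zero]
        refine Eq.trans ?_ (hlin ptX 0 _ _ _ _).symm
        rw [hWe0, hWp0, hWf0, hWq0]
        simp [InvariantFrame.der]
    conv_lhs => rw [h]
    exact hlin g y _ _ _ _
  set w := F.der p vecV with hw
  have hvw : ∀ y, area (vecV y) (w y) = 1 := fun y ↦ by
    rw [hw, F.area_vecV_der hA hC, ← hw, hVp0, vecV_zero]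
    simp [area]
  -- In the basis v, w the coefficients of ξv are areas now known to be constant.
  have hV : ∀ ξ y, F.der ξ vecV y = area (F.der ξ vecV 0) Complex.I * vecV y +
      area 1 (F.der ξ vecV 0) * w y := by
    intro ξ y
    rw [eq_of_area_eq_one (hvw y) (F.der ξ vecV y), F.area_vecV_der hA hC, hw,
      F.area_der_der hA hC, ← hw, hVp0, vecV_zero]
  have hVe : F.der e vecV = vecV := funext fun y ↦ by rw [hV, hVe0]; simp [area]
  have hVf : F.der f vecV = fun _ ↦ 0 := funext fun y ↦ by rw [hV, hVf0]; simp [area]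
  have hVq : F.der q vecV = fun _ ↦ 0 := funext fun y ↦ by rw [hV, hVq0]; simp [area]
  have hform := fun ξ ζ y ↦ F.form_eq ξ ζ y
  simp only [matrixForm_metricField131] at hform
  change ∀ ξ ζ y, -2 * A * (area (F.der ξ vecV y) (F.der ζ ptX y)
        + area (F.der ζ vecV y) (F.der ξ ptX y))
      + 4 * B * (area (vecV y) (F.der ξ vecV y) * area (vecV y) (F.der ζ vecV y))
      - 2 * C * (area (vecV y) (F.der ξ vecV y) * area (vecV y) (F.der ζ ptX y)
        + area (vecV y) (F.der ζ vecV y) * area (vecV y) (F.der ξ ptX y)) =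
      -2 * A * (area (F.der ξ vecV 0) (F.der ζ ptX 0)
        + area (F.der ζ vecV 0) (F.der ξ ptX 0))
      + 4 * B * (area (vecV 0) (F.der ξ vecV 0) * area (vecV 0) (F.der ζ vecV 0))
      - 2 * C * (area (vecV 0) (F.der ξ vecV 0) * area (vecV 0) (F.der ζ ptX 0)
        + area (vecV 0) (F.der ζ vecV 0) * area (vecV 0) (F.der ξ ptX 0)) at hform
  have h1I : area 1 Complex.I = 1 := by simp [area]
  have hI1 : area Complex.I 1 = -1 := by simp [area]
  have hee := fun y ↦ hform e e y
  have hef := fun y ↦ hform e f y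
  have heq := fun y ↦ hform e q y
  have hep := fun y ↦ hform e p y
  have hpp := fun y ↦ hform p p y
  have hpf := fun y ↦ hform p f y
  have hpq := fun y ↦ hform p q y
  rw [← hw] at hep hpp hpf hpq
  have hw0 : w 0 = Complex.I := hVp0
  simp only [hVe, hVf, hVq, hWe0, hWp0, hWf0, hWq0, vecV_zero, hvw, area_self, area_zero_left,
    area_zero_right, hw0, h1I, hI1, mul_zero, zero_mul, add_zero, zero_add, sub_zero,
    mul_one, one_mul] at hee hef heq hep hpp hpf hpq
  have h2A : -2 * A ≠ 0 := by simp [hA]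
  have hμe : ∀ y, area (vecV y) (F.der e ptX y) = 0 := fun y ↦ by
    have := hee y
    have h2 : A * area (vecV y) (F.der e ptX y) = 0 := by linarith
    simpa [hA] using h2
  have hWf : F.der f ptX = vecV := by
    funext y
    have h1 : area (vecV y) (F.der f ptX y) = 0 := by simpa [hA] using hef y
    have h2 : area (w y) (F.der f ptX y) = -1 := by
      have := hpf y
      rw [h1] at this
      exact mul_left_cancel₀ h2A (by linarith)
    rw [eq_of_area_eq_one (hvw y) (F.der f ptX y), h1, area_swap, h2]
    simp
  have hWq : F.der q ptX = w := by
    funext y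
    have h1 : area (vecV y) (F.der q ptX y) = 1 := by simpa [hA] using heq y
    have h2 : area (w y) (F.der q ptX y) = 0 := by
      have := hpq y
      rw [h1] at this
      exact mul_left_cancel₀ h2A (by linarith)
    rw [eq_of_area_eq_one (hvw y) (F.der q ptX y), h1, area_swap, h2]
    simp
  -- The constant inner products determine dx on the frame except for this one function.
  set m : 𝔼[4] → ℝ := fun y ↦ area (vecV y) (F.der p ptX y) with hm
  have hmd : Differentiable ℝ m := by
    have h1 : Differentiable ℝ vecV := contDiff_vecV.differentiable (by simp)
    have h2 : Differentiable ℝ (F.der p ptX) :=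
      (F.contDiff_der contDiff_ptX p).differentiable (by simp)
    exact fun y ↦ (Complex.imCLM.hasFDerivAt.comp y
      ((Complex.conjCLE.hasFDerivAt.comp y (h1 y).hasFDerivAt).mul
        (h2 y).hasFDerivAt)).differentiableAt
  have hWe : F.der e ptX = fun y ↦ m y * vecV y := by
    funext y
    have h1 : area (w y) (F.der e ptX y) = -m y := by
      have := hep y
      rw [hμe y] at this
      exact mul_left_cancel₀ h2A (by linarith)
    rw [eq_of_area_eq_one (hvw y) (F.der e ptX y), hμe y, area_swap, h1]
    simp
  have hWp : F.der p ptX = fun y ↦ (C / A : ℝ) * (m y * vecV y) + m y * w y := by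
    funext y
    have h1 : area (w y) (F.der p ptX y) = -(C / A) * m y := by
      have := hpp y
      refine mul_left_cancel₀ h2A ?_
      field_simp
      linarith
    rw [eq_of_area_eq_one (hvw y) (F.der p ptX y), area_swap, h1]
    push_cast
    ring
  obtain ⟨a, ha⟩ := F.exists_fderiv_eq (C / A) (F.contDiff_der contDiff_vecV p) hmd hVe rfl hVf hVq
    hWe hWp hWf hWq hvw hw0 hdec
  exact false_of_fderiv_eq ((F.contDiff_der contDiff_vecV p).differentiable (by simp)) hvw a ha

theorem not_isIsometricToLieGroup_pseudoMetric131 (hA : A ≠ 0) (hC : C ≠ 0) :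
    ¬ (pseudoMetric131 B C hA).IsIsometricToLieGroup := fun h ↦
  not_nonempty_invariantFrame131 hA hC (InvariantFrame.nonempty_of_isIsometricToLieGroup h)

end Metric131

theorem PseudoRiemannianMetric.IsIsometricToSolvsoliton.isIsometricToLieGroup {n : ℕ} {M : Type}
    [TopologicalSpace M] [ChartedSpace 𝔼[n] M] [IsManifold (𝓡 n) ∞ M]
    {g : PseudoRiemannianMetric n M} (h : g.IsIsometricToSolvsoliton) :
    g.IsIsometricToLieGroup := by
  obtain ⟨L, i1, i2, i3, i4, g', -, h2, -, h4⟩ := h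
  exact ⟨L, i1, i2, i3, i4, g', h2, h4⟩

theorem mainTheorem4 :
    -- the pairs of types 1.3¹.1 and 1.4¹.2 are those of the Fels–Renner cases B1 and A2
    (∀ (𝔤 : Type) [LieRing 𝔤] [LieAlgebra ℝ 𝔤] (b : Module.Basis (Fin 5) ℝ 𝔤),
      IsKomrakov131_1 b → ∃ b' : Module.Basis (Fin 5) ℝ 𝔤,
        IsFelsRennerB1 b' ∧ Submodule.span ℝ {b 0} = Submodule.span ℝ {b' 2}) ∧
    (∀ (𝔤 : Type) [LieRing 𝔤] [LieAlgebra ℝ 𝔤] (p : ℝ) (b : Module.Basis (Fin 5) ℝ 𝔤),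
      IsKomrakov141_2 p b → ∃ b' : Module.Basis (Fin 5) ℝ 𝔤,
        IsFelsRennerA2 (p - 1) b' ∧ Submodule.span ℝ {b 0} = Submodule.span ℝ {b' 3}) ∧
    -- type 1.3¹.1: non-reductive, `M = ℝ⁴`, invariant solitons not isometric to Lie groups
    (∃ (S : HomogeneousSpace 5 4 (EuclideanSpace ℝ (Fin 4)))
        (b : Module.Basis (Fin 5) ℝ S.lieAlg),
      IsKomrakov131_1 b ∧ S.isotropyAlg = Submodule.span ℝ {b 0} ∧
      ¬ IsReductivePair S.isotropyAlg ∧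
      ∀ A B C : ℝ, A ≠ 0 → C ≠ 0 →
        ∃ g : PseudoRiemannianMetric 4 (EuclideanSpace ℝ (Fin 4)),
          IsInvariantMetricWith S b (metric131 A B C 0) g ∧
          IsInvariantRicciSoliton S g 0 ∧ ¬ g.IsEinstein ∧
          ¬ g.IsIsometricToLieGroup ∧ ¬ g.IsIsometricToSolvsoliton) ∧
    -- type 1.4¹.2: non-reductive, `M = ℝ⁴`; invariant solitons for `p = 1`
    (∀ p : ℝ, ∃ (S : HomogeneousSpace 5 4 (EuclideanSpace ℝ (Fin 4)))
        (b : Module.Basis (Fin 5) ℝ S.lieAlg),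
      IsKomrakov141_2 p b ∧ S.isotropyAlg = Submodule.span ℝ {b 0} ∧
      ¬ IsReductivePair S.isotropyAlg ∧
      (p = 1 → ∀ A B C D : ℝ, A ≠ 0 → D ≠ 0 →
        ∃ g : PseudoRiemannianMetric 4 (EuclideanSpace ℝ (Fin 4)),
          IsInvariantMetricWith S b (metric141 A B C D) g ∧
          IsInvariantRicciSoliton S g 0 ∧ (B ≠ 0 → ¬ g.IsEinstein))) := by
  refine ⟨fun 𝔤 _ _ b hb ↦ hb.exists_isFelsRennerB1, fun 𝔤 _ _ p b hb ↦ hb.exists_isFelsRennerA2,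
    ⟨action131.space, action131.basis, isKomrakov131_1_action131, isotropyAlg_action131, ?_,
      fun A B C hA hC ↦ ⟨pseudoMetric131 B C hA, isInvariantMetricWith_pseudoMetric131 B C hA,
        isInvariantRicciSoliton_pseudoMetric131 B C hA, not_isEinstein_pseudoMetric131 B hA hC,
        not_isIsometricToLieGroup_pseudoMetric131 hA hC,
        fun h ↦ not_isIsometricToLieGroup_pseudoMetric131 hA hC h.isIsometricToLieGroup⟩⟩,
    fun p ↦ ⟨(action141 p).space, (action141 p).basis, isKomrakov141_2_action141 p,
      isotropyAlg_action141 p, ?_, ?_⟩⟩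
  · rw [isotropyAlg_action131]
    exact not_isReductivePair_span (action131.basis.ne_zero 0) isKomrakov131_1_action131.1
  · rw [isotropyAlg_action141]
    exact not_isReductivePair_span ((action141 p).basis.ne_zero 0)
      (isKomrakov141_2_action141 p).2.2.2.1
  · rintro rfl A B C D hA hD
    exact ⟨pseudoMetric141 B C hA hD, isInvariantMetricWith_pseudoMetric141 B C hA hD,
      isInvariantRicciSoliton_pseudoMetric141 B C hA hD, not_isEinstein_pseudoMetric141 C hA hD⟩
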